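/- Let $X$ be a complex manifold (Hausdorff, second countable) of positive dimension and let $\Omega\subset X$ be a relatively compact domain with $C^\infty$-smooth boundary $M=\partial\Omega$, pseudoconvex from the side of $\Omega$: if $\rho$ is a local defining function ($\Omega=\{\rho<0\}$, $d\rho\ne0$ on $M$), then $\partial\bar\partial\rho(L,\bar L)\ge 0$ at points of $M$ for all $(1,0)$-vectors $L$ with $\partial\rho(L)=0$. Then $$0\le DF_s(M)\le DF_s(\Omega)\le DF_w(\Omega)\le DF_w(M)\le 1,$$ $$1\le S_w(M)\le S_w(\Omega)\le S_s(\Omega)\le S_s(M)\le\infty .$$ The indices are defined as follows (a supremum over no exponent is $0$, an infimum over no exponent is $\infty$). *Indices of $\Omega$.* $DF_s(\Omega)$ (resp. $DF_w(\Omega)$) is the supremum of the $\gamma\in(0,1)$ for which there are a smooth function $\rho\colon X\to\mathbb R$ with $\Omega=\{\rho<0\}$ and $d\rho\neq0$ on $M$, and an open neighborhood $W$ of $M$, such that $-(-\rho)^\gamma$ is strictly plurisubharmonic (resp. plurisubharmonic) on $\Omega\cap W$. $S_s(\Omega)$ (resp. $S_w(\Omega)$) is the infimum of the $\gamma>1$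 for which there are such $\rho$ and $W$ with $\rho^\gamma$ strictly plurisubharmonic (resp. plurisubharmonic) on $W\setminus\overline\Omega$. *Indices of $M$.* Let $T^{1,0}_M=T^{1,0}X\cap(\mathbb C\otimes TM)$ and $T^{0,1}_M=\overline{T^{1,0}_M}$. A trivialization is a smooth, purely imaginary, nowhere vanishing 1-form $\eta$ on $M$ annihilating $T^{1,0}_M\oplus T^{0,1}_M$; its Levi form is $\lambda_\eta(L,L')=\eta([L,\overline{L'}])$ for sections $L,L'$ of $T^{1,0}_M$, and $\eta$ is positive if $\lambda_\eta\ge0$. Let $\mathcal N\subset T^{1,0}_M$ be the kernel of the Levi form (it does not depend on $\eta$). For a smooth purely imaginary vector field $T$ with $\eta(T)=1$, the D'Angelo $(1,0)$-form $\omega_\eta$ is the complex linear form on $\mathbb C\otimes TM$ that annihilates $T^{0,1}_M\oplus\mathbb CT$ and satisfies $\omega_\eta(L)=\eta([T,L])$ for sections $L$ of $T^{1,0}_M$. Put $$\bar\partial_b\omega_\eta(L,\overline{L'})=d\omega_\eta(L,\overline{L'})=-\big(\overline{L'}(\omega_\eta(L))+\omega_\eta([L,\overline{L'}])\big),\qquad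 (\omega_\eta\wedge\bar\omega_\eta)(L,\bar L)=|\omega_\eta(L)|^2 .$$ The restrictions of these hermitian forms to $\mathcal N$ do not depend on $T$. Then $DF_s(M)$ (resp. $DF_w(M)$) is the supremum of the $\gamma\in(0,1)$ for which some positive trivialization $\eta$ makes the quadratic form $$\bar\partial_b\omega_\eta-\frac{\gamma}{1-\gamma}\,\omega_\eta\wedge\bar\omega_\eta$$ positive definite (resp. positive semi-definite) on $\mathcal N$, and $S_s(M)$ (resp. $S_w(M)$) is the infimum of the $\gamma>1$ for which some positive trivialization $\eta$ makes $$-\bar\partial_b\omega_\eta-\frac{\gamma}{\gamma-1}\,\omega_\eta\wedge\bar\omega_\eta$$ positive definite (resp. positive semi-definite) on $\mathcal N$. -/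

import Mathlib

open Set Manifold
open scoped ContDiff

noncomputable section

section CRManifold

variable {F : Type*} [NormedAddCommGroup F] [NormedSpace ℝ F]
  {M : Type*} [TopologicalSpace M] [ChartedSpace F M]

/-- The complexified tangent space `ℂ ⊗ T_p M`; the pair `(a, b)` stands for `a + i b`. -/
abbrev CTangent (F : Type*) [NormedAddCommGroup F] [NormedSpace ℝ F]
    {M : Type*} [TopologicalSpace M] [ChartedSpace F M] (p : M) : Type _ :=
  TangentSpace 𝓘(ℝ, F) p × TangentSpace 𝓘(ℝ, F) p

/-- Complex conjugation `a + i b ↦ a - i b` on a complexified tangent space. -/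
def cconj {p : M} (z : CTangent F p) : CTangent F p := (z.1, -z.2)

/-- The pointwise conjugate of a complexified vector field. -/
def conjField (Z : (p : M) → CTangent F p) : (p : M) → CTangent F p := fun p => cconj (Z p)

/-- The complex linear extension to `ℂ ⊗ T_p M` of a real linear map `T_p M → ℂ`. -/
def cext {p : M} (φ : TangentSpace 𝓘(ℝ, F) p →L[ℝ] ℂ) (z : CTangent F p) : ℂ :=
  φ z.1 + Complex.I * φ z.2

/-- The complex bilinear extension of the Lie bracket:
`[A + i B, C + i D] = ([A, C] - [B, D]) + i ([A, D] + [B, C])`. -/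
def cbracket (Z W : (p : M) → CTangent F p) (p : M) : CTangent F p :=
  (VectorField.mlieBracket 𝓘(ℝ, F) (fun q => (Z q).1) (fun q => (W q).1) p
      - VectorField.mlieBracket 𝓘(ℝ, F) (fun q => (Z q).2) (fun q => (W q).2) p,
    VectorField.mlieBracket 𝓘(ℝ, F) (fun q => (Z q).1) (fun q => (W q).2) p
      + VectorField.mlieBracket 𝓘(ℝ, F) (fun q => (Z q).2) (fun q => (W q).1) p)

/-- The derivative of a complex valued function in the direction of a complexified tangent
vector. -/
def cderiv (f : M → ℂ) {p : M} (z : CTangent F p) : ℂ :=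
  cext (F := F) (p := p) (mfderiv 𝓘(ℝ, F) 𝓘(ℝ, ℂ) f p) z

variable [IsManifold 𝓘(ℝ, F) ∞ M]

/-- A complexified vector field is smooth if its real and imaginary parts are. -/
def SmoothCField (Z : (p : M) → CTangent F p) : Prop :=
  ContMDiff 𝓘(ℝ, F) 𝓘(ℝ, F).tangent ∞
      (fun p => (⟨p, (Z p).1⟩ : TangentBundle 𝓘(ℝ, F) M)) ∧
    ContMDiff 𝓘(ℝ, F) 𝓘(ℝ, F).tangent ∞
      (fun p => (⟨p, (Z p).2⟩ : TangentBundle 𝓘(ℝ, F) M))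

/-- Smoothness of a complex valued 1-form on `M`, as a section of `Hom(TM, ℂ)`. -/
def SmoothForm (η : (p : M) → TangentSpace 𝓘(ℝ, F) p →L[ℝ] ℂ) : Prop :=
  ContMDiff 𝓘(ℝ, F) (𝓘(ℝ, F).prod 𝓘(ℝ, F →L[ℝ] ℂ)) ∞
    (fun p => Bundle.TotalSpace.mk' (F →L[ℝ] ℂ)
      (E := fun q : M => TangentSpace 𝓘(ℝ, F) q →L[ℝ] Bundle.Trivial M ℂ q) p (η p))

/-- `L ∈ Γ(T^{1,0})`: a smooth global section of the subbundle `T10` of `ℂ ⊗ TM`. -/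
def IsSection (T10 : (p : M) → Set (CTangent F p)) (L : (p : M) → CTangent F p) : Prop :=
  SmoothCField L ∧ ∀ p, L p ∈ T10 p

/-- A trivialization of `ℂ ⊗ TM / (T^{1,0} ⊕ T^{0,1})`: a smooth purely imaginary nowhere
vanishing 1-form that annihilates `T^{1,0} ⊕ T^{0,1}`. -/
structure IsTrivialization (T10 : (p : M) → Set (CTangent F p))
    (η : (p : M) → TangentSpace 𝓘(ℝ, F) p →L[ℝ] ℂ) : Prop where
  smooth : SmoothForm η
  imaginary : ∀ p v, (η p v).re = 0
  ne_zero : ∀ p, η p ≠ 0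
  annihilates : ∀ p, ∀ z ∈ T10 p, cext (η p) z = 0
  annihilates_conj : ∀ p, ∀ z ∈ T10 p, cext (η p) (cconj z) = 0

/-- The Levi form `λ_η(L, L') = η([L, conj L'])`, on sections of `T^{1,0}`. -/
def leviForm (η : (p : M) → TangentSpace 𝓘(ℝ, F) p →L[ℝ] ℂ)
    (L L' : (p : M) → CTangent F p) (p : M) : ℂ :=
  cext (η p) (cbracket L (conjField L') p)

/-- A positive trivialization: the Levi form (which is hermitian, so that its values on the
diagonal are real) is positive semi-definite. -/
def IsPositiveTrivialization (T10 : (p : M) → Set (CTangent F p))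
    (η : (p : M) → TangentSpace 𝓘(ℝ, F) p →L[ℝ] ℂ) : Prop :=
  IsTrivialization T10 η ∧ ∀ L, IsSection T10 L → ∀ p, 0 ≤ (leviForm η L L p).re

/-- The Levi null space `N_p ⊂ T^{1,0}_p`, the kernel of the Levi form at `p`. -/
def leviNull (T10 : (p : M) → Set (CTangent F p))
    (η : (p : M) → TangentSpace 𝓘(ℝ, F) p →L[ℝ] ℂ) (p : M) : Set (CTangent F p) :=
  {z | z ∈ T10 p ∧ ∀ L L', IsSection T10 L → IsSection T10 L' → L p = z →
    leviForm η L L' p = 0}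

/-- A (smooth, purely imaginary) transversal vector field normalized by `η(T) = 1`. -/
structure IsTransversal (η : (p : M) → TangentSpace 𝓘(ℝ, F) p →L[ℝ] ℂ)
    (T : (p : M) → CTangent F p) : Prop where
  smooth : SmoothCField T
  imaginary : ∀ p, (T p).1 = 0
  normalized : ∀ p, cext (η p) (T p) = 1

/-- `σ` is the D'Angelo (1,0)-form of `η` with respect to `T`: it annihilates `T^{0,1} ⊕ ℂ T`, and
on `T^{1,0}` it agrees with the D'Angelo 1-form `α_η(L) = η([T, L])`. Since
`ℂ ⊗ TM = T^{1,0} ⊕ T^{0,1} ⊕ ℂ T`, this determines `σ` uniquely. -/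
structure IsDAngeloForm (T10 : (p : M) → Set (CTangent F p))
    (η : (p : M) → TangentSpace 𝓘(ℝ, F) p →L[ℝ] ℂ) (T : (p : M) → CTangent F p)
    (σ : (p : M) → TangentSpace 𝓘(ℝ, F) p →L[ℝ] ℂ) : Prop where
  transversal : ∀ p, cext (σ p) (T p) = 0
  antiholomorphic : ∀ p, ∀ z ∈ T10 p, cext (σ p) (cconj z) = 0
  holomorphic : ∀ L, IsSection T10 L → ∀ p, cext (σ p) (L p) = cext (η p) (cbracket T L p)

/-- The (1,1)-form `∂̄_b σ`, i.e. the (1,1)-part of `dσ` for a (1,0)-form `σ`: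
`∂̄_b σ(L, conj L') = dσ(L, conj L') = -(conj L' (σ(L)) + σ([L, conj L']))`. -/
def dbarB (σ : (p : M) → TangentSpace 𝓘(ℝ, F) p →L[ℝ] ℂ)
    (L L' : (p : M) → CTangent F p) (p : M) : ℂ :=
  -(cderiv (fun q => cext (σ q) (L q)) (conjField L' p)
    + cext (σ p) (cbracket L (conjField L') p))

/-- The quadratic form `L ↦ a ∂̄_b σ(L, conj L) - c (σ ∧ conj σ)(L, conj L)`, where
`(σ ∧ conj σ)(L, conj L) = |σ(L)|²`. (On the Levi null space of a pseudoconvex CR manifold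
`∂̄_b σ` is hermitian, so that the first value is real.) -/
def indexForm (a c : ℝ) (σ : (p : M) → TangentSpace 𝓘(ℝ, F) p →L[ℝ] ℂ)
    (L : (p : M) → CTangent F p) (p : M) : ℝ :=
  a * (dbarB σ L L p).re - c * ‖cext (σ p) (L p)‖ ^ 2

/-- For some positive trivialization `η`, the form `a ∂̄_b σ_η - c σ_η ∧ conj σ_η` is positive
definite on the Levi null space. The restriction of this form to the null space does not depend on
the transversal field `T` from which `σ_η` is computed. -/
def PositiveOnNull (T10 : (p : M) → Set (CTangent F p)) (a c : ℝ) : Prop :=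
  ∃ η T σ, IsPositiveTrivialization T10 η ∧ IsTransversal η T ∧ IsDAngeloForm T10 η T σ ∧
    ∀ L, IsSection T10 L → ∀ p, L p ∈ leviNull T10 η p → L p ≠ 0 → 0 < indexForm a c σ L p

/-- The same condition with positive semi-definiteness. -/
def NonnegOnNull (T10 : (p : M) → Set (CTangent F p)) (a c : ℝ) : Prop :=
  ∃ η T σ, IsPositiveTrivialization T10 η ∧ IsTransversal η T ∧ IsDAngeloForm T10 η T σ ∧
    ∀ L, IsSection T10 L → ∀ p, L p ∈ leviNull T10 η p → 0 ≤ indexForm a c σ L p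

/-- Strong Diederich–Fornæss index of a CR manifold (`0` if no exponent is admissible, as
`sSup ∅ = 0` in `ℝ`). -/
def crDFStrong (T10 : (p : M) → Set (CTangent F p)) : ℝ :=
  sSup {γ : ℝ | 0 < γ ∧ γ < 1 ∧ PositiveOnNull T10 1 (γ / (1 - γ))}

/-- Weak Diederich–Fornæss index of a CR manifold. -/
def crDFWeak (T10 : (p : M) → Set (CTangent F p)) : ℝ :=
  sSup {γ : ℝ | 0 < γ ∧ γ < 1 ∧ NonnegOnNull T10 1 (γ / (1 - γ))}

/-- Strong Steinness index of a CR manifold (`⊤` if no exponent is admissible, as `sInf ∅ = ⊤`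
in `EReal`). -/
def crSteinStrong (T10 : (p : M) → Set (CTangent F p)) : EReal :=
  sInf {x : EReal | ∃ γ : ℝ, x = γ ∧ 1 < γ ∧ PositiveOnNull T10 (-1) (γ / (γ - 1))}

/-- Weak Steinness index of a CR manifold. -/
def crSteinWeak (T10 : (p : M) → Set (CTangent F p)) : EReal :=
  sInf {x : EReal | ∃ γ : ℝ, x = γ ∧ 1 < γ ∧ NonnegOnNull T10 (-1) (γ / (γ - 1))}

end CRManifold

section Domain

variable {E : Type*} [NormedAddCommGroup E] [NormedSpace ℂ E]
  {X : Type*} [TopologicalSpace X] [ChartedSpace E X]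

/-- The complex Hessian `∂∂̄u(v, conj v)` of a real function at `x`, for the (1,0)-vector
`∑ v_j ∂/∂z_j`, in the preferred holomorphic chart at `x`:
`∂∂̄u(v, conj v) = (D²u(v, v) + D²u(i v, i v)) / 4`. -/
def complexHessian (u : X → ℝ) (x : X) (v : E) : ℝ :=
  let D := fderiv ℝ (fderiv ℝ (u ∘ (extChartAt 𝓘(ℝ, E) x).symm)) (extChartAt 𝓘(ℝ, E) x x)
  (D v v + D (Complex.I • v) (Complex.I • v)) / 4

/-- Plurisubharmonicity on an open set, for `C²` functions. -/
def PshOn (u : X → ℝ) (S : Set X) : Prop :=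
  ContMDiffOn 𝓘(ℝ, E) 𝓘(ℝ, ℝ) 2 u S ∧ ∀ x ∈ S, ∀ v : E, 0 ≤ complexHessian u x v

/-- Strict plurisubharmonicity on an open set, for `C²` functions. -/
def StrictPshOn (u : X → ℝ) (S : Set X) : Prop :=
  ContMDiffOn 𝓘(ℝ, E) 𝓘(ℝ, ℝ) 2 u S ∧ ∀ x ∈ S, ∀ v : E, v ≠ 0 → 0 < complexHessian u x v

/-- `ρ` is a smooth defining function of `Ω` on the open set `U`: `Ω ∩ U = {ρ < 0}` and `dρ ≠ 0` on
`∂Ω ∩ U`. -/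
structure IsDefiningFunctionOn (E : Type*) [NormedAddCommGroup E] [NormedSpace ℂ E]
    {X : Type*} [TopologicalSpace X] [ChartedSpace E X]
    (Ω U : Set X) (ρ : X → ℝ) : Prop where
  isOpen : IsOpen U
  smooth : ContMDiffOn 𝓘(ℝ, E) 𝓘(ℝ, ℝ) ∞ ρ U
  mem_iff : ∀ x ∈ U, x ∈ Ω ↔ ρ x < 0
  mfderiv_ne_zero : ∀ x ∈ frontier Ω ∩ U, mfderiv 𝓘(ℝ, E) 𝓘(ℝ, ℝ) ρ x ≠ 0

/-- `Ω` has `C^∞`-smooth boundary. -/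
def HasSmoothBoundary (E : Type*) [NormedAddCommGroup E] [NormedSpace ℂ E]
    {X : Type*} [TopologicalSpace X] [ChartedSpace E X] (Ω : Set X) : Prop :=
  ∀ p ∈ frontier Ω, ∃ U ρ, p ∈ U ∧ IsDefiningFunctionOn E Ω U ρ

/-- The boundary of `Ω` is (Levi) pseudoconvex: `∂∂̄ρ(v, conj v) ≥ 0` at every boundary point for
every `v` with `∂ρ(v) = 0`, where `ρ` is any local defining function. -/
def HasPseudoconvexBoundary (E : Type*) [NormedAddCommGroup E] [NormedSpace ℂ E]
    {X : Type*} [TopologicalSpace X] [ChartedSpace E X] (Ω : Set X) : Prop :=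
  ∀ U ρ, IsDefiningFunctionOn E Ω U ρ → ∀ p ∈ frontier Ω ∩ U, ∀ v : E,
    mfderiv 𝓘(ℝ, E) 𝓘(ℝ, ℝ) ρ p v = 0 →
    mfderiv 𝓘(ℝ, E) 𝓘(ℝ, ℝ) ρ p (Complex.I • v : E) = 0 → 0 ≤ complexHessian ρ p v

/-- Strong Diederich–Fornæss index of a domain (`0` if no exponent is admissible). -/
def domainDFStrong (E : Type*) [NormedAddCommGroup E] [NormedSpace ℂ E]
    {X : Type*} [TopologicalSpace X] [ChartedSpace E X] (Ω : Set X) : ℝ :=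
  sSup {γ : ℝ | 0 < γ ∧ γ < 1 ∧ ∃ ρ, IsDefiningFunctionOn E Ω univ ρ ∧
    ∃ W, IsOpen W ∧ frontier Ω ⊆ W ∧
      StrictPshOn (E := E) (fun x => -(-ρ x) ^ γ) (Ω ∩ W)}

/-- Weak Diederich–Fornæss index of a domain. -/
def domainDFWeak (E : Type*) [NormedAddCommGroup E] [NormedSpace ℂ E]
    {X : Type*} [TopologicalSpace X] [ChartedSpace E X] (Ω : Set X) : ℝ :=
  sSup {γ : ℝ | 0 < γ ∧ γ < 1 ∧ ∃ ρ, IsDefiningFunctionOn E Ω univ ρ ∧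
    ∃ W, IsOpen W ∧ frontier Ω ⊆ W ∧
      PshOn (E := E) (fun x => -(-ρ x) ^ γ) (Ω ∩ W)}

/-- Strong Steinness index of a domain (`⊤` if no exponent is admissible). -/
def domainSteinStrong (E : Type*) [NormedAddCommGroup E] [NormedSpace ℂ E]
    {X : Type*} [TopologicalSpace X] [ChartedSpace E X] (Ω : Set X) : EReal :=
  sInf {x : EReal | ∃ γ : ℝ, x = γ ∧ 1 < γ ∧ ∃ ρ, IsDefiningFunctionOn E Ω univ ρ ∧
    ∃ W, IsOpen W ∧ frontier Ω ⊆ W ∧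
      StrictPshOn (E := E) (fun x => ρ x ^ γ) ((closure Ω)ᶜ ∩ W)}

/-- Weak Steinness index of a domain. -/
def domainSteinWeak (E : Type*) [NormedAddCommGroup E] [NormedSpace ℂ E]
    {X : Type*} [TopologicalSpace X] [ChartedSpace E X] (Ω : Set X) : EReal :=
  sInf {x : EReal | ∃ γ : ℝ, x = γ ∧ 1 < γ ∧ ∃ ρ, IsDefiningFunctionOn E Ω univ ρ ∧
    ∃ W, IsOpen W ∧ frontier Ω ⊆ W ∧
      PshOn (E := E) (fun x => ρ x ^ γ) ((closure Ω)ᶜ ∩ W)}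

/-- The CR structure induced on `M` by a map `ι` into a complex manifold: `T^{1,0}_p` consists of
the `a + i b` that `dι` maps to vectors of type (1,0), i.e. of the form `u - i J u`. The complex
structure `J` of the ambient manifold is multiplication by `Complex.I` in a holomorphic chart. -/
def inducedCR (E : Type*) [NormedAddCommGroup E] [NormedSpace ℂ E]
    {F : Type*} [NormedAddCommGroup F] [NormedSpace ℝ F]
    {X : Type*} [TopologicalSpace X] [ChartedSpace E X]
    {M : Type*} [TopologicalSpace M] [ChartedSpace F M] (ι : M → X) (p : M) :
    Set (CTangent F p) :=
  let dι : F →L[ℝ] E := mfderiv 𝓘(ℝ, F) 𝓘(ℝ, E) ι p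
  {z | dι z.2 = -(Complex.I • dι z.1)}

end Domain

end

/-! Near a boundary point everything is decided by one real form in the second and third derivatives
of a defining function `r`. Put s = 1 inside and s = -1 outside, and γ = 1 - sκ with κ > 0. Where t
= -s r is positive, the complex Hessian of -s t^γ at v is a positive multiple of H(v, v) +
(4κ/t)|∂r(v)|², where H is the hermitian part of the real Hessian of `r` (`hermPart_rpow`). Choose m
with ∂r(m) = 1, and write x = y - sτm with y on the boundary and v = w + τbm with ∂r(w) = 0 at y.
Since t is asymptotic to 2τ, the expression is the Levi form H(w, w) at y plus τ times a quadratic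
polynomial in b whose coefficients converge (`powerHess_eq_quadPoly`, `tendsto_expansion`). The Levi
form is nonnegative by pseudoconvexity; in its null directions the sign is that of the polynomial,
hence of its discriminant, which is 4κ times `leviIndex`. So plurisubharmonicity on one side forces
`leviIndex` to be nonnegative on null vectors (`leviIndex_nonneg`), and its positivity there gives
strict plurisubharmonicity near the point, by compactness of the unit sphere
(`eventually_powerHess_pos`).

The same form is intrinsic to the CR structure. If M is locally r = 0 and η is ± the restriction of
∂r, then η of a bracket of fields with constant contact value is a Hessian expression: the Levi form
of η is ±H, and the D'Angelo form is H(u, m)/2. One more differentiation yields ∂̄_b of the D'Angelo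
form on the null space (`LocalCR.re_dbarB`). With c = 1/κ - s the index form then equals `leviIndex`
(`LocalCR.indexForm_eq`), and c is γ/(1-γ) inside and γ/(γ-1) outside.

Globally, a defining function provides a contact form and a D'Angelo form (`nonnegOnNull_of_psh`).
Conversely, given η and T = iτ, local defining functions are rescaled until |dρ(Jτ)| = 2 and glued
by a partition of unity (`exists_normalized_global`); then η = ±∂ρ, and the local criterion applies
(`strictPsh_of_positiveOnNull`). The comparisons between M and Ω follow exponent by exponent. The
remaining inequalities say that strict implies weak, or come from the range of the exponents. -/

noncomputable section

/-! ### Algebra of hermitian parts, and quadratic polynomials in one complex variable. -/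

section LeviAlgebra

open Complex Filter Topology ComplexConjugate

variable {E : Type*} [NormedAddCommGroup E] [NormedSpace ℂ E]

/-- The sesquilinear form `D(u,w) + D(iu,iw) + i (D(u,iw) - D(iu,w))` of a real bilinear form. -/
def hermPart (D : E →L[ℝ] E →L[ℝ] ℝ) (u w : E) : ℂ :=
  ⟨D u w + D (I • u) (I • w), D u (I • w) - D (I • u) w⟩

/-- The complex bilinear form `(D(u,w) - D(iu,iw) - i (D(u,iw) + D(iu,w))) / 2` of a real bilinear
form. -/
def symmPart (D : E →L[ℝ] E →L[ℝ] ℝ) (u w : E) : ℂ :=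
  ⟨(D u w - D (I • u) (I • w)) / 2, -(D u (I • w) + D (I • u) w) / 2⟩

/-- The complex linear part `(ℓ(v) - i ℓ(iv)) / 2` of a real linear form. -/
def delPart (l : E →L[ℝ] ℝ) (v : E) : ℂ := ⟨l v / 2, -l (I • v) / 2⟩

lemma I_smul_I_smul (v : E) : I • I • v = -v := by
  rw [smul_smul, I_mul_I, neg_one_smul]

lemma complex_smul_eq (z : ℂ) (v : E) : z • v = z.re • v + z.im • I • v := by
  conv_lhs => rw [← Complex.re_add_im z, add_smul, mul_smul]
  rfl

lemma hermPart_add_left (D : E →L[ℝ] E →L[ℝ] ℝ) (u u' w : E) :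
    hermPart D (u + u') w = hermPart D u w + hermPart D u' w := by
  apply Complex.ext <;> simp [hermPart] <;> ring

lemma hermPart_add_right (D : E →L[ℝ] E →L[ℝ] ℝ) (u w w' : E) :
    hermPart D u (w + w') = hermPart D u w + hermPart D u w' := by
  apply Complex.ext <;> simp [hermPart] <;> ring

lemma hermPart_smul_left (D : E →L[ℝ] E →L[ℝ] ℝ) (z : ℂ) (u w : E) :
    hermPart D (z • u) w = z * hermPart D u w := by
  rw [complex_smul_eq z u]
  apply Complex.ext <;>
    simp [hermPart, I_smul_I_smul, smul_comm I (_ : ℝ) (_ : E)] <;> ring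

lemma hermPart_smul_right (D : E →L[ℝ] E →L[ℝ] ℝ) (z : ℂ) (u w : E) :
    hermPart D u (z • w) = conj z * hermPart D u w := by
  rw [complex_smul_eq z w]
  apply Complex.ext <;>
    simp [hermPart, I_smul_I_smul, smul_comm I (_ : ℝ) (_ : E)] <;> ring

lemma hermPart_neg_left (D : E →L[ℝ] E →L[ℝ] ℝ) (u w : E) :
    hermPart D (-u) w = -hermPart D u w := by
  simpa using hermPart_smul_left D (-1) u w

lemma hermPart_neg_right (D : E →L[ℝ] E →L[ℝ] ℝ) (u w : E) :
    hermPart D u (-w) = -hermPart D u w := by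
  simpa using hermPart_smul_right D (-1) u w

lemma hermPart_conj {D : E →L[ℝ] E →L[ℝ] ℝ} (hD : ∀ a b, D a b = D b a) (u w : E) :
    hermPart D w u = conj (hermPart D u w) := by
  apply Complex.ext <;> simp [hermPart, hD w u, hD (I • w) (I • u), hD w (I • u), hD (I • w) u]

lemma delPart_add (l : E →L[ℝ] ℝ) (v w : E) : delPart l (v + w) = delPart l v + delPart l w := by
  apply Complex.ext <;> simp [delPart] <;> ring

lemma delPart_smul (l : E →L[ℝ] ℝ) (z : ℂ) (v : E) : delPart l (z • v) = z * delPart l v := by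
  rw [complex_smul_eq z v]
  apply Complex.ext <;>
    simp [delPart, I_smul_I_smul, smul_comm I (_ : ℝ) (_ : E)] <;> ring

lemma delPart_eq_zero_iff (l : E →L[ℝ] ℝ) (v : E) :
    delPart l v = 0 ↔ l v = 0 ∧ l (I • v) = 0 := by
  simp [delPart, Complex.ext_iff]

lemma hermPart_add_smul_self {D : E →L[ℝ] E →L[ℝ] ℝ} (hD : ∀ a b, D a b = D b a) (w m : E)
    (b : ℂ) : (hermPart D (w + b • m) (w + b • m)).re =
      (hermPart D w w).re + 2 * (conj b * hermPart D w m).re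
        + ‖b‖ ^ 2 * (hermPart D m m).re := by
  rw [hermPart_add_left, hermPart_add_right, hermPart_add_right, hermPart_smul_left,
    hermPart_smul_left, hermPart_smul_right, hermPart_smul_right, hermPart_conj hD w m,
    Complex.sq_norm, Complex.normSq_apply]
  simp; ring

lemma delPart_apply_apply {D : E →L[ℝ] E →L[ℝ] ℝ} (hD : ∀ a b, D a b = D b a) (m u : E) :
    delPart (D m) u = ((1 / 2 : ℂ) * hermPart D u m + symmPart D u m) / 2 := by
  apply Complex.ext <;> simp [delPart, hermPart, symmPart, hD m u, hD m (I • u)] <;> ring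

/-- A null vector of a semi-definite form lies in its kernel: along z = -s g, with g the pairing of
u and w, the term linear in s is negative and dominates for small s. -/
lemma hermPart_eq_zero_of_nonneg {D : E →L[ℝ] E →L[ℝ] ℝ} (hD : ∀ a b, D a b = D b a) {u w : E}
    (hu : (hermPart D u u).re = 0) (h : ∀ z : ℂ, 0 ≤ (hermPart D (u + z • w) (u + z • w)).re) :
    hermPart D u w = 0 := by
  by_contra hne
  have hpos : 0 < ‖hermPart D u w‖ ^ 2 := by positivity
  set g := hermPart D u w with hg
  set K := (hermPart D w w).re
  have key : ∀ s : ℝ, 0 ≤ -(2 * s * ‖g‖ ^ 2) + s ^ 2 * ‖g‖ ^ 2 * K := by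
    intro s
    have := h (-(s : ℂ) * g)
    rw [hermPart_add_smul_self hD, hu, ← hg] at this
    have e1 : (conj (-(s : ℂ) * g) * g).re = -(s * ‖g‖ ^ 2) := by
      rw [Complex.sq_norm, Complex.normSq_apply]; simp; ring
    have e2 : ‖-(s : ℂ) * g‖ ^ 2 = s ^ 2 * ‖g‖ ^ 2 := by
      rw [norm_mul, mul_pow]; simp
    rw [e1, e2] at this
    linarith
  have h1 := key (1 / (|K| + 1))
  have hK : 0 < |K| + 1 := by positivity
  have h2 : (1 / (|K| + 1)) * K ≤ 1 := by
    rw [one_div, inv_mul_le_iff₀ hK]; linarith [le_abs_self K]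
  have h3 : 0 < 1 / (|K| + 1) := by positivity
  nlinarith [mul_pos h3 hpos, mul_le_mul_of_nonneg_left h2 (mul_pos h3 hpos).le]

/-- If `u` annihilates the complex kernel of `l`, `hermPart D u` is determined by its value on a
transversal vector. -/
lemma hermPart_eq_mul_conj_delPart {D : E →L[ℝ] E →L[ℝ] ℝ} {l : E →L[ℝ] ℝ} {u m : E}
    (hm : delPart l m = 1) (hu : ∀ w, l w = 0 → l (I • w) = 0 → hermPart D u w = 0) (w : E) :
    hermPart D u w = hermPart D u m * conj (delPart l w) := by
  have h0 : delPart l (w + (-delPart l w) • m) = 0 := by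
    rw [delPart_add, delPart_smul, hm]; ring
  obtain ⟨h1, h2⟩ := (delPart_eq_zero_iff _ _).1 h0
  have := hu _ h1 h2
  rw [hermPart_add_right, hermPart_smul_right, map_neg] at this
  linear_combination this

/-- A real quadratic polynomial on `ℂ`. -/
def quadPoly (A h k : ℝ) (c z e b : ℂ) : ℝ :=
  A + 2 * (conj b * c).re + ‖b‖ ^ 2 * h + k * ‖z * b + e‖ ^ 2

/-- A quarter of the discriminant of `quadPoly`, up to sign. -/
def quadDisc (A h k : ℝ) (c z e : ℂ) : ℝ :=
  (h + k * ‖z‖ ^ 2) * (A + k * ‖e‖ ^ 2) - ‖c + k * conj z * e‖ ^ 2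

/-- Completing the square: as a polynomial in b, the leading coefficient is h + k|z|², the mixed
coefficient c + k z̄ e, and the constant term A + k|e|². -/
lemma quadPoly_mul (A h k : ℝ) (c z e b : ℂ) :
    (h + k * ‖z‖ ^ 2) * quadPoly A h k c z e b =
      ‖(h + k * ‖z‖ ^ 2 : ℝ) * b + (c + k * conj z * e)‖ ^ 2 + quadDisc A h k c z e := by
  simp only [quadPoly, quadDisc, Complex.sq_norm, Complex.normSq_apply]
  simp
  ring

lemma quadPoly_pos {A h k : ℝ} {c z e : ℂ} (ha : 0 < h + k * ‖z‖ ^ 2)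
    (hd : 0 < quadDisc A h k c z e) (b : ℂ) : 0 < quadPoly A h k c z e b := by
  have := quadPoly_mul A h k c z e b
  have h2 : 0 < (h + k * ‖z‖ ^ 2) * quadPoly A h k c z e b := by
    rw [this]; positivity
  exact (pos_iff_pos_of_mul_pos h2).1 ha

lemma quadDisc_nonneg {A h k : ℝ} {c z e : ℂ} (ha : 0 < h + k * ‖z‖ ^ 2)
    (hq : ∀ b, 0 ≤ quadPoly A h k c z e b) : 0 ≤ quadDisc A h k c z e := by
  -- Evaluation at the minimizing b, where the completed square vanishes.
  have := quadPoly_mul A h k c z e (-(c + k * conj z * e) / (h + k * ‖z‖ ^ 2 : ℝ))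
  have h0 : ((h + k * ‖z‖ ^ 2 : ℝ) : ℂ) ≠ 0 := by exact_mod_cast ha.ne'
  rw [mul_div_cancel₀ _ h0] at this
  have h2 := mul_nonneg ha.le (hq (-(c + k * conj z * e) / (h + k * ‖z‖ ^ 2 : ℝ)))
  rw [this] at h2
  simpa using h2

/-- The form governing the first order behavior, near a boundary point, of the complex Hessian of
a power of a defining function: `D` and `D3` stand for the derivatives of order two and three of
the defining function, `m` for a transversal vector and `s` for the side. -/
def leviIndex (s κ : ℝ) (D : E →L[ℝ] E →L[ℝ] ℝ) (D3 : E →L[ℝ] E →L[ℝ] E →L[ℝ] ℝ) (u m : E) : ℝ :=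
  s * (-(1 / 2) * (hermPart (D3 m) u u).re
      + ((1 / 2 * hermPart D u m) * conj (symmPart D u m)).re
      + ‖(1 / 2 : ℂ) * hermPart D u m‖ ^ 2) - ‖(1 / 2 : ℂ) * hermPart D u m‖ ^ 2 / κ

/-- Because h = 0 and z = 1, the terms in |e|² cancel. What remains is 2κA - |g|² - 4κ Re(ḡ e) with
g = H(u, m), and `delPart_apply_apply` splits e into its hermitian and symmetric parts. -/
lemma quadDisc_eq_leviIndex (s : ℝ) {κ : ℝ} (hκ : 0 < κ) {D : E →L[ℝ] E →L[ℝ] ℝ}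
    (hD : ∀ a b, D a b = D b a)
    (D3 : E →L[ℝ] E →L[ℝ] E →L[ℝ] ℝ) (u m : E) :
    quadDisc (-s * (hermPart (D3 m) u u).re) 0 (2 * κ) (hermPart D u m) 1
      (-s * delPart (D m) u) = 4 * κ * leviIndex s κ D D3 u m := by
  rw [delPart_apply_apply hD, leviIndex]
  generalize hermPart D u m = g
  generalize symmPart D u m = S
  generalize (hermPart (D3 m) u u).re = A
  have hκ' := hκ.ne'
  simp only [quadDisc, Complex.sq_norm, Complex.normSq_apply]
  simp
  field_simp
  ring

end LeviAlgebra

/-! ### First order expansion of the complex Hessian of a power at the boundary. -/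

section BoundaryExpansion

open Complex Filter Topology ComplexConjugate

variable {E : Type*} [NormedAddCommGroup E] [NormedSpace ℂ E]

/-- Difference quotients of a strictly differentiable function along a fixed direction. -/
lemma HasStrictFDerivAt.tendsto_inv_smul_sub {G V α : Type*} [NormedAddCommGroup G]
    [NormedSpace ℝ G] [NormedAddCommGroup V] [NormedSpace ℝ V] {f : G → V} {f' : G →L[ℝ] V} {z : G}
    (hf : HasStrictFDerivAt f f' z) {l : Filter α} {a b : α → G} {τ : α → ℝ} {d : G}
    (ha : Tendsto a l (𝓝 z)) (hb : Tendsto b l (𝓝 z)) (hτ : ∀ᶠ i in l, τ i ≠ 0)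
    (hd : ∀ i, a i - b i = τ i • d) :
    Tendsto (fun i => (τ i)⁻¹ • (f (a i) - f (b i))) l (𝓝 (f' d)) := by
  have h1 := hf.isLittleO.comp_tendsto (ha.prodMk_nhds hb)
  have h2 : (fun i => a i - b i) =O[l] τ := by
    refine Asymptotics.IsBigO.of_bound ‖d‖ (Eventually.of_forall fun i => ?_)
    rw [hd, norm_smul, mul_comm]
  have h3 : (fun i => f (a i) - f (b i) - f' (a i - b i)) =o[l] τ := h1.trans_isBigO h2
  have h4 := h3.tendsto_inv_smul_nhds_zero
  have h5 : Tendsto (fun i => (τ i)⁻¹ • (f (a i) - f (b i) - f' (a i - b i)) + f' d) l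
      (𝓝 (0 + f' d)) := h4.add_const _
  rw [zero_add] at h5
  refine h5.congr' ?_
  filter_upwards [hτ] with i hi
  rw [hd, smul_sub, map_smul, smul_smul, inv_mul_cancel₀ hi, one_smul, sub_add_cancel]

/-- The complex Hessian of a power of a defining function `r`, on the side `s * r < 0`, up to a
positive factor. -/
def powerHess (s κ : ℝ) (r : E → ℝ) (x v : E) : ℝ :=
  (hermPart (fderiv ℝ (fderiv ℝ r) x) v v).re
    + 4 * κ / (-(s * r x)) * ‖delPart (fderiv ℝ r x) v‖ ^ 2

lemma hermPart_smul_self_re (D : E →L[ℝ] E →L[ℝ] ℝ) (c : ℝ) (v : E) :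
    (hermPart D (c • v) (c • v)).re = c ^ 2 * (hermPart D v v).re := by
  simp [hermPart, smul_comm I c v]; ring

lemma norm_delPart_smul (l : E →L[ℝ] ℝ) (c : ℝ) (v : E) :
    ‖delPart l (c • v)‖ ^ 2 = c ^ 2 * ‖delPart l v‖ ^ 2 := by
  simp only [delPart, smul_comm I c v, Complex.sq_norm, Complex.normSq_apply]; simp; ring

lemma powerHess_smul (s κ : ℝ) (r : E → ℝ) (x v : E) (c : ℝ) :
    powerHess s κ r x (c • v) = c ^ 2 * powerHess s κ r x v := by
  rw [powerHess, powerHess, hermPart_smul_self_re, norm_delPart_smul]; ring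

/-- Comparison of the complex Hessian at two points `x`, `y` with `v = w + τ b m`. -/
lemma powerHess_eq_quadPoly {s κ : ℝ} {r : E → ℝ} {x y w m : E} {τ : ℝ} {b : ℂ}
    (hx : ∀ a c, fderiv ℝ (fderiv ℝ r) x a c = fderiv ℝ (fderiv ℝ r) x c a)
    (hw : delPart (fderiv ℝ r y) w = 0) (hτ : τ ≠ 0) :
    powerHess s κ r x (w + (τ * b) • m) = (hermPart (fderiv ℝ (fderiv ℝ r) y) w w).re +
      τ * quadPoly
        (τ⁻¹ • ((hermPart (fderiv ℝ (fderiv ℝ r) x) w w).re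
          - (hermPart (fderiv ℝ (fderiv ℝ r) y) w w).re))
        (τ * (hermPart (fderiv ℝ (fderiv ℝ r) x) m m).re)
        (4 * κ * (τ⁻¹ • (-(s * r x)))⁻¹)
        (hermPart (fderiv ℝ (fderiv ℝ r) x) w m)
        (delPart (fderiv ℝ r y) m)
        (τ⁻¹ • (delPart (fderiv ℝ r x) (w + (τ * b) • m)
          - delPart (fderiv ℝ r y) (w + (τ * b) • m))) b := by
  -- Since ∂r(w) = 0 at y, the quotient ∂r(v)/τ at x is the value ∂r(m) b at y plus a difference
  -- quotient; both stay bounded as τ tends to 0.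
  have h1 : delPart (fderiv ℝ r y) m * b + τ⁻¹ • (delPart (fderiv ℝ r x) (w + (τ * b) • m)
          - delPart (fderiv ℝ r y) (w + (τ * b) • m))
      = τ⁻¹ • delPart (fderiv ℝ r x) (w + (τ * b) • m) := by
    have hτ' : (τ : ℂ) ≠ 0 := by exact_mod_cast hτ
    rw [delPart_add (fderiv ℝ r y), hw, delPart_smul (fderiv ℝ r y)]
    simp only [Complex.real_smul, Complex.ofReal_inv]
    field_simp
    ring
  rw [quadPoly, h1, powerHess, hermPart_add_smul_self hx, norm_smul, mul_pow]
  have e : (conj ((τ : ℂ) * b) * hermPart (fderiv ℝ (fderiv ℝ r) x) w m).re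
      = τ * (conj b * hermPart (fderiv ℝ (fderiv ℝ r) x) w m).re := by
    simp; ring
  rw [e]
  simp only [norm_mul, Complex.norm_real, mul_pow, Real.norm_eq_abs, abs_inv, inv_pow, sq_abs,
    smul_eq_mul, mul_inv, inv_inv]
  field_simp
  ring

lemma continuous_quadDisc : Continuous fun p : ℝ × ℝ × ℝ × ℂ × ℂ × ℂ =>
    quadDisc p.1 p.2.1 p.2.2.1 p.2.2.2.1 p.2.2.2.2.1 p.2.2.2.2.2 := by
  unfold quadDisc; fun_prop

lemma continuous_quadPoly (b : ℂ) : Continuous fun p : ℝ × ℝ × ℝ × ℂ × ℂ × ℂ =>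
    quadPoly p.1 p.2.1 p.2.2.1 p.2.2.2.1 p.2.2.2.2.1 p.2.2.2.2.2 b := by
  unfold quadPoly; fun_prop

lemma hermPart_eq (D : E →L[ℝ] E →L[ℝ] ℝ) (u w : E) :
    hermPart D u w = ((D u w + D (I • u) (I • w) : ℝ) : ℂ)
      + ((D u (I • w) - D (I • u) w : ℝ) : ℂ) * I := by
  apply Complex.ext <;> simp [hermPart]

lemma delPart_eq (l : E →L[ℝ] ℝ) (v : E) :
    delPart l v = ((l v / 2 : ℝ) : ℂ) + ((-l (I • v) / 2 : ℝ) : ℂ) * I := by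
  apply Complex.ext <;> simp [delPart]

lemma Filter.Tendsto.clm_apply' {α G V : Type*} [NormedAddCommGroup G] [NormedSpace ℝ G]
    [NormedAddCommGroup V] [NormedSpace ℝ V] {f : Filter α} {A : α → G →L[ℝ] V} {A₀ : G →L[ℝ] V}
    {v : α → G} {v₀ : G} (hA : Tendsto A f (𝓝 A₀)) (hv : Tendsto v f (𝓝 v₀)) :
    Tendsto (fun i => A i (v i)) f (𝓝 (A₀ v₀)) :=
  (isBoundedBilinearMap_apply.continuous.tendsto (A₀, v₀)).comp (hA.prodMk_nhds hv)

lemma tendsto_hermPart {α : Type*} {f : Filter α} {D : α → E →L[ℝ] E →L[ℝ] ℝ}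
    {D₀ : E →L[ℝ] E →L[ℝ] ℝ} {u w : α → E} {u₀ w₀ : E} (hD : Tendsto D f (𝓝 D₀))
    (hu : Tendsto u f (𝓝 u₀)) (hw : Tendsto w f (𝓝 w₀)) :
    Tendsto (fun i => hermPart (D i) (u i) (w i)) f (𝓝 (hermPart D₀ u₀ w₀)) := by
  simp only [hermPart_eq]
  have hu' := hu.const_smul I
  have hw' := hw.const_smul I
  exact ((Complex.continuous_ofReal.tendsto _).comp
    (((hD.clm_apply' hu).clm_apply' hw).add ((hD.clm_apply' hu').clm_apply' hw'))).add
    (((Complex.continuous_ofReal.tendsto _).comp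
    (((hD.clm_apply' hu).clm_apply' hw').sub ((hD.clm_apply' hu').clm_apply' hw))).mul_const I)

lemma tendsto_hermPart_re {α : Type*} {f : Filter α} {D : α → E →L[ℝ] E →L[ℝ] ℝ}
    {D₀ : E →L[ℝ] E →L[ℝ] ℝ} {u w : α → E} {u₀ w₀ : E} (hD : Tendsto D f (𝓝 D₀))
    (hu : Tendsto u f (𝓝 u₀)) (hw : Tendsto w f (𝓝 w₀)) :
    Tendsto (fun i => (hermPart (D i) (u i) (w i)).re) f (𝓝 (hermPart D₀ u₀ w₀).re) :=
  (Complex.continuous_re.tendsto _).comp (tendsto_hermPart hD hu hw)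

lemma tendsto_delPart {α : Type*} {f : Filter α} {l : α → E →L[ℝ] ℝ}
    {l₀ : E →L[ℝ] ℝ} {u : α → E} {u₀ : E} (hl : Tendsto l f (𝓝 l₀))
    (hu : Tendsto u f (𝓝 u₀)) :
    Tendsto (fun i => delPart (l i) (u i)) f (𝓝 (delPart l₀ u₀)) := by
  simp only [delPart_eq]
  exact ((Complex.continuous_ofReal.tendsto _).comp ((hl.clm_apply' hu).div_const 2)).add
    (((Complex.continuous_ofReal.tendsto _).comp
      ((hl.clm_apply' (hu.const_smul I)).neg.div_const 2)).mul_const I)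

lemma contDiffAt_fderiv_two {r : E → ℝ} {x₀ : E} (hr : ContDiffAt ℝ 4 r x₀) :
    ContDiffAt ℝ 2 (fderiv ℝ (fderiv ℝ r)) x₀ :=
  (hr.fderiv_right (m := 3) (by norm_num)).fderiv_right (by norm_num)

/-- Strict differentiability in the pair (point, vector) lets both base points and the vector move
in the limit. The two ends of the difference quotient carry the same vector, so only directions (d,
0) have to be evaluated. -/
lemma hasStrictFDerivAt_hermPart_re {r : E → ℝ} {x₀ : E} (hr : ContDiffAt ℝ 4 r x₀) (u : E) :
    ∃ f' : E × E →L[ℝ] ℝ, HasStrictFDerivAt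
      (fun p : E × E => (hermPart (fderiv ℝ (fderiv ℝ r) p.1) p.2 p.2).re) f' (x₀, u) ∧
      ∀ d, f' (d, 0) = (hermPart (fderiv ℝ (fderiv ℝ (fderiv ℝ r)) x₀ d) u u).re := by
  have h2 := contDiffAt_fderiv_two hr
  have hD : HasStrictFDerivAt (fun p : E × E => fderiv ℝ (fderiv ℝ r) p.1)
      ((fderiv ℝ (fderiv ℝ (fderiv ℝ r)) x₀).comp (ContinuousLinearMap.fst ℝ E E)) (x₀, u) :=
    HasStrictFDerivAt.comp (f := Prod.fst) (x₀, u) (h2.hasStrictFDerivAt (by norm_num))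
      hasStrictFDerivAt_fst
  have hs : HasStrictFDerivAt (fun p : E × E => p.2) (ContinuousLinearMap.snd ℝ E E) (x₀, u) :=
    hasStrictFDerivAt_snd
  have hs' : HasStrictFDerivAt (fun p : E × E => I • p.2)
      (I • (ContinuousLinearMap.snd ℝ E E)) (x₀, u) := hs.const_smul I
  exact ⟨_, ((hD.clm_apply hs).clm_apply hs).add ((hD.clm_apply hs').clm_apply hs'),
    fun d => by simp [hermPart]⟩

lemma hasStrictFDerivAt_delPart {r : E → ℝ} {x₀ : E} (hr : ContDiffAt ℝ 4 r x₀) (u : E) :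
    ∃ f' : E × E →L[ℝ] ℂ, HasStrictFDerivAt
      (fun p : E × E => delPart (fderiv ℝ r p.1) p.2) f' (x₀, u) ∧
      ∀ d, f' (d, 0) = delPart (fderiv ℝ (fderiv ℝ r) x₀ d) u := by
  have h2 : ContDiffAt ℝ 3 (fderiv ℝ r) x₀ := hr.fderiv_right (by norm_num)
  have hD : HasStrictFDerivAt (fun p : E × E => fderiv ℝ r p.1)
      ((fderiv ℝ (fderiv ℝ r) x₀).comp (ContinuousLinearMap.fst ℝ E E)) (x₀, u) :=
    HasStrictFDerivAt.comp (f := Prod.fst) (x₀, u) (h2.hasStrictFDerivAt (by norm_num))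
      hasStrictFDerivAt_fst
  have hs : HasStrictFDerivAt (fun p : E × E => p.2) (ContinuousLinearMap.snd ℝ E E) (x₀, u) :=
    hasStrictFDerivAt_snd
  have hs' : HasStrictFDerivAt (fun p : E × E => I • p.2)
      (I • (ContinuousLinearMap.snd ℝ E E)) (x₀, u) := hs.const_smul I
  have h1 := ((hD.clm_apply hs).const_smul (1 / 2 : ℝ)).prodMk
    ((hD.clm_apply hs').const_smul (-1 / 2 : ℝ))
  have h3 := (Complex.equivRealProdCLM.symm : ℝ × ℝ →L[ℝ] ℂ).hasStrictFDerivAt.comp (x₀, u) h1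
  refine ⟨_, h3.congr_of_eventuallyEq (Eventually.of_forall fun p => ?_), fun d => ?_⟩
  · apply Complex.ext <;> simp [delPart] <;> ring
  · apply Complex.ext <;> simp [delPart] <;> ring

lemma eventually_symm {r : E → ℝ} {x₀ : E} (hr : ContDiffAt ℝ 4 r x₀) :
    ∀ᶠ x in 𝓝 x₀, ∀ a b, fderiv ℝ (fderiv ℝ r) x a b = fderiv ℝ (fderiv ℝ r) x b a := by
  filter_upwards [hr.eventually (by norm_num)] with x hx a b
  exact (hx.isSymmSndFDerivAt (by norm_num)).eq a b

lemma delPart_of_normalized {l : E →L[ℝ] ℝ} {m : E} (hm : l m = 2) (hm' : l (I • m) = 0) :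
    delPart l m = 1 := by
  simp [delPart, hm, hm', Complex.ext_iff]

/-- The limit, at a boundary point, of the parameters in `powerHess_eq_quadPoly`. -/
lemma tendsto_expansion {α : Type*} {f : Filter α} {s κ : ℝ} {r : E → ℝ} {x₀ m u : E}
    (hr : ContDiffAt ℝ 4 r x₀) (hm : fderiv ℝ r x₀ m = 2)
    (hm' : fderiv ℝ r x₀ (I • m) = 0) (hs : s ^ 2 = 1) {x y w v : α → E} {τ : α → ℝ}
    (hx : Tendsto x f (𝓝 x₀)) (hy : Tendsto y f (𝓝 x₀)) (hw : Tendsto w f (𝓝 u))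
    (hv : Tendsto v f (𝓝 u)) (hτ : Tendsto τ f (𝓝 0)) (hτ0 : ∀ᶠ i in f, τ i ≠ 0)
    (hd : ∀ i, x i - y i = τ i • (-s) • m) (hy0 : ∀ᶠ i in f, r (y i) = 0) :
    Tendsto (fun i => ((τ i)⁻¹ • ((hermPart (fderiv ℝ (fderiv ℝ r) (x i)) (w i) (w i)).re
          - (hermPart (fderiv ℝ (fderiv ℝ r) (y i)) (w i) (w i)).re),
        τ i * (hermPart (fderiv ℝ (fderiv ℝ r) (x i)) m m).re,
        4 * κ * ((τ i)⁻¹ • (-(s * r (x i))))⁻¹,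
        hermPart (fderiv ℝ (fderiv ℝ r) (x i)) (w i) m,
        delPart (fderiv ℝ r (y i)) m,
        (τ i)⁻¹ • (delPart (fderiv ℝ r (x i)) (v i) - delPart (fderiv ℝ r (y i)) (v i)))) f
      (𝓝 (-s * (hermPart (fderiv ℝ (fderiv ℝ (fderiv ℝ r)) x₀ m) u u).re, 0, 2 * κ,
        hermPart (fderiv ℝ (fderiv ℝ r) x₀) u m, 1,
        -s * delPart (fderiv ℝ (fderiv ℝ r) x₀ m) u)) := by
  have hD : Tendsto (fun i => fderiv ℝ (fderiv ℝ r) (x i)) f (𝓝 (fderiv ℝ (fderiv ℝ r) x₀)) :=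
    (contDiffAt_fderiv_two hr).continuousAt.tendsto.comp hx
  have hl : Tendsto (fun i => fderiv ℝ r (y i)) f (𝓝 (fderiv ℝ r x₀)) :=
    ((hr.fderiv_right (m := 3) (by norm_num)).continuousAt.tendsto).comp hy
  refine Tendsto.prodMk_nhds ?_ (Tendsto.prodMk_nhds ?_ (Tendsto.prodMk_nhds ?_
    (Tendsto.prodMk_nhds ?_ (Tendsto.prodMk_nhds ?_ ?_))))
  · obtain ⟨f', hf', hf'd⟩ := hasStrictFDerivAt_hermPart_re hr u
    have := hf'.tendsto_inv_smul_sub (a := fun i => (x i, w i)) (b := fun i => (y i, w i))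
      (d := ((-s) • m, 0)) (hx.prodMk_nhds hw) (hy.prodMk_nhds hw) hτ0 (fun i => by simp [hd i])
    rw [hf'd, map_smul] at this
    convert this using 2
    simp [hermPart]; ring
  · simpa only [zero_mul] using
      hτ.mul (tendsto_hermPart_re hD tendsto_const_nhds tendsto_const_nhds)
  -- From dr(-s m) = -2s and r = 0 at y, the ratio -s r(x)/τ tends to 2 s² = 2, whence the limit
  -- 4κ/2.
  · have h1 := (hr.hasStrictFDerivAt (by norm_num)).tendsto_inv_smul_sub hx hy hτ0 hd
    rw [map_smul, hm] at h1
    have h2 : Tendsto (fun i => (τ i)⁻¹ • (-(s * r (x i)))) f (𝓝 2) := by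
      have h3 := h1.const_mul (-s)
      have e : -s * ((-s) • (2 : ℝ)) = 2 := by rw [smul_eq_mul]; linear_combination 2 * hs
      rw [e] at h3
      refine h3.congr' ?_
      filter_upwards [hy0] with i hi
      rw [hi]; simp; ring
    have h3 := (h2.inv₀ two_ne_zero).const_mul (4 * κ)
    convert h3 using 2
    ring
  · exact tendsto_hermPart hD hw tendsto_const_nhds
  · rw [← delPart_of_normalized hm hm']
    exact tendsto_delPart hl tendsto_const_nhds
  · obtain ⟨f', hf', hf'd⟩ := hasStrictFDerivAt_delPart hr u
    have := hf'.tendsto_inv_smul_sub (a := fun i => (x i, v i)) (b := fun i => (y i, v i))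
      (d := ((-s) • m, 0)) (hx.prodMk_nhds hv) (hy.prodMk_nhds hv) hτ0 (fun i => by simp [hd i])
    rw [hf'd, map_smul] at this
    convert this using 2
    apply Complex.ext <;> simp [delPart] <;> ring

/-- If a power of a defining function is plurisubharmonic on one side of the boundary, the form
`leviIndex` is nonnegative on the null space of the Levi form. -/
theorem leviIndex_nonneg {s κ : ℝ} {r : E → ℝ} {x₀ m u : E}
    (hr : ContDiffAt ℝ 4 r x₀) (h0 : r x₀ = 0) (hm : fderiv ℝ r x₀ m = 2)
    (hm' : fderiv ℝ r x₀ (I • m) = 0) (hs : s ^ 2 = 1) (hκ : 0 < κ)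
    (hu : fderiv ℝ r x₀ u = 0) (hu' : fderiv ℝ r x₀ (I • u) = 0)
    (hnull : (hermPart (fderiv ℝ (fderiv ℝ r) x₀) u u).re = 0)
    (hpsh : ∀ᶠ x in 𝓝 x₀, s * r x < 0 → ∀ v, 0 ≤ powerHess s κ r x v) :
    0 ≤ leviIndex s κ (fderiv ℝ (fderiv ℝ r) x₀) (fderiv ℝ (fderiv ℝ (fderiv ℝ r)) x₀) u m := by
  have hsym := eventually_symm hr
  have hκ4 : 0 < 4 * κ := by positivity
  refine nonneg_of_mul_nonneg_right ?_ hκ4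
  rw [← quadDisc_eq_leviIndex s hκ hsym.self_of_nhds]
  -- For fixed b, the hypothesis is tested at the points x₀ - τ s m on the vectors u + τ b m. The
  -- Levi term at x₀ is zero, so dividing by τ and letting τ decrease to 0 leaves the limit
  -- polynomial at b.
  refine quadDisc_nonneg (by simp; positivity) fun b => ?_
  have hτ : Tendsto (fun τ : ℝ => τ) (𝓝[>] 0) (𝓝 0) := tendsto_nhdsWithin_of_tendsto_nhds tendsto_id
  have hpos : ∀ᶠ τ : ℝ in 𝓝[>] 0, 0 < τ := eventually_mem_nhdsWithin
  have hx : Tendsto (fun τ : ℝ => x₀ + τ • (-s) • m) (𝓝[>] 0) (𝓝 x₀) := by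
    simpa using (hτ.smul_const ((-s) • m)).const_add x₀
  have hv : Tendsto (fun τ : ℝ => u + ((τ : ℂ) * b) • m) (𝓝[>] 0) (𝓝 u) := by
    have : Tendsto (fun τ : ℝ => (τ : ℂ) * b) (𝓝[>] 0) (𝓝 0) := by
      simpa using ((Complex.continuous_ofReal.tendsto _).comp hτ).mul_const b
    simpa using (this.smul_const m).const_add u
  have hlim := tendsto_expansion (κ := κ) (f := 𝓝[>] (0 : ℝ)) hr hm hm' hs hx
    (y := fun _ => x₀) tendsto_const_nhds (w := fun _ => u) tendsto_const_nhds hv hτ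
    (hpos.mono fun _ h => h.ne') (fun τ => by simp) (Eventually.of_forall fun _ => h0)
  have hlim2 := ((continuous_quadPoly b).tendsto _).comp hlim
  refine ge_of_tendsto hlim2 ?_
  have hside : ∀ᶠ τ : ℝ in 𝓝[>] 0, s * r (x₀ + τ • (-s) • m) < 0 := by
    have h1 := (hr.hasStrictFDerivAt (by norm_num)).tendsto_inv_smul_sub (l := 𝓝[>] (0 : ℝ)) hx
      (b := fun _ => x₀) (d := (-s) • m) tendsto_const_nhds (hpos.mono fun _ h => h.ne')
      (fun τ => by simp)
    rw [map_smul, hm, h0] at h1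
    have h3 := h1.const_mul s
    have e : s * ((-s) • (2 : ℝ)) = -2 := by rw [smul_eq_mul]; linear_combination (-2) * hs
    rw [e] at h3
    filter_upwards [h3.eventually (gt_mem_nhds (show (-2 : ℝ) < 0 by norm_num)), hpos] with τ h hp
    have : s * τ⁻¹ • (r (x₀ + τ • (-s) • m) - 0) = τ⁻¹ * (s * r (x₀ + τ • (-s) • m)) := by
      simp; ring
    rw [this] at h
    exact neg_of_mul_neg_right h (by positivity)
  filter_upwards [hside, hpos, hx.eventually hpsh, hx.eventually hsym] with τ h1 h2 h3 h4
  have h5 := h3 h1 (u + ((τ : ℂ) * b) • m)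
  rw [powerHess_eq_quadPoly (y := x₀) h4 ((delPart_eq_zero_iff _ _).2 ⟨hu, hu'⟩) h2.ne'] at h5
  replace h5 := h5.trans_eq (congrArg (· + _) hnull |>.trans (zero_add _))
  exact nonneg_of_mul_nonneg_right h5 h2

/-- The points of one side of a boundary are obtained from the boundary by moving along a fixed
transversal direction. -/
lemma exists_boundary_point {s : ℝ} {r : E → ℝ} {x₀ m : E} (hr : ContDiffAt ℝ 4 r x₀)
    (h0 : r x₀ = 0) (hm : fderiv ℝ r x₀ m = 2) (hs : s ^ 2 = 1) :
    ∃ τ : E → ℝ, Tendsto τ (𝓝[{x | s * r x < 0}] x₀) (𝓝 0) ∧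
      ∀ᶠ x in 𝓝[{x | s * r x < 0}] x₀, 0 < τ x ∧ r (x + τ x • s • m) = 0 := by
  classical
  -- The bound σ ≤ -(s r(x)) is part of the choice, so that τ tends to 0 whatever solution is
  -- picked; the default value 0 respects it.
  let τ : E → ℝ := fun x =>
    if h : ∃ σ, 0 < σ ∧ σ ≤ -(s * r x) ∧ r (x + σ • s • m) = 0 then h.choose else 0
  have hs1 : |s| = 1 := by rw [← sq_eq_sq₀ (abs_nonneg s) zero_le_one, sq_abs, hs, one_pow]
  have hτle : ∀ x, 0 ≤ τ x ∧ τ x ≤ |r x| := by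
    intro x
    by_cases h : ∃ σ, 0 < σ ∧ σ ≤ -(s * r x) ∧ r (x + σ • s • m) = 0
    · simp only [τ, dif_pos h]
      refine ⟨h.choose_spec.1.le, h.choose_spec.2.1.trans ((neg_le_abs _).trans ?_)⟩
      rw [abs_mul, hs1, one_mul]
    · simp [τ, dif_neg h]
  have hr0 : Tendsto (fun x => |r x|) (𝓝 x₀) (𝓝 0) := by
    have := hr.continuousAt.abs.tendsto
    rwa [h0, abs_zero] at this
  refine ⟨τ, tendsto_nhdsWithin_of_tendsto_nhds
    (squeeze_zero (fun x => (hτle x).1) (fun x => (hτle x).2) hr0), ?_⟩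
  -- With this constant the linearization error over a displacement of length t‖m‖ is at most t.
  have hstrict := (hr.hasStrictFDerivAt (by norm_num)).isLittleO.def
    (show 0 < 1 / (‖m‖ + 1) by positivity)
  have hcont : ContinuousAt (fun p : E × ℝ => (p.1 + p.2 • s • m, p.1)) (x₀, 0) := by fun_prop
  have hc2 : Tendsto (fun p : E × ℝ => (p.1 + p.2 • s • m, p.1)) (𝓝 x₀ ×ˢ 𝓝 0) (𝓝 (x₀, x₀)) := by
    simpa [ContinuousAt, nhds_prod_eq] using hcont
  have hc3 : Tendsto (fun p : E × ℝ => p.1 + p.2 • s • m) (𝓝 x₀ ×ˢ 𝓝 0) (𝓝 x₀) :=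
    ((continuous_fst.tendsto (x₀, x₀)).comp hc2)
  obtain ⟨pa, hpa, pb, hpb, hab⟩ := eventually_prod_iff.1 ((hc2.eventually hstrict).and
    (hc3.eventually (hr.eventually (by norm_num))))
  obtain ⟨δ, hδ, hball⟩ := Metric.eventually_nhds_iff.1 hpb
  rw [eventually_nhdsWithin_iff]
  filter_upwards [hpa, hr0.eventually (gt_mem_nhds hδ)] with x hxa hxδ hside
  have hside' : s * r x < 0 := hside
  have htle : -(s * r x) ≤ |r x| := by
    refine (neg_le_abs _).trans ?_
    rw [abs_mul, hs1, one_mul]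
  have hmem : ∀ σ ∈ Icc 0 (-(s * r x)), pb σ := by
    intro σ hσ
    apply hball
    rw [Real.dist_eq, sub_zero, abs_of_nonneg hσ.1]
    linarith [hσ.2]
  have hgc : ContinuousOn (fun σ : ℝ => s * r (x + σ • s • m)) (Icc 0 (-(s * r x))) := by
    intro σ hσ
    have h1 : ContinuousAt r (x + σ • s • m) := (hab hxa (hmem σ hσ)).2.continuousAt
    have h2 : ContinuousAt (fun σ : ℝ => x + σ • s • m) σ := by fun_prop
    exact ((ContinuousAt.comp (g := r) (f := fun σ : ℝ => x + σ • s • m) h1 h2).const_mul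
      s).continuousWithinAt
  have ht0 : 0 ≤ -(s * r x) := by linarith
  -- Set t = -s r(x). Over the displacement t s m the function s r grows by 2t up to an error t, so
  -- it rises from -t to a nonnegative value, and the intermediate value theorem applies.
  have hend : 0 ≤ s * r (x + (-(s * r x)) • s • m) := by
    have h1 := (hab hxa (hmem _ (right_mem_Icc.2 ht0))).1
    set t := -(s * r x) with ht
    simp only [add_sub_cancel_left, map_smul, hm, norm_smul, Real.norm_eq_abs, hs1, one_mul] at h1
    rw [abs_of_nonneg ht0] at h1
    have h2 : 1 / (‖m‖ + 1) * (t * ‖m‖) ≤ t := by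
      rw [one_div, inv_mul_le_iff₀ (by positivity)]
      nlinarith [norm_nonneg m]
    have h3 := (abs_le.1 (h1.trans h2))
    have h4 : |s * (r (x + t • s • m) - r x - t • s • (2 : ℝ))| ≤ t := by
      rw [abs_mul, hs1, one_mul]; exact h1.trans h2
    have h5 := (abs_le.1 h4).1
    have h6 : s * (r (x + t • s • m) - r x - t • s • (2 : ℝ))
        = s * r (x + t • s • m) + t - 2 * t := by
      simp only [smul_eq_mul]; rw [ht]; linear_combination (2 * s * r x) * hs
    linarith
  obtain ⟨σ, hσ, hσ0⟩ := intermediate_value_Icc ht0 hgc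
    (show (0 : ℝ) ∈ Icc _ _ from ⟨by simpa using hside'.le, hend⟩)
  have hsne : s ≠ 0 := by rintro rfl; simp at hs
  have hrσ : r (x + σ • s • m) = 0 := (mul_eq_zero.1 hσ0).resolve_left hsne
  have hσpos : 0 < σ := by
    rcases hσ.1.lt_or_eq with h | h
    · exact h
    · rw [← h, zero_smul, add_zero] at hrσ
      rw [hrσ] at hside'; simp at hside'
  have hex : ∃ σ, 0 < σ ∧ σ ≤ -(s * r x) ∧ r (x + σ • s • m) = 0 := ⟨σ, hσpos, hσ.2, hrσ⟩
  simp only [τ, dif_pos hex]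
  exact ⟨hex.choose_spec.1, hex.choose_spec.2.2⟩

/-- Conversely, positivity of `leviIndex` on the null space of the Levi form of a pseudoconvex
boundary implies strict plurisubharmonicity of a power of the defining function near a boundary
point. -/
theorem eventually_powerHess_pos [FiniteDimensional ℂ E] {s κ : ℝ} {r : E → ℝ} {x₀ m : E}
    (hr : ContDiffAt ℝ 4 r x₀) (h0 : r x₀ = 0) (hm : fderiv ℝ r x₀ m = 2)
    (hm' : fderiv ℝ r x₀ (I • m) = 0) (hs : s ^ 2 = 1) (hκ : 0 < κ)
    (hpsc : ∀ᶠ x in 𝓝 x₀, r x = 0 → ∀ v, delPart (fderiv ℝ r x) v = 0 →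
      0 ≤ (hermPart (fderiv ℝ (fderiv ℝ r) x) v v).re)
    (hpos : ∀ u, u ≠ 0 → delPart (fderiv ℝ r x₀) u = 0 →
      (∀ w, delPart (fderiv ℝ r x₀) w = 0 → hermPart (fderiv ℝ (fderiv ℝ r) x₀) u w = 0) →
      0 < leviIndex s κ (fderiv ℝ (fderiv ℝ r) x₀) (fderiv ℝ (fderiv ℝ (fderiv ℝ r)) x₀) u m) :
    ∀ᶠ x in 𝓝 x₀, s * r x < 0 → ∀ v, v ≠ 0 → 0 < powerHess s κ r x v := by
  have hsym := eventually_symm hr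
  have hDc : ContinuousAt (fderiv ℝ (fderiv ℝ r)) x₀ := (contDiffAt_fderiv_two hr).continuousAt
  have hlc : ContinuousAt (fderiv ℝ r) x₀ := (hr.fderiv_right (m := 3) (by norm_num)).continuousAt
  have hH : ∀ u, Tendsto (fun p : E × E => (hermPart (fderiv ℝ (fderiv ℝ r) p.1) p.2 p.2).re)
      (𝓝 (x₀, u)) (𝓝 (hermPart (fderiv ℝ (fderiv ℝ r) x₀) u u).re) := fun u =>
    tendsto_hermPart_re (hDc.tendsto.comp (continuous_fst.tendsto (x₀, u)))
      (continuous_snd.tendsto (x₀, u)) (continuous_snd.tendsto (x₀, u))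
  have hl : ∀ u, Tendsto (fun p : E × E => delPart (fderiv ℝ r p.1) p.2)
      (𝓝 (x₀, u)) (𝓝 (delPart (fderiv ℝ r x₀) u)) := fun u =>
    tendsto_delPart (hlc.tendsto.comp (continuous_fst.tendsto (x₀, u)))
      (continuous_snd.tendsto (x₀, u))
  have hrc : ∀ u : E, Tendsto (fun p : E × E => r p.1) (𝓝 (x₀, u)) (𝓝 0) := fun u => by
    have := hr.continuousAt.tendsto.comp (continuous_fst.tendsto (x₀, u))
    rwa [h0] at this
  have hm1 := delPart_of_normalized hm hm'
  -- It suffices to work near each unit vector u: compactness of the sphere makes the neighborhood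
  -- of x₀ uniform, and homogeneity removes the normalization of v.
  have main : ∀ u ∈ Metric.sphere (0 : E) 1,
      ∀ᶠ p : E × E in 𝓝 (x₀, u), s * r p.1 < 0 → 0 < powerHess s κ r p.1 p.2 := by
    intro u hu
    have hu0 : u ≠ 0 := by rintro rfl; simp at hu
    by_cases hd : delPart (fderiv ℝ r x₀) u = 0
    swap
    -- Non-tangential direction: the term with 1/t dominates, as is seen after multiplication by t.
    · have h1 : Tendsto (fun p : E × E => -(s * r p.1) *
          (hermPart (fderiv ℝ (fderiv ℝ r) p.1) p.2 p.2).re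
            + 4 * κ * ‖delPart (fderiv ℝ r p.1) p.2‖ ^ 2) (𝓝 (x₀, u))
          (𝓝 (-(s * 0) * (hermPart (fderiv ℝ (fderiv ℝ r) x₀) u u).re
            + 4 * κ * ‖delPart (fderiv ℝ r x₀) u‖ ^ 2)) :=
        (((hrc u).const_mul s).neg.mul (hH u)).add (((hl u).norm.pow 2).const_mul _)
      have h2 : 0 < -(s * 0) * (hermPart (fderiv ℝ (fderiv ℝ r) x₀) u u).re
            + 4 * κ * ‖delPart (fderiv ℝ r x₀) u‖ ^ 2 := by
        have : 0 < ‖delPart (fderiv ℝ r x₀) u‖ := norm_pos_iff.2 hd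
        simp; positivity
      filter_upwards [h1.eventually (lt_mem_nhds h2)] with p hp hside
      have ht : 0 < -(s * r p.1) := by linarith
      have : powerHess s κ r p.1 p.2 = (-(s * r p.1))⁻¹ * (-(s * r p.1) *
          (hermPart (fderiv ℝ (fderiv ℝ r) p.1) p.2 p.2).re
            + 4 * κ * ‖delPart (fderiv ℝ r p.1) p.2‖ ^ 2) := by
        rw [powerHess]
        generalize -(s * r p.1) = t at ht
        field_simp
      rw [this]
      exact mul_pos (inv_pos.2 ht) hp
    rcases (hpsc.self_of_nhds h0 u hd).lt_or_eq with hL | hL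
    -- Tangential direction with positive Levi form: H stays positive by continuity, and the other
    -- term is nonnegative.
    · filter_upwards [(hH u).eventually (lt_mem_nhds hL)] with p hp hside
      have ht : 0 < -(s * r p.1) := by linarith
      rw [powerHess]
      positivity
    -- the Levi null directions
    have hker : ∀ w, delPart (fderiv ℝ r x₀) w = 0 →
        hermPart (fderiv ℝ (fderiv ℝ r) x₀) u w = 0 := fun w hw =>
      hermPart_eq_zero_of_nonneg hsym.self_of_nhds hL.symm fun z =>
        hpsc.self_of_nhds h0 _ (by rw [delPart_add, delPart_smul, hd, hw]; simp)
    have hI := hpos u hu0 hd hker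
    obtain ⟨τ, hτ, hτ'⟩ := exists_boundary_point hr h0 hm hs
    set f : Filter (E × E) := 𝓝 (x₀, u) ⊓ 𝓟 {p | s * r p.1 < 0} with hf
    suffices ∀ᶠ p in f, 0 < powerHess s κ r p.1 p.2 by
      rwa [hf, eventually_inf_principal] at this
    have hfst : Tendsto Prod.fst f (𝓝[{x | s * r x < 0}] x₀) :=
      tendsto_nhdsWithin_iff.2 ⟨(continuous_fst.tendsto (x₀, u)).mono_left inf_le_left,
        eventually_inf_principal.2 (Eventually.of_forall fun p hp => hp)⟩
    have hx : Tendsto (fun p : E × E => p.1) f (𝓝 x₀) := tendsto_nhds_of_tendsto_nhdsWithin hfst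
    have hv : Tendsto (fun p : E × E => p.2) f (𝓝 u) :=
      (continuous_snd.tendsto (x₀, u)).mono_left inf_le_left
    have hτf : Tendsto (fun p : E × E => τ p.1) f (𝓝 0) := hτ.comp hfst
    have hτp := hfst.eventually hτ'
    set y : E × E → E := fun p => p.1 + τ p.1 • s • m with hy
    have hyt : Tendsto y f (𝓝 x₀) := by simpa using hx.add (hτf.smul_const (s • m))
    -- The coefficient that makes w = v - b m tangential at y. It tends to 0, but b/τ need not be
    -- bounded, which is why positivity of the polynomial is needed for all arguments.
    set b : E × E → ℂ := fun p =>
      delPart (fderiv ℝ r (y p)) p.2 / delPart (fderiv ℝ r (y p)) m with hb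
    have hym : Tendsto (fun p => delPart (fderiv ℝ r (y p)) m) f (𝓝 1) := by
      rw [← hm1]
      exact (hl m).comp (hyt.prodMk_nhds tendsto_const_nhds)
    have hbt : Tendsto b f (𝓝 0) := by
      have := ((hl u).comp (hyt.prodMk_nhds hv)).div hym one_ne_zero
      rwa [hd, zero_div] at this
    set w : E × E → E := fun p => p.2 - b p • m with hwdef
    have hw : Tendsto w f (𝓝 u) := by simpa using hv.sub (hbt.smul_const m)
    have hlim := tendsto_expansion (κ := κ) hr hm hm' hs hx hyt hw hv hτf
      (hτp.mono fun _ h => h.1.ne') (fun p => by simp [hy]) (hτp.mono fun _ h => h.2)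
    have hdisc := (continuous_quadDisc.tendsto _).comp hlim
    have hdpos : 0 < quadDisc (-s * (hermPart (fderiv ℝ (fderiv ℝ (fderiv ℝ r)) x₀ m) u u).re) 0
        (2 * κ) (hermPart (fderiv ℝ (fderiv ℝ r) x₀) u m) 1
        (-s * delPart (fderiv ℝ (fderiv ℝ r) x₀ m) u) := by
      rw [quadDisc_eq_leviIndex s hκ hsym.self_of_nhds]; positivity
    have hlead : Continuous fun p : ℝ × ℝ × ℝ × ℂ × ℂ × ℂ =>
        p.2.1 + p.2.2.1 * ‖p.2.2.2.2.1‖ ^ 2 := by fun_prop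
    have hlead' := (hlead.tendsto _).comp hlim
    filter_upwards [hdisc.eventually (lt_mem_nhds hdpos),
      hlead'.eventually (lt_mem_nhds (show (0 : ℝ) < 0 + 2 * κ * ‖(1 : ℂ)‖ ^ 2 by
        simp; positivity)), hτp, hx.eventually hsym, hyt.eventually hpsc,
      hym.eventually_ne one_ne_zero] with p h1 h2 h3 h4 h5 h6
    have hτc : ((τ p.1 : ℝ) : ℂ) ≠ 0 := by exact_mod_cast h3.1.ne'
    have hwz : delPart (fderiv ℝ r (y p)) (w p) = 0 := by
      simp only [hwdef, hb]
      rw [sub_eq_add_neg, ← neg_smul, delPart_add, delPart_smul]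
      field_simp
      ring
    have hp2 : p.2 = w p + ((τ p.1 : ℂ) * (b p / τ p.1)) • m := by
      rw [mul_div_cancel₀ _ hτc]; simp [hwdef]
    have key := powerHess_eq_quadPoly (s := s) (κ := κ) (m := m) (b := b p / τ p.1) h4 hwz h3.1.ne'
    rw [← hp2] at key
    rw [key]
    -- Pseudoconvexity at the nearby boundary point y, not only at x₀, controls the Levi term. The
    -- leading coefficient and the discriminant are positive near the limit, so the polynomial is
    -- positive.
    exact add_pos_of_nonneg_of_pos (h5 h3.2 _ hwz) (mul_pos h3.1 (quadPoly_pos h2 h1 _))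
  have : ProperSpace E := FiniteDimensional.proper ℂ E
  have hcomp := (isCompact_sphere (0 : E) 1).eventually_forall_of_forall_eventually
    (P := fun x v => s * r x < 0 → 0 < powerHess s κ r x v) main
  filter_upwards [hcomp] with x hx hside v hv
  have hn : 0 < ‖v‖ := norm_pos_iff.2 hv
  have h1 := hx (‖v‖⁻¹ • v) (by simp [norm_smul, hn.ne']) hside
  rw [powerHess_smul] at h1
  exact (pos_iff_pos_of_mul_pos h1).1 (by positivity)

end BoundaryExpansion

/-! ### Second derivatives of compositions with holomorphic maps and with powers. -/

section SecondDerivative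

open Filter Topology Complex

lemma fderiv_fderiv_comp {E G V : Type*} [NormedAddCommGroup E] [NormedSpace ℝ E]
    [NormedAddCommGroup G] [NormedSpace ℝ G] [NormedAddCommGroup V] [NormedSpace ℝ V]
    {f : G → V} {θ : E → G} {x : E} (hf : ContDiffAt ℝ 2 f (θ x)) (hθ : ContDiffAt ℝ 2 θ x)
    (a b : E) : fderiv ℝ (fderiv ℝ (f ∘ θ)) x a b =
      fderiv ℝ (fderiv ℝ f) (θ x) (fderiv ℝ θ x a) (fderiv ℝ θ x b)
        + fderiv ℝ f (θ x) (fderiv ℝ (fderiv ℝ θ) x a b) := by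
  have h1 : fderiv ℝ (f ∘ θ) =ᶠ[𝓝 x] fun y => (fderiv ℝ f (θ y)).comp (fderiv ℝ θ y) := by
    filter_upwards [hθ.eventually (by norm_num),
      hθ.continuousAt.eventually (hf.eventually (by norm_num))] with y hy hy'
    exact fderiv_comp y (hy'.differentiableAt (by norm_num)) (hy.differentiableAt (by norm_num))
  have hθ1 : HasFDerivAt (fderiv ℝ θ) (fderiv ℝ (fderiv ℝ θ) x) x :=
    ((hθ.fderiv_right (m := 1) (by norm_num)).differentiableAt (by norm_num)).hasFDerivAt
  have hf1 : HasFDerivAt (fderiv ℝ f) (fderiv ℝ (fderiv ℝ f) (θ x)) (θ x) :=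
    ((hf.fderiv_right (m := 1) (by norm_num)).differentiableAt (by norm_num)).hasFDerivAt
  have hθ0 : HasFDerivAt θ (fderiv ℝ θ x) x := (hθ.differentiableAt (by norm_num)).hasFDerivAt
  have hc : HasFDerivAt (fun y => fderiv ℝ f (θ y)) _ x :=
    HasFDerivAt.comp (g := fderiv ℝ f) x hf1 hθ0
  rw [h1.fderiv_eq, (HasFDerivAt.clm_comp hc hθ1).fderiv]
  simp [add_comm]

variable {E : Type*} [NormedAddCommGroup E] [NormedSpace ℂ E]

/-- Invariance of the complex Hessian under holomorphic maps. -/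
lemma hermPart_comp_holomorphic {r : E → ℝ} {θ : E → E} {x : E} (hr : ContDiffAt ℝ 2 r (θ x))
    (hθ : ContDiffAt ℂ 2 θ x) (v : E) :
    (hermPart (fderiv ℝ (fderiv ℝ (r ∘ θ)) x) v v).re =
      (hermPart (fderiv ℝ (fderiv ℝ r) (θ x)) (fderiv ℝ θ x v) (fderiv ℝ θ x v)).re := by
  have hθr : ContDiffAt ℝ 2 θ x := hθ.restrict_scalars ℝ
  have hev : ∀ᶠ y in 𝓝 x, ∀ w, fderiv ℝ θ y (I • w) = I • fderiv ℝ θ y w := by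
    filter_upwards [hθ.eventually (by norm_num)] with y hy w
    rw [((hy.differentiableAt (by norm_num)).hasFDerivAt.restrictScalars ℝ).fderiv]
    simp
  have hd : DifferentiableAt ℝ (fderiv ℝ θ) x :=
    (hθr.fderiv_right (m := 1) (by norm_num)).differentiableAt (by norm_num)
  have h2 : ∀ a w, fderiv ℝ (fderiv ℝ θ) x a (I • w) = I • fderiv ℝ (fderiv ℝ θ) x a w := by
    intro a w
    have e1 : HasFDerivAt (fun y => fderiv ℝ θ y (I • w))
        ((fderiv ℝ (fderiv ℝ θ) x).flip (I • w)) x := by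
      simpa using hd.hasFDerivAt.clm_apply (hasFDerivAt_const (I • w) x)
    have e2 : HasFDerivAt (fun y => I • fderiv ℝ θ y w)
        (I • (fderiv ℝ (fderiv ℝ θ) x).flip w) x := by
      have : HasFDerivAt (fun y => fderiv ℝ θ y w) ((fderiv ℝ (fderiv ℝ θ) x).flip w) x := by
        simpa using hd.hasFDerivAt.clm_apply (hasFDerivAt_const w x)
      exact this.const_smul I
    have e3 := e1.unique (e2.congr_of_eventuallyEq (hev.mono fun y hy => hy w))
    exact DFunLike.congr_fun e3 a
  have hsymm : ∀ a b, fderiv ℝ (fderiv ℝ θ) x a b = fderiv ℝ (fderiv ℝ θ) x b a := fun a b =>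
    (hθr.isSymmSndFDerivAt (by simp)).eq a b
  -- The second derivative of a holomorphic map is complex bilinear, so its values at (iv, iv) and
  -- (v, v) cancel in the hermitian part and no first derivative of r survives.
  have h3 : fderiv ℝ (fderiv ℝ θ) x (I • v) (I • v) = -fderiv ℝ (fderiv ℝ θ) x v v := by
    rw [h2, hsymm, h2, I_smul_I_smul]
  simp only [hermPart, fderiv_fderiv_comp hr hθr, h3, hev.self_of_nhds]
  simp
  ring

/-- With f(y) = -s(-s y)^γ and t = -s r(x), s² = 1 gives f' = γ t^(γ-1), and γ = 1 - sκ gives f'' =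
f' κ/t. Also dr(v)² + dr(iv)² = 4|∂r(v)|². The sign s treats both sides of the boundary at once. -/
lemma hermPart_rpow {r : E → ℝ} {x : E} (hr : ContDiffAt ℝ 2 r x) {s κ γ : ℝ} (hs : s ^ 2 = 1)
    (hγ : γ = 1 - s * κ) (hside : s * r x < 0) (v : E) :
    (hermPart (fderiv ℝ (fderiv ℝ (fun y => -s * (-(s * r y)) ^ γ)) x) v v).re =
      γ * (-(s * r x)) ^ (γ - 1) * powerHess s κ r x v := by
  have ht : 0 < -(s * r x) := by linarith
  set f : ℝ → ℝ := fun y => -s * (-(s * y)) ^ γ with hf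
  have hlin : ∀ y : ℝ, HasDerivAt (fun y : ℝ => -(s * y)) (-s) y := fun y =>
    ((hasDerivAt_id y).const_mul s).neg.congr_deriv (by simp)
  have hpos : ∀ᶠ y in 𝓝 (r x), 0 < -(s * y) :=
    ((continuous_const.mul continuous_id).neg.tendsto (r x)).eventually (lt_mem_nhds ht)
  have hd1 : ∀ y, 0 < -(s * y) → HasDerivAt f (γ * (-(s * y)) ^ (γ - 1)) y := fun y hy => by
    refine (((hlin y).rpow_const (p := γ) (Or.inl hy.ne')).const_mul (-s)).congr_deriv ?_
    linear_combination (γ * (-(s * y)) ^ (γ - 1)) * hs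
  have hd2 : HasDerivAt (fun y => γ * (-(s * y)) ^ (γ - 1))
      (γ * (-(s * r x)) ^ (γ - 1) * (κ / (-(s * r x)))) (r x) := by
    refine (((hlin (r x)).rpow_const (p := γ - 1) (Or.inl ht.ne')).const_mul γ).congr_deriv ?_
    rw [Real.rpow_sub_one ht.ne' (γ - 1)]
    have e : γ - 1 = -s * κ := by rw [hγ]; ring
    have : (γ - 1) * (-s) = κ := by rw [e]; linear_combination κ * hs
    rw [← this]; ring
  have hfd : fderiv ℝ f =ᶠ[𝓝 (r x)] fun y =>
      (ContinuousLinearMap.toSpanSingleton ℝ (γ * (-(s * y)) ^ (γ - 1))) := by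
    filter_upwards [hpos] with y hy
    exact (hd1 y hy).hasFDerivAt.fderiv
  have hf2 : ∀ a b, fderiv ℝ (fderiv ℝ f) (r x) a b
      = a * b * (γ * (-(s * r x)) ^ (γ - 1) * (κ / (-(s * r x)))) := by
    intro a b
    have hdiff : DifferentiableAt ℝ (fderiv ℝ f) (r x) := by
      refine DifferentiableAt.congr_of_eventuallyEq ?_ hfd
      exact ((ContinuousLinearMap.toSpanSingletonCLE (𝕜 := ℝ) (E := ℝ)).toContinuousLinearMap.differentiableAt).comp (r x) hd2.differentiableAt
    have e1 : HasFDerivAt (fun y => fderiv ℝ f y b) ((fderiv ℝ (fderiv ℝ f) (r x)).flip b) (r x) := by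
      simpa using hdiff.hasFDerivAt.clm_apply (hasFDerivAt_const b (r x))
    have e2 : HasFDerivAt (fun y => fderiv ℝ f y b) _ (r x) :=
      (hd2.const_mul b).hasFDerivAt.congr_of_eventuallyEq
        (hfd.mono fun y hy => by simp only [hy]; simp)
    refine (DFunLike.congr_fun (e1.unique e2) a).trans ?_
    rw [ContinuousLinearMap.toSpanSingleton_apply, smul_eq_mul]
    ring
  have hfc : ContDiffAt ℝ 2 f (r x) := by
    have : ContDiffAt ℝ 2 (fun y : ℝ => (-(s * y)) ^ γ) (r x) :=
      ContDiffAt.rpow_const_of_ne (by fun_prop) ht.ne'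
    exact contDiffAt_const.mul this
  have hcomp : (fun y => -s * (-(s * r y)) ^ γ) = f ∘ r := rfl
  have hf1 : ∀ a, fderiv ℝ f (r x) a = a * (γ * (-(s * r x)) ^ (γ - 1)) := fun a => by
    rw [hfd.eq_of_nhds]; simp
  rw [hcomp, powerHess]
  simp only [hermPart, fderiv_fderiv_comp hfc hr, hf2, hf1, delPart, Complex.sq_norm,
    Complex.normSq_apply]
  ring

end SecondDerivative

/-! ### First and second derivatives in a fixed holomorphic chart. -/

section ComplexManifold

open Filter Topology Complex

variable {E : Type*} [NormedAddCommGroup E] [NormedSpace ℂ E]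
  {X : Type*} [TopologicalSpace X] [ChartedSpace E X]

lemma IsManifold.real_of_complex [IsManifold 𝓘(ℂ, E) ω X] : IsManifold 𝓘(ℝ, E) ∞ X := by
  refine isManifold_of_contDiffOn _ _ _ fun e e' he he' => ?_
  have h0 := HasGroupoid.compatible (G := contDiffGroupoid ω 𝓘(ℂ, E)) he he'
  have h : ContDiffOn ℂ ω (𝓘(ℂ, E) ∘ (e.symm ≫ₕ e') ∘ 𝓘(ℂ, E).symm)
      (𝓘(ℂ, E).symm ⁻¹' (e.symm ≫ₕ e').source ∩ range 𝓘(ℂ, E)) :=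
    (mem_groupoid_of_pregroupoid.1 h0).1
  exact (h.restrict_scalars ℝ).of_le le_top

lemma hasMFDerivAt_restrictScalars {f : X → E} {x : X} {f' : E →L[ℂ] E}
    (h : HasMFDerivAt 𝓘(ℂ, E) 𝓘(ℂ, E) f x f') :
    HasMFDerivAt 𝓘(ℝ, E) 𝓘(ℝ, E) f x (f'.restrictScalars ℝ : E →L[ℝ] E) :=
  ⟨h.1, HasFDerivWithinAt.restrictScalars ℝ h.2⟩

variable [IsManifold 𝓘(ℂ, E) ω X]

lemma two_le_infty : (2 : WithTop ℕ∞) ≤ ∞ := by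
  have : ((2 : ℕ∞) : WithTop ℕ∞) ≤ ((⊤ : ℕ∞) : WithTop ℕ∞) := WithTop.coe_le_coe.2 le_top
  exact this

/-- The derivative at `x` of the preferred chart at `x₀`. -/
def chartDeriv (E : Type*) [NormedAddCommGroup E] [NormedSpace ℂ E]
    {X : Type*} [TopologicalSpace X] [ChartedSpace E X] (x₀ x : X) : E →L[ℝ] E :=
  mfderiv 𝓘(ℝ, E) 𝓘(ℝ, E) (extChartAt 𝓘(ℝ, E) x₀) x

/-- The real derivative of a holomorphic chart is the restriction of its complex derivative, hence
commutes with i. -/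
lemma chartDeriv_I_smul {x₀ x : X} (hx : x ∈ (chartAt E x₀).source) (v : E) :
    chartDeriv E x₀ x (I • v) = I • chartDeriv E x₀ x v := by
  have h : MDifferentiableAt 𝓘(ℂ, E) 𝓘(ℂ, E) (extChartAt 𝓘(ℂ, E) x₀) x :=
    have : IsManifold 𝓘(ℂ, E) 1 X := IsManifold.of_le (n := ω) le_top
    mdifferentiableAt_extChartAt hx
  have h2 := (hasMFDerivAt_restrictScalars h.hasMFDerivAt).mfderiv
  refine (DFunLike.congr_fun h2 (I • v)).trans ((map_smul (mfderiv 𝓘(ℂ, E) 𝓘(ℂ, E)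
    (extChartAt 𝓘(ℂ, E) x₀) x : E →L[ℂ] E) I v).trans ?_)
  exact congrArg (I • ·) (DFunLike.congr_fun h2 v).symm

lemma chartDeriv_bijective {x₀ x : X} (hx : x ∈ (chartAt E x₀).source) :
    Function.Bijective (chartDeriv E x₀ x) := by
  have : IsManifold 𝓘(ℝ, E) ∞ X := IsManifold.real_of_complex
  have : IsManifold 𝓘(ℝ, E) 1 X := IsManifold.of_le (n := ∞) (by simp)
  obtain ⟨A, hA⟩ := isInvertible_mfderiv_extChartAt (I := 𝓘(ℝ, E)) (x := x₀) (y := x)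
    (by simpa using hx)
  have h2 : (chartDeriv E x₀ x : E → E) = A := congrArg DFunLike.coe hA.symm
  rw [h2]
  exact A.bijective

lemma contDiffAt_comp_extChartAt_symm {ρ : X → ℝ} {n : WithTop ℕ∞} (hn : n ≤ ∞) {x₀ x : X}
    (hx : x ∈ (chartAt E x₀).source)
    (hρ : ContMDiffAt 𝓘(ℝ, E) 𝓘(ℝ, ℝ) n ρ x) :
    ContDiffAt ℝ n (ρ ∘ (extChartAt 𝓘(ℝ, E) x₀).symm) (extChartAt 𝓘(ℝ, E) x₀ x) := by
  have : IsManifold 𝓘(ℝ, E) ∞ X := IsManifold.real_of_complex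
  have : IsManifold 𝓘(ℝ, E) n X := IsManifold.of_le hn
  have hx' : x ∈ (extChartAt 𝓘(ℝ, E) x₀).source := by simpa using hx
  rw [← contMDiffAt_iff_contDiffAt]
  have h1 : ContMDiffAt 𝓘(ℝ, E) 𝓘(ℝ, E) n (extChartAt 𝓘(ℝ, E) x₀).symm (extChartAt 𝓘(ℝ, E) x₀ x) :=
    (contMDiffOn_extChartAt_symm x₀).contMDiffAt
      (extChartAt_target_mem_nhds' (PartialEquiv.map_source _ hx'))
  refine ContMDiffAt.comp (I' := 𝓘(ℝ, E)) _ ?_ h1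
  rwa [PartialEquiv.left_inv _ hx']

lemma mfderiv_eq_fderiv_chart {ρ : X → ℝ} {x₀ x : X} (hx : x ∈ (chartAt E x₀).source)
    (hρ : MDifferentiableAt 𝓘(ℝ, E) 𝓘(ℝ, ℝ) ρ x) (v : E) :
    (mfderiv 𝓘(ℝ, E) 𝓘(ℝ, ℝ) ρ x : E →L[ℝ] ℝ) v =
      fderiv ℝ (ρ ∘ (extChartAt 𝓘(ℝ, E) x₀).symm) (extChartAt 𝓘(ℝ, E) x₀ x)
        (chartDeriv E x₀ x v) := by
  have : IsManifold 𝓘(ℝ, E) ∞ X := IsManifold.real_of_complex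
  have : IsManifold 𝓘(ℝ, E) 1 X := IsManifold.of_le (n := ∞) (by simp)
  have hx' : x ∈ (extChartAt 𝓘(ℝ, E) x₀).source := by simpa using hx
  have hd : DifferentiableAt ℝ (ρ ∘ (extChartAt 𝓘(ℝ, E) x₀).symm) (extChartAt 𝓘(ℝ, E) x₀ x) := by
    rw [← mdifferentiableAt_iff_differentiableAt]
    have h1 : MDifferentiableAt 𝓘(ℝ, E) 𝓘(ℝ, E) (extChartAt 𝓘(ℝ, E) x₀).symm
        (extChartAt 𝓘(ℝ, E) x₀ x) :=
      (mdifferentiableOn_extChartAt_symm.mdifferentiableAt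
        (extChartAt_target_mem_nhds' (PartialEquiv.map_source _ hx')))
    refine MDifferentiableAt.comp (I' := 𝓘(ℝ, E)) _ ?_ h1
    rwa [PartialEquiv.left_inv _ hx']
  have heq : ρ =ᶠ[𝓝 x] (ρ ∘ (extChartAt 𝓘(ℝ, E) x₀).symm) ∘ extChartAt 𝓘(ℝ, E) x₀ := by
    filter_upwards [extChartAt_source_mem_nhds' (I := 𝓘(ℝ, E)) hx'] with y hy
    simp only [Function.comp, PartialEquiv.left_inv _ hy]
  have h2 := HasMFDerivAt.comp x (hd.hasFDerivAt.hasMFDerivAt)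
    (mdifferentiableAt_extChartAt (I := 𝓘(ℝ, E)) hx).hasMFDerivAt
  have h3 := h2.congr_of_eventuallyEq heq
  rw [h3.mfderiv]
  rfl

/-- The complex Hessian is defined in a chart that varies with x, while limits require one chart
around x₀. The transition map is holomorphic with derivative `chartDeriv`, so
`hermPart_comp_holomorphic` compares the two. -/
lemma complexHessian_eq_chart {ρ : X → ℝ} {x₀ x : X} (hx : x ∈ (chartAt E x₀).source)
    (hρ : ContMDiffAt 𝓘(ℝ, E) 𝓘(ℝ, ℝ) 2 ρ x) (v : E) :
    complexHessian ρ x v = (hermPart (fderiv ℝ (fderiv ℝ (ρ ∘ (extChartAt 𝓘(ℝ, E) x₀).symm))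
      (extChartAt 𝓘(ℝ, E) x₀ x)) (chartDeriv E x₀ x v) (chartDeriv E x₀ x v)).re / 4 := by
  have : IsManifold 𝓘(ℝ, E) ∞ X := IsManifold.real_of_complex
  have : IsManifold 𝓘(ℝ, E) 1 X := IsManifold.of_le (n := ∞) (by simp)
  have hx' : x ∈ (extChartAt 𝓘(ℝ, E) x₀).source := by simpa using hx
  set θ : E → E := extChartAt 𝓘(ℂ, E) x₀ ∘ (extChartAt 𝓘(ℂ, E) x).symm with hθdef
  set y := extChartAt 𝓘(ℝ, E) x x with hy
  have hyx : (extChartAt 𝓘(ℂ, E) x).symm y = x := extChartAt_to_inv (I := 𝓘(ℂ, E)) x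
  have hθ : ContDiffAt ℂ 2 θ y := by
    rw [← contMDiffAt_iff_contDiffAt]
    have h1 : ContMDiffAt 𝓘(ℂ, E) 𝓘(ℂ, E) ω (extChartAt 𝓘(ℂ, E) x).symm y :=
      (contMDiffOn_extChartAt_symm x).contMDiffAt (extChartAt_target_mem_nhds (I := 𝓘(ℂ, E)) x)
    have h2 : ContMDiffAt 𝓘(ℂ, E) 𝓘(ℂ, E) ω (extChartAt 𝓘(ℂ, E) x₀) x :=
      contMDiffAt_extChartAt' hx
    refine (ContMDiffAt.comp (I' := 𝓘(ℂ, E)) y ?_ h1).of_le le_top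
    rwa [hyx]
  have hθy : θ y = extChartAt 𝓘(ℝ, E) x₀ x := by
    simp only [hθdef, Function.comp, hyx]; rfl
  have heq : ρ ∘ (extChartAt 𝓘(ℝ, E) x).symm =ᶠ[𝓝 y]
      (ρ ∘ (extChartAt 𝓘(ℝ, E) x₀).symm) ∘ θ := by
    have hc : ContinuousAt (extChartAt 𝓘(ℝ, E) x).symm y := continuousAt_extChartAt_symm x
    have hyx' : (extChartAt 𝓘(ℝ, E) x).symm y = x := hyx
    filter_upwards [hc.eventually (by rw [hyx']; exact extChartAt_source_mem_nhds' hx')] with z hz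
    have : (extChartAt 𝓘(ℝ, E) x₀).symm (θ z) = (extChartAt 𝓘(ℝ, E) x).symm z :=
      (extChartAt 𝓘(ℝ, E) x₀).left_inv hz
    simp only [Function.comp]
    rw [this]
  have hfd : fderiv ℝ θ y = chartDeriv E x₀ x := by
    have h := (mdifferentiableAt_extChartAt (I := 𝓘(ℝ, E)) hx).hasMFDerivAt.2
    have h' : HasFDerivWithinAt θ (chartDeriv E x₀ x) (range 𝓘(ℝ, E)) y := h
    exact (h'.hasFDerivAt (by simp)).fderiv
  have hr : ContDiffAt ℝ 2 (ρ ∘ (extChartAt 𝓘(ℝ, E) x₀).symm) (θ y) := by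
    rw [hθy]; exact contDiffAt_comp_extChartAt_symm two_le_infty hx hρ
  have key := hermPart_comp_holomorphic hr hθ v
  rw [← heq.fderiv.fderiv_eq, hθy, hfd] at key
  rw [← key]
  rfl

end ComplexManifold

/-! ### Vector fields and Lie brackets on a real manifold, in charts. -/

section RealManifold

open Filter Topology

variable {F : Type*} [NormedAddCommGroup F] [NormedSpace ℝ F]
  {M : Type*} [TopologicalSpace M] [ChartedSpace F M]
  {V : Type*} [NormedAddCommGroup V] [NormedSpace ℝ V]

/-- The derivative of a vector valued function, as a map between fixed normed spaces. -/
def mdir (F : Type*) [NormedAddCommGroup F] [NormedSpace ℝ F]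
    {M : Type*} [TopologicalSpace M] [ChartedSpace F M]
    {V : Type*} [NormedAddCommGroup V] [NormedSpace ℝ V] (f : M → V) (q : M) : F →L[ℝ] V :=
  mfderiv 𝓘(ℝ, F) 𝓘(ℝ, V) f q

lemma mdir_congr {f g : M → V} {q : M} (h : f =ᶠ[𝓝 q] g) : mdir F f q = mdir F g q :=
  h.mfderiv_eq

lemma HasFDerivAt.comp_mdir {G : Type*} [NormedAddCommGroup G] [NormedSpace ℝ G] {K : V → G}
    {f : M → V} {q : M} {K' : V →L[ℝ] G} (hK : HasFDerivAt K K' (f q))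
    (hf : MDifferentiableAt 𝓘(ℝ, F) 𝓘(ℝ, V) f q) :
    mdir F (fun q => K (f q)) q = K'.comp (mdir F f q) :=
  (HasMFDerivAt.comp (I' := 𝓘(ℝ, V)) q hK.hasMFDerivAt hf.hasMFDerivAt).mfderiv

/-- Smoothness of a vector field at a point. -/
def SmoothFieldAt (Z : (p : M) → TangentSpace 𝓘(ℝ, F) p) [IsManifold 𝓘(ℝ, F) ∞ M] (q : M) : Prop :=
  ContMDiffAt 𝓘(ℝ, F) 𝓘(ℝ, F).tangent ∞ (fun p => (⟨p, Z p⟩ : TangentBundle 𝓘(ℝ, F) M)) q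

variable [IsManifold 𝓘(ℝ, F) ∞ M]

omit [IsManifold 𝓘(ℝ, F) ∞ M] in
lemma IsManifold.one_of_infty (h : IsManifold 𝓘(ℝ, F) ∞ M) : IsManifold 𝓘(ℝ, F) 1 M :=
  IsManifold.of_le (n := ∞) (by simp)

lemma contMDiffAt_extChartAt_symm {p q : M} (hq : q ∈ (chartAt F p).source) :
    ContMDiffAt 𝓘(ℝ, F) 𝓘(ℝ, F) ∞ (extChartAt 𝓘(ℝ, F) p).symm (extChartAt 𝓘(ℝ, F) p q) :=
  (contMDiffOn_extChartAt_symm p).contMDiffAt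
    (extChartAt_target_mem_nhds' (PartialEquiv.map_source _ (by simpa using hq)))

omit [IsManifold 𝓘(ℝ, F) ∞ M] in
lemma extChartAt_symm_apply {p q : M} (hq : q ∈ (chartAt F p).source) :
    (extChartAt 𝓘(ℝ, F) p).symm (extChartAt 𝓘(ℝ, F) p q) = q :=
  PartialEquiv.left_inv _ (by simpa using hq)

lemma contDiffAt_written {f : M → V} {p q : M} {n : WithTop ℕ∞} (hn : n ≤ ∞)
    (hq : q ∈ (chartAt F p).source)
    (hf : ContMDiffAt 𝓘(ℝ, F) 𝓘(ℝ, V) n f q) :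
    ContDiffAt ℝ n (f ∘ (extChartAt 𝓘(ℝ, F) p).symm) (extChartAt 𝓘(ℝ, F) p q) := by
  rw [← contMDiffAt_iff_contDiffAt]
  refine ContMDiffAt.comp (I' := 𝓘(ℝ, F)) _ ?_ ((contMDiffAt_extChartAt_symm hq).of_le hn)
  rwa [extChartAt_symm_apply hq]

lemma mdir_eq_fderiv_written {f : M → V} {p q : M} (hq : q ∈ (chartAt F p).source)
    (hf : MDifferentiableAt 𝓘(ℝ, F) 𝓘(ℝ, V) f q) :
    mdir F f q = (fderiv ℝ (f ∘ (extChartAt 𝓘(ℝ, F) p).symm) (extChartAt 𝓘(ℝ, F) p q)).comp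
        (mdir F (extChartAt 𝓘(ℝ, F) p) q) := by
  have : IsManifold 𝓘(ℝ, F) 1 M := IsManifold.one_of_infty ‹_›
  have hd : DifferentiableAt ℝ (f ∘ (extChartAt 𝓘(ℝ, F) p).symm) (extChartAt 𝓘(ℝ, F) p q) := by
    rw [← mdifferentiableAt_iff_differentiableAt]
    refine MDifferentiableAt.comp (I' := 𝓘(ℝ, F)) _ ?_
      ((contMDiffAt_extChartAt_symm hq).mdifferentiableAt (by simp))
    rwa [extChartAt_symm_apply hq]
  have heq : f =ᶠ[𝓝 q] fun q => (f ∘ (extChartAt 𝓘(ℝ, F) p).symm) (extChartAt 𝓘(ℝ, F) p q) := by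
    filter_upwards [(chartAt F p).open_source.mem_nhds hq] with y hy
    simp only [Function.comp, extChartAt_symm_apply hy]
  rw [mdir_congr heq]
  exact hd.hasFDerivAt.comp_mdir (mdifferentiableAt_extChartAt hq)

/-- Over its base set, the trivialization of the tangent bundle at p is the derivative of the chart
at p, so its fiber component is the coordinate expression of the field. -/
lemma smoothFieldAt_iff {Z : (p : M) → TangentSpace 𝓘(ℝ, F) p} {p q : M}
    (hq : q ∈ (chartAt F p).source) :
    SmoothFieldAt Z q ↔ ContMDiffAt 𝓘(ℝ, F) 𝓘(ℝ, F) ∞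
      (fun q' => mdir F (extChartAt 𝓘(ℝ, F) p) q' (Z q')) q := by
  have : IsManifold 𝓘(ℝ, F) 1 M := IsManifold.one_of_infty ‹_›
  set e := trivializationAt F (TangentSpace 𝓘(ℝ, F) : M → Type _) p
  have h1 := e.contMDiffAt_iff (IM := 𝓘(ℝ, F)) (IB := 𝓘(ℝ, F)) (n := ∞)
    (f := fun p => (⟨p, Z p⟩ : TangentBundle 𝓘(ℝ, F) M)) (x₀ := q)
    (by rw [e.mem_source]; simpa [e] using hq)
  rw [SmoothFieldAt]
  refine h1.trans ((and_iff_right contMDiffAt_id).trans ?_)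
  refine Filter.EventuallyEq.contMDiffAt_iff ?_
  filter_upwards [(chartAt F p).open_source.mem_nhds hq] with y hy
  have h2 := TangentBundle.continuousLinearMapAt_trivializationAt (I := 𝓘(ℝ, F)) (x₀ := p) hy
  have h3 := DFunLike.congr_fun h2 (Z y)
  refine Eq.trans ?_ h3
  rw [Bundle.Trivialization.continuousLinearMapAt_apply, Bundle.Trivialization.linearMapAt_apply,
    if_pos (by simpa [e] using hy)]

lemma SmoothFieldAt.contMDiffAt_mdir {Z : (p : M) → TangentSpace 𝓘(ℝ, F) p} {q : M} {f : M → V}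
    (hZ : SmoothFieldAt Z q) (hf : ContMDiffAt 𝓘(ℝ, F) 𝓘(ℝ, V) ∞ f q) :
    ContMDiffAt 𝓘(ℝ, F) 𝓘(ℝ, V) ∞ (fun q' => mdir F f q' (Z q')) q := by
  have : IsManifold 𝓘(ℝ, F) 1 M := IsManifold.one_of_infty ‹_›
  have hq := mem_chart_source F q
  have h1 := (smoothFieldAt_iff hq).1 hZ
  have h2 : ContDiffAt ℝ ∞ (fderiv ℝ (f ∘ (extChartAt 𝓘(ℝ, F) q).symm)) (extChartAt 𝓘(ℝ, F) q q) :=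
    (contDiffAt_written le_rfl hq hf).fderiv_right (by simp)
  have h3 : ContMDiffAt 𝓘(ℝ, F) 𝓘(ℝ, F →L[ℝ] V) ∞
      (fun q' => fderiv ℝ (f ∘ (extChartAt 𝓘(ℝ, F) q).symm) (extChartAt 𝓘(ℝ, F) q q')) q :=
    ContDiffAt.comp_contMDiffAt (g := fderiv ℝ (f ∘ (extChartAt 𝓘(ℝ, F) q).symm)) h2
      contMDiffAt_extChartAt
  have hev : ∀ᶠ q' in 𝓝 q, ContMDiffAt 𝓘(ℝ, F) 𝓘(ℝ, V) 1 f q' :=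
    (contMDiffAt_iff_contMDiffAt_nhds (by simp)).1 (hf.of_le (by simp))
  refine (h3.clm_apply h1).congr_of_eventuallyEq ?_
  filter_upwards [(chartAt F q).open_source.mem_nhds hq, hev] with y hy hfy
  rw [mdir_eq_fderiv_written hy (hfy.mdifferentiableAt (by simp))]
  rfl

omit [IsManifold 𝓘(ℝ, F) ∞ M] in
lemma mdir_extChartAt_self [IsManifold 𝓘(ℝ, F) 1 M] (q : M) :
    mdir F (extChartAt 𝓘(ℝ, F) q) q = ContinuousLinearMap.id ℝ F :=
  mfderiv_extChartAt_self (I := 𝓘(ℝ, F)) (x := q)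

lemma mdir_extChartAt_bijective {p q : M} (hq : q ∈ (chartAt F p).source) :
    Function.Bijective (mdir F (extChartAt 𝓘(ℝ, F) p) q) := by
  have : IsManifold 𝓘(ℝ, F) 1 M := IsManifold.one_of_infty ‹_›
  obtain ⟨A, hA⟩ := isInvertible_mfderiv_extChartAt (I := 𝓘(ℝ, F)) (x := p) (y := q)
    (by simpa using hq)
  have h2 : (mdir F (extChartAt 𝓘(ℝ, F) p) q : F → F) = A := congrArg DFunLike.coe hA.symm
  rw [h2]
  exact A.bijective

/-- The coordinate expression of a vector field. -/
def fieldInChart (p : M) (Z : (p : M) → TangentSpace 𝓘(ℝ, F) p) (y : F) : F :=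
  mdir F (extChartAt 𝓘(ℝ, F) p) ((extChartAt 𝓘(ℝ, F) p).symm y)
    (Z ((extChartAt 𝓘(ℝ, F) p).symm y))

/-- In the chart at q the derivative at q is the identity, so the pullback in the definition of the
bracket disappears at that point. -/
lemma mlieBracket_eq_chart (Z W : (p : M) → TangentSpace 𝓘(ℝ, F) p) (q : M) :
    (VectorField.mlieBracket 𝓘(ℝ, F) Z W q : F) =
      fderiv ℝ (fieldInChart q W) (extChartAt 𝓘(ℝ, F) q q) (Z q)
      - fderiv ℝ (fieldInChart q Z) (extChartAt 𝓘(ℝ, F) q q) (W q) := by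
  have : IsManifold 𝓘(ℝ, F) 1 M := IsManifold.one_of_infty ‹_›
  set φ := extChartAt 𝓘(ℝ, F) q with hφ
  have key : ∀ Y : (p : M) → TangentSpace 𝓘(ℝ, F) p,
      (VectorField.mpullbackWithin 𝓘(ℝ, F) 𝓘(ℝ, F) φ.symm Y (range 𝓘(ℝ, F)) : F → F)
        =ᶠ[𝓝 (φ q)] fieldInChart q Y := by
    intro Y
    filter_upwards [extChartAt_target_mem_nhds (I := 𝓘(ℝ, F)) q] with y hy
    obtain ⟨A, hA⟩ := isInvertible_mfderivWithin_extChartAt_symm (I := 𝓘(ℝ, F)) hy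
    have h1 := mfderiv_extChartAt_comp_mfderivWithin_extChartAt_symm (I := 𝓘(ℝ, F)) hy
    have h2 : ∀ v, mdir F φ (φ.symm y) (A v) = v := fun v => by
      rw [← hA] at h1
      exact DFunLike.congr_fun h1 v
    have h3 : VectorField.mpullbackWithin 𝓘(ℝ, F) 𝓘(ℝ, F) φ.symm Y (range 𝓘(ℝ, F)) y
        = A.symm (Y (φ.symm y)) := by
      rw [VectorField.mpullbackWithin_apply, ← hA, ContinuousLinearMap.inverse_equiv]
      rfl
    rw [h3]
    refine (h2 (A.symm (Y (φ.symm y)))).symm.trans ?_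
    exact congrArg (mdir F φ (φ.symm y)) (A.apply_symm_apply _)
  have h0 : mfderiv 𝓘(ℝ, F) 𝓘(ℝ, F) φ q = ContinuousLinearMap.id ℝ F := mdir_extChartAt_self q
  have h1 : (VectorField.mlieBracket 𝓘(ℝ, F) Z W q : F) =
      VectorField.lieBracketWithin ℝ
        (VectorField.mpullbackWithin 𝓘(ℝ, F) 𝓘(ℝ, F) φ.symm Z (range 𝓘(ℝ, F)))
        (VectorField.mpullbackWithin 𝓘(ℝ, F) 𝓘(ℝ, F) φ.symm W (range 𝓘(ℝ, F)))
        (φ.symm ⁻¹' univ ∩ range 𝓘(ℝ, F)) (φ q) := by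
    refine (VectorField.mlieBracketWithin_apply (I := 𝓘(ℝ, F)) (V := Z) (W := W) (s := univ)
      (x₀ := q)).trans ?_
    rw [← hφ, h0]
    exact DFunLike.congr_fun ContinuousLinearMap.inverse_id _
  have hc : ∀ Y : (p : M) → TangentSpace 𝓘(ℝ, F) p, fieldInChart q Y (φ q) = Y q := fun Y => by
    have e : ∀ q', q' = q → mdir F φ q' (Y q') = (Y q : F) := by
      rintro _ rfl
      rw [hφ, mdir_extChartAt_self]; rfl
    exact e _ (extChartAt_to_inv (I := 𝓘(ℝ, F)) q)
  have hset : φ.symm ⁻¹' univ ∩ range 𝓘(ℝ, F) = univ := by simp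
  have gen : ∀ (A B A' B' : F → F) (s : Set F) (y a b : F), s = univ → A =ᶠ[𝓝 y] A' →
      B =ᶠ[𝓝 y] B' → A' y = a → B' y = b → VectorField.lieBracketWithin ℝ A B s y
        = fderiv ℝ B' y a - fderiv ℝ A' y b := by
    rintro A B A' B' s y a b rfl hA hB rfl rfl
    rw [VectorField.lieBracketWithin_univ, VectorField.lieBracket_eq]
    simp only
    rw [hA.fderiv_eq, hB.fderiv_eq, hA.eq_of_nhds, hB.eq_of_nhds]
  exact h1.trans (gen _ _ _ _ _ _ _ _ hset (key Z) (key W) (hc Z) (hc W))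

/-- Symmetry of the second derivative of f cancels its contribution, leaving the coordinate formula
for the bracket. For an embedding f into a vector space this turns brackets on M into derivatives of
vector valued functions. -/
lemma mdir_mlieBracket {Z W : (p : M) → TangentSpace 𝓘(ℝ, F) p} {q : M} {f : M → V}
    (hZ : SmoothFieldAt Z q) (hW : SmoothFieldAt W q) (hf : ContMDiffAt 𝓘(ℝ, F) 𝓘(ℝ, V) ∞ f q) :
    mdir F f q (VectorField.mlieBracket 𝓘(ℝ, F) Z W q) =
      mdir F (fun q' => mdir F f q' (W q')) q (Z q)
      - mdir F (fun q' => mdir F f q' (Z q')) q (W q) := by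
  have : IsManifold 𝓘(ℝ, F) 1 M := IsManifold.one_of_infty ‹_›
  have hq := mem_chart_source F q
  set φ := extChartAt 𝓘(ℝ, F) q with hφ
  have hf2 : ContDiffAt ℝ ∞ (f ∘ φ.symm) (φ q) := contDiffAt_written le_rfl hq hf
  have hself : ∀ {G : Type _} [NormedAddCommGroup G] [NormedSpace ℝ G] {g : M → G},
      ContMDiffAt 𝓘(ℝ, F) 𝓘(ℝ, G) ∞ g q → ∀ v, mdir F g q v = fderiv ℝ (g ∘ φ.symm) (φ q) v := by
    intro G _ _ g hg v
    rw [mdir_eq_fderiv_written hq (hg.mdifferentiableAt (by simp)), mdir_extChartAt_self]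
    rfl
  have hev : ∀ᶠ q' in 𝓝 q, ContMDiffAt 𝓘(ℝ, F) 𝓘(ℝ, V) 1 f q' :=
    (contMDiffAt_iff_contMDiffAt_nhds (by simp)).1 (hf.of_le (by simp))
  have hcs : Tendsto φ.symm (𝓝 (φ q)) (𝓝 q) := by
    have := (contMDiffAt_extChartAt_symm hq).continuousAt.tendsto
    rwa [extChartAt_symm_apply hq] at this
  have hY : ∀ Y : (p : M) → TangentSpace 𝓘(ℝ, F) p, SmoothFieldAt Y q → ∀ v,
      mdir F (fun q' => mdir F f q' (Y q')) q v
        = fderiv ℝ (fderiv ℝ (f ∘ φ.symm)) (φ q) v (Y q)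
          + fderiv ℝ (f ∘ φ.symm) (φ q) (fderiv ℝ (fieldInChart q Y) (φ q) v) := by
    intro Y hYs v
    rw [hself (hYs.contMDiffAt_mdir hf)]
    have heq : (fun q' => mdir F f q' (Y q')) ∘ φ.symm =ᶠ[𝓝 (φ q)]
        fun y => fderiv ℝ (f ∘ φ.symm) y (fieldInChart q Y y) := by
      filter_upwards [hcs.eventually hev, hcs.eventually ((chartAt F q).open_source.mem_nhds hq),
        extChartAt_target_mem_nhds (I := 𝓘(ℝ, F)) q] with y hy hy2 hy3
      have e := mdir_eq_fderiv_written hy2 (hy.mdifferentiableAt (by simp))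
      have e2 : extChartAt 𝓘(ℝ, F) q (φ.symm y) = y := PartialEquiv.right_inv _ hy3
      rw [e2] at e
      simp only [Function.comp, e]
      rfl
    have hd1 : DifferentiableAt ℝ (fderiv ℝ (f ∘ φ.symm)) (φ q) :=
      (hf2.fderiv_right (m := ∞) (by simp)).differentiableAt (by simp)
    have hd2 : DifferentiableAt ℝ (fieldInChart q Y) (φ q) :=
      (contDiffAt_written le_rfl hq ((smoothFieldAt_iff hq).1 hYs)).differentiableAt (by simp)
    have e : fieldInChart q Y (φ q) = Y q := by
      have e : ∀ q', q' = q → mdir F φ q' (Y q') = (Y q : F) := by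
        rintro _ rfl
        rw [hφ, mdir_extChartAt_self]; rfl
      exact e _ (extChartAt_to_inv (I := 𝓘(ℝ, F)) q)
    rw [heq.fderiv_eq, (hd1.hasFDerivAt.clm_apply hd2.hasFDerivAt).fderiv, e]
    exact add_comm _ _
  refine (hself hf _).trans ?_
  refine (congrArg (fderiv ℝ (f ∘ φ.symm) (φ q)) (mlieBracket_eq_chart Z W q)).trans ?_
  have hsymm := (hf2.isSymmSndFDerivAt (by simpa using two_le_infty)).eq (Z q) (W q)
  refine (map_sub (fderiv ℝ (f ∘ φ.symm) (φ q)) _ _).trans ?_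
  refine Eq.trans ?_ (congrArg₂ (· - ·) (hY W hW (Z q)) (hY Z hZ (W q))).symm
  refine Eq.trans ?_ (congrArg (fun t => _ - (t + _)) hsymm)
  exact (add_sub_add_left_eq_sub _ _ _).symm

end RealManifold

/-! ### Product, sum and chain rules for vector valued functions on a manifold. -/

section MdirCalculus

open Filter Topology

variable {F : Type*} [NormedAddCommGroup F] [NormedSpace ℝ F]
  {M : Type*} [TopologicalSpace M] [ChartedSpace F M]
  {V : Type*} [NormedAddCommGroup V] [NormedSpace ℝ V]
  {W : Type*} [NormedAddCommGroup W] [NormedSpace ℝ W]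

lemma mdir_eventually_const {f : M → V} {c : V} {p : M} (h : ∀ᶠ q in 𝓝 p, f q = c) :
    mdir F f p = 0 := by
  have h' : f =ᶠ[𝓝 p] fun _ => c := h
  rw [mdir_congr h']
  exact mfderiv_const

lemma mdir_continuousLinearMap_comp (A : V →L[ℝ] W) {f : M → V} {p : M}
    (hf : MDifferentiableAt 𝓘(ℝ, F) 𝓘(ℝ, V) f p) (v : F) :
    mdir F (fun q => A (f q)) p v = A (mdir F f p v) := by
  rw [A.hasFDerivAt.comp_mdir hf]; rfl

/-- The derivative in the chart at p itself is the manifold derivative at p; the rules below are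
transferred from normed spaces in this way. -/
lemma hasFDerivAt_written_self {f : M → V} {p : M}
    (hf : MDifferentiableAt 𝓘(ℝ, F) 𝓘(ℝ, V) f p) :
    HasFDerivAt (f ∘ (extChartAt 𝓘(ℝ, F) p).symm) (mdir F f p) (extChartAt 𝓘(ℝ, F) p p) := by
  have h : HasFDerivWithinAt (f ∘ (extChartAt 𝓘(ℝ, F) p).symm) (mdir F f p) (range 𝓘(ℝ, F))
    (extChartAt 𝓘(ℝ, F) p p) := hf.hasMFDerivAt.2
  exact h.hasFDerivAt (by simp)

lemma mdir_eq_of_hasFDerivAt {f : M → V} {p : M} {A : F →L[ℝ] V}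
    (hf : MDifferentiableAt 𝓘(ℝ, F) 𝓘(ℝ, V) f p)
    (h : HasFDerivAt (f ∘ (extChartAt 𝓘(ℝ, F) p).symm) A (extChartAt 𝓘(ℝ, F) p p)) :
    mdir F f p = A :=
  (hasFDerivAt_written_self hf).unique h

lemma mdir_clm_apply {A : M → V →L[ℝ] W} {b : M → V} {p : M}
    (hA : MDifferentiableAt 𝓘(ℝ, F) 𝓘(ℝ, V →L[ℝ] W) A p)
    (hb : MDifferentiableAt 𝓘(ℝ, F) 𝓘(ℝ, V) b p) (v : F) :
    mdir F (fun q => A q (b q)) p v = mdir F A p v (b p) + A p (mdir F b p v) := by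
  have h := (hasFDerivAt_written_self hA).clm_apply (hasFDerivAt_written_self hb)
  rw [mdir_eq_of_hasFDerivAt (hA.clm_apply hb) h]
  simp [add_comm]

lemma mdir_add {f g : M → V} {p : M} (hf : MDifferentiableAt 𝓘(ℝ, F) 𝓘(ℝ, V) f p)
    (hg : MDifferentiableAt 𝓘(ℝ, F) 𝓘(ℝ, V) g p) (v : F) :
    mdir F (fun q => f q + g q) p v = mdir F f p v + mdir F g p v := by
  exact DFunLike.congr_fun (mdir_eq_of_hasFDerivAt (hf.add hg)
    ((hasFDerivAt_written_self hf).add (hasFDerivAt_written_self hg))) v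

lemma mdir_sub {f g : M → V} {p : M} (hf : MDifferentiableAt 𝓘(ℝ, F) 𝓘(ℝ, V) f p)
    (hg : MDifferentiableAt 𝓘(ℝ, F) 𝓘(ℝ, V) g p) (v : F) :
    mdir F (fun q => f q - g q) p v = mdir F f p v - mdir F g p v := by
  exact DFunLike.congr_fun (mdir_eq_of_hasFDerivAt (hf.sub hg)
    ((hasFDerivAt_written_self hf).sub (hasFDerivAt_written_self hg))) v

lemma mdir_complex_mk {f g : M → ℝ} {p : M} (hf : MDifferentiableAt 𝓘(ℝ, F) 𝓘(ℝ, ℝ) f p)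
    (hg : MDifferentiableAt 𝓘(ℝ, F) 𝓘(ℝ, ℝ) g p) (v : F) :
    mdir F (fun q => (⟨f q, g q⟩ : ℂ)) p v = ⟨mdir F f p v, mdir F g p v⟩ := by
  have h := (hf.prodMk_space hg)
  have e : mdir F (fun q => (f q, g q)) p v = (mdir F f p v, mdir F g p v) := by
    rw [mdir_eq_of_hasFDerivAt h
      ((hasFDerivAt_written_self hf).prodMk (hasFDerivAt_written_self hg))]
    rfl
  have := mdir_continuousLinearMap_comp (Complex.equivRealProdCLM.symm : ℝ × ℝ →L[ℝ] ℂ) h v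
  rw [e] at this
  exact this

end MdirCalculus

/-! ### CR manifolds as local real hypersurfaces; the contact form on brackets. -/

section LocalCR

open Filter Topology Complex ComplexConjugate

variable {E : Type*} [NormedAddCommGroup E] [NormedSpace ℂ E]
  {F : Type*} [NormedAddCommGroup F] [NormedSpace ℝ F]
  {M : Type*} [TopologicalSpace M] [ChartedSpace F M]

/-- Near `p`, the CR manifold `M` is, through `g`, the real hypersurface `r = 0` of `E`. -/
structure LocalCR (T10 : (p : M) → Set (CTangent F p)) (g : M → E) (r : E → ℝ) (p : M) : Prop where
  smooth_g : ∀ᶠ q in 𝓝 p, ContMDiffAt 𝓘(ℝ, F) 𝓘(ℝ, E) ∞ g q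
  smooth_r : ∀ᶠ q in 𝓝 p, ContDiffAt ℝ ∞ r (g q)
  range_iff : ∀ᶠ q in 𝓝 p, ∀ a : E, fderiv ℝ r (g q) a = 0 ↔ ∃ v, mdir F g q v = a
  mem_iff : ∀ᶠ q in 𝓝 p, ∀ z : CTangent F q, z ∈ T10 q ↔ mdir F g q z.2 = -(I • mdir F g q z.1)

variable {T10 : (p : M) → Set (CTangent F p)} {g : M → E} {r : E → ℝ} {p : M}

/-- All conditions concern germs, so identities proved at p hold at nearby points and can be
differentiated. -/
lemma LocalCR.eventually (h : LocalCR T10 g r p) : ∀ᶠ q in 𝓝 p, LocalCR T10 g r q := by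
  filter_upwards [h.smooth_g.eventually_nhds, h.smooth_r.eventually_nhds,
    h.range_iff.eventually_nhds, h.mem_iff.eventually_nhds] with q h1 h2 h3 h4
  exact ⟨h1, h2, h3, h4⟩

lemma LocalCR.continuousAt (h : LocalCR T10 g r p) : ContinuousAt g p :=
  h.smooth_g.self_of_nhds.continuousAt

lemma LocalCR.mdifferentiableAt_fderiv (h : LocalCR T10 g r p) :
    MDifferentiableAt 𝓘(ℝ, F) 𝓘(ℝ, E →L[ℝ] ℝ) (fun q => fderiv ℝ r (g q)) p := by
  have h1 : ContDiffAt ℝ ∞ (fderiv ℝ r) (g p) :=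
    h.smooth_r.self_of_nhds.fderiv_right (by simp)
  exact (ContDiffAt.comp_contMDiffAt (g := fderiv ℝ r) h1 h.smooth_g.self_of_nhds).mdifferentiableAt
    (by simp)

lemma LocalCR.mdir_fderiv (h : LocalCR T10 g r p) (v : F) :
    mdir F (fun q => fderiv ℝ r (g q)) p v = fderiv ℝ (fderiv ℝ r) (g p) (mdir F g p v) := by
  have h1 : ContDiffAt ℝ ∞ (fderiv ℝ r) (g p) :=
    h.smooth_r.self_of_nhds.fderiv_right (by simp)
  rw [(h1.differentiableAt (by simp)).hasFDerivAt.comp_mdir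
    (h.smooth_g.self_of_nhds.mdifferentiableAt (by simp))]
  rfl

lemma LocalCR.hess_symm (h : LocalCR T10 g r p) (a b : E) :
    fderiv ℝ (fderiv ℝ r) (g p) a b = fderiv ℝ (fderiv ℝ r) (g p) b a :=
  (h.smooth_r.self_of_nhds.isSymmSndFDerivAt (by simpa using two_le_infty)).eq a b

lemma LocalCR.fderiv_mdir (h : LocalCR T10 g r p) (v : F) : fderiv ℝ r (g p) (mdir F g p v) = 0 :=
  (h.range_iff.self_of_nhds _).2 ⟨v, rfl⟩

lemma mdir_I_smul {b : M → E} (hb : MDifferentiableAt 𝓘(ℝ, F) 𝓘(ℝ, E) b p) (v : F) :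
    mdir F (fun q => I • b q) p v = I • mdir F b p v :=
  mdir_continuousLinearMap_comp ((I • ContinuousLinearMap.id ℂ E).restrictScalars ℝ) hb v

lemma MDifferentiableAt.I_smul {b : M → E} (hb : MDifferentiableAt 𝓘(ℝ, F) 𝓘(ℝ, E) b p) :
    MDifferentiableAt 𝓘(ℝ, F) 𝓘(ℝ, E) (fun q => I • b q) p :=
  (((I • ContinuousLinearMap.id ℂ E).restrictScalars ℝ).hasFDerivAt.hasMFDerivAt.comp p
    hb.hasMFDerivAt).mdifferentiableAt

/-- The differential of `q ↦ dr_{g q}(b q)`. -/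
lemma LocalCR.mdir_fderiv_apply (h : LocalCR T10 g r p) {b : M → E}
    (hb : MDifferentiableAt 𝓘(ℝ, F) 𝓘(ℝ, E) b p) (v : F) :
    mdir F (fun q => fderiv ℝ r (g q) (b q)) p v =
      fderiv ℝ (fderiv ℝ r) (g p) (mdir F g p v) (b p) + fderiv ℝ r (g p) (mdir F b p v) := by
  rw [mdir_clm_apply h.mdifferentiableAt_fderiv hb, h.mdir_fderiv]

variable [IsManifold 𝓘(ℝ, F) ∞ M]

lemma SmoothFieldAt.neg {Z : (p : M) → TangentSpace 𝓘(ℝ, F) p} (hZ : SmoothFieldAt Z p) :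
    SmoothFieldAt (fun q => -Z q) p := by
  rw [smoothFieldAt_iff (mem_chart_source F p)] at hZ ⊢
  refine hZ.neg.congr_of_eventuallyEq (Eventually.of_forall fun q => ?_)
  exact map_neg (mdir F (extChartAt 𝓘(ℝ, F) p) q) _

lemma smoothFieldAt_zero : SmoothFieldAt (F := F) (fun q => (0 : TangentSpace 𝓘(ℝ, F) q)) p := by
  rw [smoothFieldAt_iff (mem_chart_source F p)]
  refine (contMDiffAt_const (c := (0 : F))).congr_of_eventuallyEq (Eventually.of_forall fun q => ?_)
  exact map_zero (mdir F (extChartAt 𝓘(ℝ, F) p) q)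

/-- The contact form `θ(v) = dr(i g_* v)` on a Lie bracket of fields on which it is constant. -/
lemma LocalCR.contact_mlieBracket (h : LocalCR T10 g r p)
    {V W : (p : M) → TangentSpace 𝓘(ℝ, F) p} (hV : SmoothFieldAt V p) (hW : SmoothFieldAt W p)
    {cV cW : ℝ} (hcV : ∀ᶠ q in 𝓝 p, fderiv ℝ r (g q) (I • mdir F g q (V q)) = cV)
    (hcW : ∀ᶠ q in 𝓝 p, fderiv ℝ r (g q) (I • mdir F g q (W q)) = cW) :
    fderiv ℝ r (g p) (I • mdir F g p (VectorField.mlieBracket 𝓘(ℝ, F) V W p)) =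
      fderiv ℝ (fderiv ℝ r) (g p) (mdir F g p (W p)) (I • mdir F g p (V p))
      - fderiv ℝ (fderiv ℝ r) (g p) (mdir F g p (V p)) (I • mdir F g p (W p)) := by
  have hg := h.smooth_g.self_of_nhds
  -- Differentiating the constant dr(i g_* Y) trades the unknown derivative of g_* Y for a Hessian
  -- term.
  have key : ∀ (Y : (p : M) → TangentSpace 𝓘(ℝ, F) p) (c : ℝ), SmoothFieldAt Y p →
      (∀ᶠ q in 𝓝 p, fderiv ℝ r (g q) (I • mdir F g q (Y q)) = c) → ∀ v : F,
      fderiv ℝ (fderiv ℝ r) (g p) (mdir F g p v) (I • mdir F g p (Y p))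
        + fderiv ℝ r (g p) (I • mdir F (fun q => mdir F g q (Y q)) p v) = 0 := by
    intro Y c hY hc v
    have hd := (hY.contMDiffAt_mdir hg).mdifferentiableAt (by simp)
    have h1 := h.mdir_fderiv_apply hd.I_smul v
    rw [mdir_eventually_const hc, mdir_I_smul hd] at h1
    exact h1.symm
  have h1 := key V cV hV hcV (W p)
  have h2 := key W cW hW hcW (V p)
  rw [mdir_mlieBracket hV hW hg, smul_sub, map_sub]
  linarith

end LocalCR

/-! ### Levi form and D'Angelo form in terms of the Hessian of a defining function. -/

section CRFormulas

open Filter Topology Complex ComplexConjugate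

variable {E : Type*} [NormedAddCommGroup E] [NormedSpace ℂ E]
  {F : Type*} [NormedAddCommGroup F] [NormedSpace ℝ F]
  {M : Type*} [TopologicalSpace M] [ChartedSpace F M]
  {T10 : (p : M) → Set (CTangent F p)} {g : M → E} {r : E → ℝ} {p : M}

/-- The contact form of the real hypersurface `r = 0`, up to the factor `-i/2`. -/
def contact (F : Type*) [NormedAddCommGroup F] [NormedSpace ℝ F]
    {M : Type*} [TopologicalSpace M] [ChartedSpace F M]
    (r : E → ℝ) (g : M → E) (q : M) (v : F) : ℝ := fderiv ℝ r (g q) (I • mdir F g q v)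

/-- Near `p`, the form `η` is `±` the restriction of `∂r`. -/
def IsContactAt (η : (p : M) → TangentSpace 𝓘(ℝ, F) p →L[ℝ] ℂ) (g : M → E) (r : E → ℝ) (s : ℝ)
    (p : M) : Prop :=
  ∀ᶠ q in 𝓝 p, ∀ v : F, (η q : F →L[ℝ] ℂ) v = s * (-I / 2) * contact F r g q v

lemma contact_add (q : M) (v w : F) : contact F r g q (v + w) = contact F r g q v + contact F r g q w := by
  simp [contact]

lemma contact_sub (q : M) (v w : F) : contact F r g q (v - w) = contact F r g q v - contact F r g q w := by
  simp [contact, smul_sub]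

lemma contact_neg (q : M) (v : F) : contact F r g q (-v) = -contact F r g q v := by
  simp [contact]

lemma contact_zero (q : M) : contact F r g q 0 = 0 := by
  simp [contact]

lemma LocalCR.mdir_snd (h : LocalCR T10 g r p) {z : CTangent F p} (hz : z ∈ T10 p) :
    mdir F g p z.2 = -(I • mdir F g p z.1) := (h.mem_iff.self_of_nhds z).1 hz

/-- The imaginary part of a (1,0)-vector maps to -i times the image of its real part, and that image
is tangent to r = 0. -/
lemma LocalCR.contact_fst (h : LocalCR T10 g r p) {z : CTangent F p} (hz : z ∈ T10 p) :
    contact F r g p z.1 = 0 := by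
  have h1 := h.mdir_snd hz
  have h2 := h.fderiv_mdir z.2
  rw [h1, map_neg, neg_eq_zero] at h2
  exact h2

lemma LocalCR.contact_snd (h : LocalCR T10 g r p) {z : CTangent F p} (hz : z ∈ T10 p) :
    contact F r g p z.2 = 0 := by
  have h2 := h.fderiv_mdir z.1
  refine (congrArg (fun a => fderiv ℝ r (g p) (I • a)) (h.mdir_snd hz)).trans ?_
  simpa only [smul_neg, I_smul_I_smul, neg_neg] using h2

/-- The complex linear extension of a contact form. -/
lemma cext_contact {η : (p : M) → TangentSpace 𝓘(ℝ, F) p →L[ℝ] ℂ} {s : ℝ} {q : M}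
    (hη : ∀ v : F, (η q : F →L[ℝ] ℂ) v = s * (-I / 2) * contact F r g q v) (z : CTangent F q) :
    cext (η q) z = s * (-I / 2) * (contact F r g q z.1 + I * contact F r g q z.2) := by
  have h1 := hη z.1
  have h2 := hη z.2
  calc cext (η q) z = (η q : F →L[ℝ] ℂ) z.1 + I * (η q : F →L[ℝ] ℂ) z.2 := rfl
    _ = _ := by rw [h1, h2]; ring

/-- The vector `m = ± i g_* τ` associated with the transversal field `T = iτ`. -/
def transv (F : Type*) [NormedAddCommGroup F] [NormedSpace ℝ F]
    {M : Type*} [TopologicalSpace M] [ChartedSpace F M] (g : M → E) (s : ℝ)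
    (T : (p : M) → CTangent F p) (q : M) : E := (s : ℂ) • I • mdir F g q (T q).2

lemma smul_transv {s : ℝ} (hs : s ^ 2 = 1) (T : (p : M) → CTangent F p) (q : M) :
    mdir F g q (T q).2 = -((s : ℂ) • I • transv F g s T q) := by
  have hs' : (s : ℂ) * s = 1 := by rw [← sq]; exact_mod_cast hs
  rw [transv, smul_comm I (s : ℂ), smul_smul, hs', one_smul, I_smul_I_smul, neg_neg]

variable [IsManifold 𝓘(ℝ, F) ∞ M]

lemma SmoothCField.fst {Z : (p : M) → CTangent F p} (hZ : SmoothCField Z) (p : M) :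
    SmoothFieldAt (fun q => (Z q).1) p := hZ.1 p

lemma SmoothCField.snd {Z : (p : M) → CTangent F p} (hZ : SmoothCField Z) (p : M) :
    SmoothFieldAt (fun q => (Z q).2) p := hZ.2 p

lemma LocalCR.eventually_contact (h : LocalCR T10 g r p) {L : (p : M) → CTangent F p}
    (hL : IsSection T10 L) : ∀ᶠ q in 𝓝 p, contact F r g q (L q).1 = 0 ∧ contact F r g q (L q).2 = 0 := by
  filter_upwards [h.eventually] with q hq
  exact ⟨hq.contact_fst (hL.2 q), hq.contact_snd (hL.2 q)⟩

lemma LocalCR.contact_bracket (h : LocalCR T10 g r p)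
    {V W : (p : M) → TangentSpace 𝓘(ℝ, F) p} (hV : SmoothFieldAt V p) (hW : SmoothFieldAt W p)
    {cV cW : ℝ} (hcV : ∀ᶠ q in 𝓝 p, contact F r g q (V q) = cV)
    (hcW : ∀ᶠ q in 𝓝 p, contact F r g q (W q) = cW) {a b : E} (ha : mdir F g p (V p) = a)
    (hb : mdir F g p (W p) = b) :
    contact F r g p (VectorField.mlieBracket 𝓘(ℝ, F) V W p : F) =
      fderiv ℝ (fderiv ℝ r) (g p) b (I • a) - fderiv ℝ (fderiv ℝ r) (g p) a (I • b) := by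
  subst ha hb
  exact h.contact_mlieBracket hV hW hcV hcW

/-- The real and imaginary parts of sections of T^{1,0} lie in the kernel of the contact form, so
`contact_bracket` evaluates the four real brackets. The images u and -iu of the two parts assemble
the Hessian values into its hermitian part. -/
lemma LocalCR.leviForm_eq (h : LocalCR T10 g r p)
    {η : (p : M) → TangentSpace 𝓘(ℝ, F) p →L[ℝ] ℂ} {s : ℝ} (hη : IsContactAt η g r s p)
    {L L' : (p : M) → CTangent F p} (hL : IsSection T10 L) (hL' : IsSection T10 L') :
    leviForm η L L' p =
      s * hermPart (fderiv ℝ (fderiv ℝ r) (g p)) (mdir F g p (L p).1) (mdir F g p (L' p).1) := by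
  have hD := h.hess_symm
  set u : E := mdir F g p (L p).1 with hu
  set w : E := mdir F g p (L' p).1 with hw
  have hu2 : mdir F g p (L p).2 = -(I • u) := h.mdir_snd (hL.2 p)
  have hw2 : mdir F g p (L' p).2 = -(I • w) := h.mdir_snd (hL'.2 p)
  have hw3 : mdir F g p (-(L' p).2) = I • w :=
    ((mdir F g p).map_neg (L' p).2).trans (by rw [hw2, neg_neg])
  have c1 := (h.eventually_contact hL).mono fun q hq => hq.1
  have c2 := (h.eventually_contact hL).mono fun q hq => hq.2
  have c1' := (h.eventually_contact hL').mono fun q hq => hq.1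
  have c2' : ∀ᶠ q in 𝓝 p, contact F r g q (-(L' q).2) = 0 := (h.eventually_contact hL').mono
    fun q hq => (contact_neg q _).trans (by rw [hq.2, neg_zero])
  have b11 := h.contact_bracket (hL.1.fst p) (hL'.1.fst p) c1 c1' hu.symm hw.symm
  have b22 := h.contact_bracket (hL.1.snd p) (hL'.1.snd p).neg c2 c2' hu2 hw3
  have b12 := h.contact_bracket (hL.1.fst p) (hL'.1.snd p).neg c1 c2' hu.symm hw3
  have b21 := h.contact_bracket (hL.1.snd p) (hL'.1.fst p) c2 c1' hu2 hw.symm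
  refine (cext_contact hη.self_of_nhds _).trans ?_
  have e1 := (contact_sub (F := F) (r := r) (g := g) p
    (VectorField.mlieBracket 𝓘(ℝ, F) (fun q => (L q).1) (fun q => (L' q).1) p)
    (VectorField.mlieBracket 𝓘(ℝ, F) (fun q => (L q).2) (fun q => -(L' q).2) p)).trans
    (congrArg₂ (· - ·) b11 b22)
  have e2 := (contact_add (F := F) (r := r) (g := g) p
    (VectorField.mlieBracket 𝓘(ℝ, F) (fun q => (L q).1) (fun q => -(L' q).2) p)
    (VectorField.mlieBracket 𝓘(ℝ, F) (fun q => (L q).2) (fun q => (L' q).1) p)).trans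
    (congrArg₂ (· + ·) b12 b21)
  refine (congrArg₂ (fun x y : ℝ => (s : ℂ) * (-I / 2) * ((x : ℂ) + I * (y : ℂ))) e1 e2).trans ?_
  simp only [hermPart]
  apply Complex.ext <;> simp [I_smul_I_smul, hD w u, hD w (I • u), hD (I • w) u, hD (I • w) (I • u)] <;> ring

/-- For T = iτ with contact value c on τ, η(T) = s c/2; the normalization and s² = 1 force c = 2s.
-/
lemma IsContactAt.contact_transversal {η : (p : M) → TangentSpace 𝓘(ℝ, F) p →L[ℝ] ℂ} {s : ℝ}
    (hη : IsContactAt η g r s p) (hs : s ^ 2 = 1) {T : (p : M) → CTangent F p}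
    (hT : IsTransversal η T) : ∀ᶠ q in 𝓝 p, contact F r g q (T q).2 = 2 * s := by
  filter_upwards [hη] with q hq
  have h1 := (cext_contact hq (T q)).symm.trans (hT.normalized q)
  have h2 : contact F r g q (T q).1 = 0 :=
    (congrArg (contact F r g q) (hT.imaginary q)).trans (contact_zero q)
  rw [h2] at h1
  generalize contact F r g q (T q).2 = c at *
  have h3 := congrArg Complex.re h1
  simp at h3
  linear_combination (-2 * s) * h3 * (-1) - c * hs

/-- For m = s i g_*τ, dr(m) is s times the contact value 2s, and im is tangent. Thus ∂r(m) = 1 for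
either orientation s of η. -/
lemma LocalCR.fderiv_transv (h : LocalCR T10 g r p)
    {η : (p : M) → TangentSpace 𝓘(ℝ, F) p →L[ℝ] ℂ} {s : ℝ} (hη : IsContactAt η g r s p)
    (hs : s ^ 2 = 1) {T : (p : M) → CTangent F p} (hT : IsTransversal η T) :
    fderiv ℝ r (g p) (transv F g s T p) = 2 ∧ fderiv ℝ r (g p) (I • transv F g s T p) = 0 := by
  have h1 := (hη.contact_transversal hs hT).self_of_nhds
  have h2 := h.fderiv_mdir (T p).2
  have hreal : ∀ a : E, fderiv ℝ r (g p) ((s : ℂ) • a) = s * fderiv ℝ r (g p) a := fun a =>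
    (map_smul (fderiv ℝ r (g p)) s a)
  constructor
  · rw [transv, hreal]
    change s * contact F r g p (T p).2 = 2
    rw [h1]; linear_combination 2 * hs
  · rw [transv, smul_comm I (s : ℂ), hreal, I_smul_I_smul, map_neg]
    exact (congrArg (fun x => s * -x) h2).trans (by simp)

/-- The contact values of T are the constants 0 and 2s, so the bracket formula applies to T as well.
The sign s enters through both η and T, and drops out. -/
lemma LocalCR.dAngelo_eq (h : LocalCR T10 g r p)
    {η : (p : M) → TangentSpace 𝓘(ℝ, F) p →L[ℝ] ℂ} {s : ℝ} (hη : IsContactAt η g r s p)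
    (hs : s ^ 2 = 1) {T : (p : M) → CTangent F p} (hT : IsTransversal η T)
    {L : (p : M) → CTangent F p} (hL : IsSection T10 L) :
    cext (η p) (cbracket T L p) = 1 / 2 *
      hermPart (fderiv ℝ (fderiv ℝ r) (g p)) (mdir F g p (L p).1) (transv F g s T p) := by
  have hD := h.hess_symm
  set u : E := mdir F g p (L p).1 with hu
  set m : E := transv F g s T p with hm
  have hu2 : mdir F g p (L p).2 = -(I • u) := h.mdir_snd (hL.2 p)
  have ht1 : mdir F g p (T p).1 = 0 :=
    (congrArg (mdir F g p) (hT.imaginary p)).trans (map_zero _)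
  have ht2 : mdir F g p (T p).2 = -((s : ℂ) • I • m) := smul_transv hs T p
  have c1 := (h.eventually_contact hL).mono fun q hq => hq.1
  have c2 := (h.eventually_contact hL).mono fun q hq => hq.2
  have d1 : ∀ᶠ q in 𝓝 p, contact F r g q (T q).1 = 0 := Eventually.of_forall fun q =>
    (congrArg (contact F r g q) (hT.imaginary q)).trans (contact_zero q)
  have d2 := hη.contact_transversal hs hT
  have b11 := h.contact_bracket (hT.smooth.fst p) (hL.1.fst p) d1 c1 ht1 hu.symm
  have b22 := h.contact_bracket (hT.smooth.snd p) (hL.1.snd p) d2 c2 ht2 hu2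
  have b12 := h.contact_bracket (hT.smooth.fst p) (hL.1.snd p) d1 c2 ht1 hu2
  have b21 := h.contact_bracket (hT.smooth.snd p) (hL.1.fst p) d2 c1 ht2 hu.symm
  refine (cext_contact hη.self_of_nhds _).trans ?_
  have e1 := (contact_sub (F := F) (r := r) (g := g) p
    (VectorField.mlieBracket 𝓘(ℝ, F) (fun q => (T q).1) (fun q => (L q).1) p)
    (VectorField.mlieBracket 𝓘(ℝ, F) (fun q => (T q).2) (fun q => (L q).2) p)).trans
    (congrArg₂ (· - ·) b11 b22)
  have e2 := (contact_add (F := F) (r := r) (g := g) p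
    (VectorField.mlieBracket 𝓘(ℝ, F) (fun q => (T q).1) (fun q => (L q).2) p)
    (VectorField.mlieBracket 𝓘(ℝ, F) (fun q => (T q).2) (fun q => (L q).1) p)).trans
    (congrArg₂ (· + ·) b12 b21)
  have hreal : ∀ a : E, (s : ℂ) • a = s • a := fun a => rfl
  have hIs : ∀ a : E, I • s • a = s • I • a := fun a => smul_comm _ _ _
  set D := fderiv ℝ (fderiv ℝ r) (g p) with hDdef
  have e1' := e1.trans (b := _) (c := s * (D (I • u) m - D u (I • m))) (by
    simp only [smul_neg, hIs, I_smul_I_smul, hreal, map_neg, map_smul, neg_apply,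
      smul_apply, smul_eq_mul, map_zero, smul_zero, zero_apply, hD (I • m) u]
    ring)
  have e2' := e2.trans (b := _) (c := s * (D u m + D (I • u) (I • m))) (by
    simp only [smul_neg, hIs, I_smul_I_smul, hreal, map_neg, map_smul, neg_apply,
      smul_apply, smul_eq_mul, map_zero, smul_zero, zero_apply, hD (I • m) (I • u)]
    ring)
  refine (congrArg₂ (fun x y : ℝ => (s : ℂ) * (-I / 2) * ((x : ℂ) + I * (y : ℂ))) e1' e2').trans ?_
  rw [hermPart]
  generalize D (I • u) m = x1
  generalize D u (I • m) = x2
  generalize D u m + D (I • u) (I • m) = y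
  apply Complex.ext
  · simp; linear_combination y / 2 * hs
  · simp; linear_combination (x2 - x1) / 2 * hs

end CRFormulas

/-! ### The (1,1)-form ∂̄_b of the D'Angelo form on the Levi null space. -/

section DAngelo

open Filter Topology Complex ComplexConjugate

variable {E : Type*} [NormedAddCommGroup E] [NormedSpace ℂ E]

lemma fderiv_three_symm_left {r : E → ℝ} {x : E} (hr : ContDiffAt ℝ 4 r x) (a b c : E) :
    fderiv ℝ (fderiv ℝ (fderiv ℝ r)) x a b c = fderiv ℝ (fderiv ℝ (fderiv ℝ r)) x b a c := by
  have h1 : ContDiffAt ℝ 3 (fderiv ℝ r) x := hr.fderiv_right (by norm_num)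
  exact DFunLike.congr_fun ((h1.isSymmSndFDerivAt (by norm_num)).eq a b) c

lemma fderiv_three_symm_right {r : E → ℝ} {x : E} (hr : ContDiffAt ℝ 4 r x) (a b c : E) :
    fderiv ℝ (fderiv ℝ (fderiv ℝ r)) x a b c = fderiv ℝ (fderiv ℝ (fderiv ℝ r)) x a c b := by
  have h2 : DifferentiableAt ℝ (fderiv ℝ (fderiv ℝ r)) x :=
    ((hr.fderiv_right (m := 3) (by norm_num)).fderiv_right (m := 2) (by norm_num)).differentiableAt
      (by norm_num)
  have key : ∀ b c, fderiv ℝ (fun y => fderiv ℝ (fderiv ℝ r) y b c) x a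
      = fderiv ℝ (fderiv ℝ (fderiv ℝ r)) x a b c := by
    intro b c
    have h := (h2.hasFDerivAt.clm_apply (hasFDerivAt_const b x)).clm_apply (hasFDerivAt_const c x)
    rw [h.fderiv]
    simp
  have hs : (fun y => fderiv ℝ (fderiv ℝ r) y b c) =ᶠ[𝓝 x] fun y => fderiv ℝ (fderiv ℝ r) y c b :=
    (eventually_symm hr).mono fun y hy => hy b c
  rw [← key, hs.fderiv_eq, key]

/-- The left side is the antiholomorphic derivative along ū of H(u, m). Symmetry in ū and m̄ turns
it into the derivative along m̄ of H(u, u); as H(u, u) is real, its real part is the real derivative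
along m. -/
lemma re_hermPart_third {C : E →L[ℝ] E →L[ℝ] E →L[ℝ] ℝ} (h1 : ∀ a b c, C a b c = C b a c)
    (h2 : ∀ a b c, C a b c = C a c b) (u m : E) :
    (hermPart (C u) u m + I * hermPart (C (I • u)) u m).re = (hermPart (C m) u u).re := by
  have e1 : C m u u = C u u m := by rw [h1, h2]
  have e2 : C m (I • u) (I • u) = C (I • u) (I • u) m := by rw [h1, h2]
  have e3 : C (I • u) u (I • m) = C u (I • u) (I • m) := h1 _ _ _
  simp only [hermPart, Complex.add_re, Complex.mul_re, Complex.I_re, Complex.I_im, e1, e2, e3]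
  ring

lemma symmPart_eq_delPart (D : E →L[ℝ] E →L[ℝ] ℝ) (u m : E) :
    delPart (D u) m - I * delPart (D (I • u)) m = symmPart D u m := by
  apply Complex.ext <;> simp [delPart, symmPart] <;> ring

variable {F : Type*} [NormedAddCommGroup F] [NormedSpace ℝ F]
  {M : Type*} [TopologicalSpace M] [ChartedSpace F M] [IsManifold 𝓘(ℝ, F) ∞ M]
  {T10 : (p : M) → Set (CTangent F p)} {g : M → E} {r : E → ℝ} {p : M}

omit [IsManifold 𝓘(ℝ, F) ∞ M] in
lemma LocalCR.mdir_hess (h : LocalCR T10 g r p) {a b : M → E}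
    (ha : MDifferentiableAt 𝓘(ℝ, F) 𝓘(ℝ, E) a p) (hb : MDifferentiableAt 𝓘(ℝ, F) 𝓘(ℝ, E) b p) :
    MDifferentiableAt 𝓘(ℝ, F) 𝓘(ℝ, ℝ) (fun q => fderiv ℝ (fderiv ℝ r) (g q) (a q) (b q)) p ∧
    ∀ v, mdir F (fun q => fderiv ℝ (fderiv ℝ r) (g q) (a q) (b q)) p v =
      fderiv ℝ (fderiv ℝ (fderiv ℝ r)) (g p) (mdir F g p v) (a p) (b p)
        + fderiv ℝ (fderiv ℝ r) (g p) (mdir F a p v) (b p)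
        + fderiv ℝ (fderiv ℝ r) (g p) (a p) (mdir F b p v) := by
  have h1 : ContDiffAt ℝ ∞ (fderiv ℝ (fderiv ℝ r)) (g p) :=
    (h.smooth_r.self_of_nhds.fderiv_right (m := ∞) (by simp)).fderiv_right (by simp)
  have h2 : MDifferentiableAt 𝓘(ℝ, F) 𝓘(ℝ, E →L[ℝ] E →L[ℝ] ℝ)
      (fun q => fderiv ℝ (fderiv ℝ r) (g q)) p :=
    (ContDiffAt.comp_contMDiffAt (g := fderiv ℝ (fderiv ℝ r)) h1
      h.smooth_g.self_of_nhds).mdifferentiableAt (by simp)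
  refine ⟨(h2.clm_apply ha).clm_apply hb, fun v => ?_⟩
  rw [mdir_clm_apply (h2.clm_apply ha) hb, mdir_clm_apply h2 ha,
    (h1.differentiableAt (by simp)).hasFDerivAt.comp_mdir
    (h.smooth_g.self_of_nhds.mdifferentiableAt (by simp))]
  rfl

omit [IsManifold 𝓘(ℝ, F) ∞ M] in
lemma LocalCR.mdir_hermPart (h : LocalCR T10 g r p) {a b : M → E}
    (ha : MDifferentiableAt 𝓘(ℝ, F) 𝓘(ℝ, E) a p) (hb : MDifferentiableAt 𝓘(ℝ, F) 𝓘(ℝ, E) b p) :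
    MDifferentiableAt 𝓘(ℝ, F) 𝓘(ℝ, ℂ)
      (fun q => hermPart (fderiv ℝ (fderiv ℝ r) (g q)) (a q) (b q)) p ∧
    ∀ v, mdir F (fun q => hermPart (fderiv ℝ (fderiv ℝ r) (g q)) (a q) (b q)) p v =
      hermPart (fderiv ℝ (fderiv ℝ (fderiv ℝ r)) (g p) (mdir F g p v)) (a p) (b p)
        + hermPart (fderiv ℝ (fderiv ℝ r) (g p)) (mdir F a p v) (b p)
        + hermPart (fderiv ℝ (fderiv ℝ r) (g p)) (a p) (mdir F b p v) := by
  have e1 := h.mdir_hess ha hb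
  have e2 := h.mdir_hess ha.I_smul hb.I_smul
  have e3 := h.mdir_hess ha hb.I_smul
  have e4 := h.mdir_hess ha.I_smul hb
  constructor
  · have := (e1.1.add e2.1).prodMk_space (e3.1.sub e4.1)
    exact ((Complex.equivRealProdCLM.symm : ℝ × ℝ →L[ℝ] ℂ).hasFDerivAt.hasMFDerivAt.comp p
      this.hasMFDerivAt).mdifferentiableAt
  · intro v
    refine (mdir_complex_mk (e1.1.add e2.1) (e3.1.sub e4.1) v).trans ?_
    have s1 := mdir_add e1.1 e2.1 v
    have s2 := mdir_sub e3.1 e4.1 v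
    rw [e1.2, e2.2] at s1
    rw [e3.2, e4.2] at s2
    rw [mdir_I_smul ha, mdir_I_smul hb] at s1
    rw [mdir_I_smul ha, mdir_I_smul hb] at s2
    refine (congrArg₂ Complex.mk s1 s2).trans ?_
    apply Complex.ext <;> simp [hermPart] <;> ring

/-- The value of the D'Angelo form on a complex tangential real vector. -/
lemma LocalCR.dAngelo_real (h : LocalCR T10 g r p)
    {η σ : (p : M) → TangentSpace 𝓘(ℝ, F) p →L[ℝ] ℂ} {s : ℝ} (hη : IsContactAt η g r s p)
    (hs : s ^ 2 = 1) {T : (p : M) → CTangent F p} (hT : IsTransversal η T)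
    (hσ : IsDAngeloForm T10 η T σ) (hsec : ∀ z ∈ T10 p, ∃ L, IsSection T10 L ∧ L p = z)
    {v : F} (hv : contact F r g p v = 0) : (σ p : F →L[ℝ] ℂ) v =
      1 / 4 * hermPart (fderiv ℝ (fderiv ℝ r) (g p)) (mdir F g p v) (transv F g s T p) := by
  -- The vector v is the mean of the (1,0)-vector v + i v' and its conjugate. The form kills the
  -- conjugate, which halves the factor 1/2 of `dAngelo_eq` to 1/4.
  obtain ⟨v', hv'⟩ := (h.range_iff.self_of_nhds (-(I • mdir F g p v))).1
    (by rw [map_neg, neg_eq_zero]; exact hv)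
  have hz : ((v, v') : CTangent F p) ∈ T10 p := (h.mem_iff.self_of_nhds _).2 hv'
  obtain ⟨L, hL, hLp⟩ := hsec _ hz
  have h1 := hσ.holomorphic L hL p
  rw [h.dAngelo_eq hη hs hT hL, hLp] at h1
  have h2 := hσ.antiholomorphic p _ hz
  have h1' : (σ p : F →L[ℝ] ℂ) v + I * (σ p : F →L[ℝ] ℂ) v' = 1 / 2 *
    hermPart (fderiv ℝ (fderiv ℝ r) (g p)) (mdir F g p v) (transv F g s T p) := h1
  have h2' : (σ p : F →L[ℝ] ℂ) v + I * (σ p : F →L[ℝ] ℂ) (-v') = 0 := h2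
  have h3 : (σ p : F →L[ℝ] ℂ) (-v') = -(σ p : F →L[ℝ] ℂ) v' := map_neg (σ p : F →L[ℝ] ℂ) v'
  rw [h3] at h2'
  linear_combination (h1' + h2') / 2

/-- On the Levi null space, the real part of `∂̄_b σ` in terms of a defining function. -/
lemma LocalCR.re_dbarB (h : LocalCR T10 g r p)
    {η σ : (p : M) → TangentSpace 𝓘(ℝ, F) p →L[ℝ] ℂ} {s : ℝ} (hη : IsContactAt η g r s p)
    (hs : s ^ 2 = 1) {T : (p : M) → CTangent F p} (hT : IsTransversal η T)
    (hσ : IsDAngeloForm T10 η T σ) (hsec : ∀ z ∈ T10 p, ∃ L, IsSection T10 L ∧ L p = z)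
    {L : (p : M) → CTangent F p} (hL : IsSection T10 L)
    (hnull : ∀ w, fderiv ℝ r (g p) w = 0 → fderiv ℝ r (g p) (I • w) = 0 →
      hermPart (fderiv ℝ (fderiv ℝ r) (g p)) (mdir F g p (L p).1) w = 0) :
    (dbarB σ L L p).re =
      -(1 / 2) * (hermPart (fderiv ℝ (fderiv ℝ (fderiv ℝ r)) (g p) (transv F g s T p))
        (mdir F g p (L p).1) (mdir F g p (L p).1)).re
      + ((1 / 2 * hermPart (fderiv ℝ (fderiv ℝ r) (g p)) (mdir F g p (L p).1) (transv F g s T p))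
        * conj (symmPart (fderiv ℝ (fderiv ℝ r) (g p)) (mdir F g p (L p).1)
          (transv F g s T p))).re := by
  have hg := h.smooth_g.self_of_nhds
  have hr4 : ContDiffAt ℝ 4 r (g p) := h.smooth_r.self_of_nhds.of_le (by
    have : ((4 : ℕ∞) : WithTop ℕ∞) ≤ ((⊤ : ℕ∞) : WithTop ℕ∞) := WithTop.coe_le_coe.2 le_top
    exact this)
  set D := fderiv ℝ (fderiv ℝ r) (g p) with hD
  set C := fderiv ℝ (fderiv ℝ (fderiv ℝ r)) (g p) with hC
  set uf : M → E := fun q => mdir F g q (L q).1 with huf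
  set mf : M → E := transv F g s T with hmf
  change (dbarB σ L L p).re = -(1 / 2) * (hermPart (C (mf p)) (uf p) (uf p)).re
    + ((1 / 2 * hermPart D (uf p) (mf p)) * conj (symmPart D (uf p) (mf p))).re
  have hu : MDifferentiableAt 𝓘(ℝ, F) 𝓘(ℝ, E) uf p :=
    ((hL.1.fst p).contMDiffAt_mdir hg).mdifferentiableAt (by simp)
  have ht : MDifferentiableAt 𝓘(ℝ, F) 𝓘(ℝ, E) (fun q => mdir F g q (T q).2) p :=
    ((hT.smooth.snd p).contMDiffAt_mdir hg).mdifferentiableAt (by simp)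
  have hm : MDifferentiableAt 𝓘(ℝ, F) 𝓘(ℝ, E) mf p := by
    have := ((s • ContinuousLinearMap.id ℝ E).hasFDerivAt.hasMFDerivAt.comp p
      ht.I_smul.hasMFDerivAt).mdifferentiableAt
    exact this
  -- the function `σ(L)`
  have hσL : (fun q => cext (σ q) (L q)) =ᶠ[𝓝 p]
      fun q => ((1 / 2 : ℝ) • ContinuousLinearMap.id ℝ ℂ)
        (hermPart (fderiv ℝ (fderiv ℝ r) (g q)) (uf q) (mf q)) := by
    filter_upwards [h.eventually, hη.eventually_nhds] with q hq hηq
    rw [hσ.holomorphic L hL q, hq.dAngelo_eq hηq hs hT hL]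
    simp [huf, hmf]
  obtain ⟨hd, hder⟩ := h.mdir_hermPart hu hm
  have hcd : ∀ v : F, mdir F (fun q => cext (σ q) (L q)) p v = 1 / 2 *
      (hermPart (C (mdir F g p v)) (uf p) (mf p) + hermPart D (mdir F uf p v) (mf p)
        + hermPart D (uf p) (mdir F mf p v)) := by
    intro v
    rw [mdir_congr hσL, mdir_continuousLinearMap_comp _ hd, hder]
    simp only [hC, hD, smul_apply, ContinuousLinearMap.id_apply, Complex.real_smul]
    push_cast
    rfl
  -- the components of `[L, conj L]`
  set v1 : F := (L p).1 with hv1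
  set v2 : F := (L p).2 with hv2
  have hgv2 : mdir F g p v2 = -(I • uf p) := h.mdir_snd (hL.2 p)
  have f2 : (fun q => mdir F g q (L q).2) =ᶠ[𝓝 p] fun q => -(I • uf q) :=
    h.eventually.mono fun q hq => hq.mdir_snd (hL.2 q)
  have f3 : (fun q => mdir F g q (-(L q).2)) =ᶠ[𝓝 p] fun q => I • uf q :=
    h.eventually.mono fun q hq => ((mdir F g q).map_neg (L q).2).trans
      (by rw [hq.mdir_snd (hL.2 q), neg_neg])
  have d2 : ∀ v, mdir F (fun q => mdir F g q (L q).2) p v = -(I • mdir F uf p v) := fun v => by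
    rw [mdir_congr f2]
    exact (mdir_continuousLinearMap_comp (-ContinuousLinearMap.id ℝ E) hu.I_smul v).trans
      (congrArg Neg.neg (mdir_I_smul hu v))
  have d3 : ∀ v, mdir F (fun q => mdir F g q (-(L q).2)) p v = I • mdir F uf p v := fun v => by
    rw [mdir_congr f3]
    exact mdir_I_smul hu v
  set z := cbracket L (conjField L) p with hz
  -- For L = a + ib the bracket [L, L̄] is -2i[a, b]: its real part vanishes, and its imaginary part
  -- is expressed through the derivatives of u alone.
  have z1 : mdir F g p z.1 = 0 := by
    have b1 := mdir_mlieBracket (hL.1.fst p) (hL.1.fst p) hg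
    have b2 := mdir_mlieBracket (hL.1.snd p) (hL.1.snd p).neg hg
    refine (map_sub (mdir F g p) _ _).trans ((congrArg₂ (· - ·) b1 b2).trans ?_)
    refine (congrArg₂ (fun x y => _ - _ - (x - y)) (d3 v2) (d2 (-v2))).trans ?_
    simp
  have z2 : mdir F g p z.2 = (2 : ℂ) • (I • mdir F uf p v1 + mdir F uf p v2) := by
    have b1 := mdir_mlieBracket (hL.1.fst p) (hL.1.snd p).neg hg
    have b2 := mdir_mlieBracket (hL.1.snd p) (hL.1.fst p) hg
    refine (map_add (mdir F g p) _ _).trans ((congrArg₂ (· + ·) b1 b2).trans ?_)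
    refine (congrArg₂ (fun x y => x - mdir F uf p (-v2) + (mdir F uf p v2 - y)) (d3 v1)
      (d2 v1)).trans ?_
    rw [two_smul, map_neg]
    abel
  have hs0 : s ≠ 0 := by rintro rfl; norm_num at hs
  -- Since L is Levi null at p, the Levi form at (L, L) is zero and the bracket is complex
  -- tangential, so the D'Angelo form can be evaluated on it.
  have hc : contact F r g p z.1 = 0 ∧ contact F r g p z.2 = 0 := by
    have h1 := (cext_contact hη.self_of_nhds z).symm.trans (h.leviForm_eq hη hL hL)
    have h2 := hnull (uf p) (h.fderiv_mdir v1) (h.contact_fst (hL.2 p))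
    have h2' : hermPart (fderiv ℝ (fderiv ℝ r) (g p)) (mdir F g p (L p).1)
      (mdir F g p (L p).1) = 0 := h2
    rw [h2', mul_zero] at h1
    have h3 : (s : ℂ) * (-I / 2) ≠ 0 := by simp [hs0]
    have h4 := (mul_eq_zero.1 h1).resolve_left h3
    have h5 := congrArg Complex.re h4
    have h6 := congrArg Complex.im h4
    simp at h5 h6
    exact ⟨h5, h6⟩
  have hσz : cext (σ p) z = 1 / 4 * hermPart D (mdir F g p z.1) (mf p)
      + I * (1 / 4 * hermPart D (mdir F g p z.2) (mf p)) :=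
    congrArg₂ (fun x y => x + I * y) (h.dAngelo_real hη hs hT hσ hsec hc.1)
      (h.dAngelo_real hη hs hT hσ hsec hc.2)
  have hder2 : cderiv (fun q => cext (σ q) (L q)) (conjField L p)
      = mdir F (fun q => cext (σ q) (L q)) p v1
        + I * mdir F (fun q => cext (σ q) (L q)) p (-v2) := rfl
  -- the derivatives of the normalization of `m`
  have hnorm : ∀ v, delPart (fderiv ℝ r (g p)) (mdir F mf p v)
      = -delPart (D (mdir F g p v)) (mf p) := by
    intro v
    have k1 := h.mdir_fderiv_apply hm v
    have k2 := h.mdir_fderiv_apply hm.I_smul v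
    rw [mdir_eventually_const (c := (2 : ℝ)) (by
      filter_upwards [h.eventually, hη.eventually_nhds] with q hq hηq
      exact (hq.fderiv_transv hηq hs hT).1)] at k1
    rw [mdir_eventually_const (c := (0 : ℝ)) (by
      filter_upwards [h.eventually, hη.eventually_nhds] with q hq hηq
      exact (hq.fderiv_transv hηq hs hT).2), mdir_I_smul hm] at k2
    have k1' : 0 = D (mdir F g p v) (mf p) + fderiv ℝ r (g p) (mdir F mf p v) := k1
    have k2' : 0 = D (mdir F g p v) (I • mf p) + fderiv ℝ r (g p) (I • mdir F mf p v) := k2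
    apply Complex.ext
    · simp only [delPart, Complex.neg_re]; linarith
    · simp only [delPart, Complex.neg_im]; linarith
  have hone : delPart (fderiv ℝ r (g p)) (mf p) = 1 :=
    delPart_of_normalized (h.fderiv_transv hη hs hT).1
      (h.fderiv_transv hη hs hT).2
  -- On a null vector, H(u, ·) depends only on ∂r of its argument. Hence the derivatives of m
  -- contribute only through ∂r, where `hnorm` gives their value.
  have hG := hermPart_eq_mul_conj_delPart hone hnull
  have g1 := hG (mdir F mf p v1)
  have g2 := hG (mdir F mf p v2)
  rw [hnorm] at g1 g2
  have hgv1 : mdir F g p v1 = uf p := rfl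
  have e1 := hcd v1
  have e2 := hcd (-v2)
  have hP := symmPart_eq_delPart D (uf p) (mf p)
  have n2 : delPart (D (-(I • uf p))) (mf p) = -delPart (D (I • uf p)) (mf p) := by
    apply Complex.ext <;> simp [delPart] <;> ring
  rw [hgv2, n2, neg_neg] at g2
  rw [hgv1] at g1 e1
  rw [map_neg (mdir F g p) v2, hgv2, neg_neg, map_neg (mdir F uf p) v2, map_neg (mdir F mf p) v2,
    hermPart_neg_left, hermPart_neg_right] at e2
  rw [z1, z2, hermPart_smul_left, hermPart_add_left, hermPart_smul_left] at hσz
  have z0 : hermPart D 0 (mf p) = 0 := by simpa using hermPart_smul_left D 0 0 (mf p)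
  -- The derivatives of u in σ(L) cancel against those in σ([L, L̄]). The derivatives of m produce
  -- the product with the symmetric part, and the third derivatives form the first term.
  have key : dbarB σ L L p = -(1 / 2) * (hermPart (C (uf p)) (uf p) (mf p)
      + I * hermPart (C (I • uf p)) (uf p) (mf p))
      + (1 / 2 * hermPart D (uf p) (mf p)) * conj (symmPart D (uf p) (mf p)) := by
    rw [dbarB, hder2, e1, e2, ← hz, hσz, z0, ← hP, g1, g2]
    simp only [map_neg, map_sub, map_mul, conj_I]
    linear_combination (-(1 / 2) * hermPart D (mdir F uf p v1) (mf p)) * I_mul_I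
  rw [key, Complex.add_re, ← re_hermPart_third (fderiv_three_symm_left hr4)
    (fderiv_three_symm_right hr4) (uf p) (mf p)]
  congr 1
  have : (-(1 / 2) : ℂ) = ((-(1 / 2) : ℝ) : ℂ) := by push_cast; ring
  rw [this, Complex.re_ofReal_mul]

end DAngelo

/-! ### Identification of the index form with the boundary discriminant. -/

section IndexForm

open Filter Topology Complex ComplexConjugate

variable {E : Type*} [NormedAddCommGroup E] [NormedSpace ℂ E]
  {F : Type*} [NormedAddCommGroup F] [NormedSpace ℝ F]
  {M : Type*} [TopologicalSpace M] [ChartedSpace F M] [IsManifold 𝓘(ℝ, F) ∞ M]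
  {T10 : (p : M) → Set (CTangent F p)} {g : M → E} {r : E → ℝ} {p : M}

omit [IsManifold 𝓘(ℝ, F) ∞ M] in
lemma LocalCR.exists_mem (h : LocalCR T10 g r p) {w : E} (hw : fderiv ℝ r (g p) w = 0)
    (hw' : fderiv ℝ r (g p) (I • w) = 0) : ∃ z ∈ T10 p, mdir F g p z.1 = w := by
  obtain ⟨v, hv⟩ := (h.range_iff.self_of_nhds w).1 hw
  obtain ⟨v', hv'⟩ := (h.range_iff.self_of_nhds (-(I • w))).1 (by rw [map_neg, hw', neg_zero])
  exact ⟨(v, v'), (h.mem_iff.self_of_nhds _).2 (hv'.trans (by rw [← hv])), hv⟩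

/-- Every (1,0)-vector at p is the value of a section, so testing against sections is testing
against all complex tangential vectors. -/
lemma LocalCR.leviNull_iff (h : LocalCR T10 g r p)
    {η : (p : M) → TangentSpace 𝓘(ℝ, F) p →L[ℝ] ℂ} {s : ℝ} (hη : IsContactAt η g r s p)
    (hs : s ^ 2 = 1) (hsec : ∀ z ∈ T10 p, ∃ L, IsSection T10 L ∧ L p = z)
    {z : CTangent F p} (hz : z ∈ T10 p) :
    z ∈ leviNull T10 η p ↔ ∀ w, fderiv ℝ r (g p) w = 0 → fderiv ℝ r (g p) (I • w) = 0 →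
      hermPart (fderiv ℝ (fderiv ℝ r) (g p)) (mdir F g p z.1) w = 0 := by
  have hs0 : (s : ℂ) ≠ 0 := by
    rintro h0
    rw [Complex.ofReal_eq_zero] at h0
    subst h0
    norm_num at hs
  constructor
  · rintro ⟨-, hz2⟩ w hw hw'
    obtain ⟨z', hz', hw2⟩ := h.exists_mem hw hw'
    obtain ⟨L', hL', hLp'⟩ := hsec z' hz'
    obtain ⟨L, hL, hLp⟩ := hsec z hz
    have h1 := hz2 L L' hL hL' hLp
    rw [h.leviForm_eq hη hL hL', hLp, hLp', hw2] at h1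
    exact (mul_eq_zero.1 h1).resolve_left hs0
  · refine fun hw => ⟨hz, fun L L' hL hL' hLp => ?_⟩
    rw [h.leviForm_eq hη hL hL', hLp, hw _ (h.fderiv_mdir _) (h.contact_fst (hL'.2 p)), mul_zero]

/-- The choice c = 1/κ - a matches the coefficients of |H(u, m)/2|². Here a plays the role of the
side of the boundary, whereas s is the orientation of η and enters only through m. -/
lemma LocalCR.indexForm_eq (h : LocalCR T10 g r p)
    {η σ : (p : M) → TangentSpace 𝓘(ℝ, F) p →L[ℝ] ℂ} {s : ℝ} (hη : IsContactAt η g r s p)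
    (hs : s ^ 2 = 1) {T : (p : M) → CTangent F p} (hT : IsTransversal η T)
    (hσ : IsDAngeloForm T10 η T σ) (hsec : ∀ z ∈ T10 p, ∃ L, IsSection T10 L ∧ L p = z)
    {L : (p : M) → CTangent F p} (hL : IsSection T10 L) (hnull : L p ∈ leviNull T10 η p)
    {a c κ : ℝ} (hc : c = 1 / κ - a) :
    indexForm a c σ L p = leviIndex a κ (fderiv ℝ (fderiv ℝ r) (g p))
      (fderiv ℝ (fderiv ℝ (fderiv ℝ r)) (g p)) (mdir F g p (L p).1) (transv F g s T p) := by
  have h1 := h.re_dbarB hη hs hT hσ hsec hL ((h.leviNull_iff hη hs hsec (hL.2 p)).1 hnull)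
  have h2 := (hσ.holomorphic L hL p).trans (h.dAngelo_eq hη hs hT hL)
  rw [indexForm, h1, h2, leviIndex, hc]
  ring

end IndexForm

/-! ### Lifting ambient fields to the hypersurface. -/

section LocalFrames

open Filter Topology Complex

variable {E : Type*} [NormedAddCommGroup E] [NormedSpace ℂ E]
  {F : Type*} [NormedAddCommGroup F] [NormedSpace ℝ F]
  {M : Type*} [TopologicalSpace M] [ChartedSpace F M]

/-- The map `g` is, near `p`, a smooth immersion with a smooth left inverse. -/
def HasLeftInverse (F : Type*) [NormedAddCommGroup F] [NormedSpace ℝ F]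
    {M : Type*} [TopologicalSpace M] [ChartedSpace F M] (g : M → E) (p : M) : Prop :=
  ∃ R : E → F, (∀ᶠ q in 𝓝 p, ContDiffAt ℝ ∞ R (g q)) ∧
    (∀ᶠ q in 𝓝 p, ContMDiffAt 𝓘(ℝ, F) 𝓘(ℝ, E) ∞ g q) ∧
    ∀ᶠ q in 𝓝 p, R (g q) = extChartAt 𝓘(ℝ, F) p q

lemma mdir_eq_of_leftInverse {g : M → E} {p : M} {R : E → F} (hR : ContDiffAt ℝ ∞ R (g p))
    {f : M → F} (hg : ContMDiffAt 𝓘(ℝ, F) 𝓘(ℝ, E) ∞ g p) (h : ∀ᶠ q in 𝓝 p, R (g q) = f q) (v : F) :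
    mdir F f p v = fderiv ℝ R (g p) (mdir F g p v) := by
  have h' : (fun q => R (g q)) =ᶠ[𝓝 p] f := h
  rw [← mdir_congr h', (hR.differentiableAt (by simp)).hasFDerivAt.comp_mdir
    (hg.mdifferentiableAt (by simp))]
  rfl

variable [IsManifold 𝓘(ℝ, F) ∞ M] {g : M → E} {p : M}

lemma HasLeftInverse.injective (h : HasLeftInverse F g p) :
    ∀ᶠ q in 𝓝 p, Function.Injective (mdir F g q) := by
  obtain ⟨R, hR, hg, hRg⟩ := h
  filter_upwards [hR, hg, hRg.eventually_nhds,
    (chartAt F p).open_source.mem_nhds (mem_chart_source F p)] with q h1 h2 h3 h4 v w hvw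
  have e := mdir_eq_of_leftInverse h1 h2 h3
  refine (mdir_extChartAt_bijective h4).1 ?_
  rw [e, e, hvw]

/-- The derivative of the left inverse recovers the coordinates of V from g_* V, so smoothness of
the image suffices. -/
lemma HasLeftInverse.smoothFieldAt (h : HasLeftInverse F g p) :
    ∀ᶠ q in 𝓝 p, ∀ V : (p : M) → TangentSpace 𝓘(ℝ, F) p,
      ContMDiffAt 𝓘(ℝ, F) 𝓘(ℝ, E) ∞ (fun q' => mdir F g q' (V q')) q → SmoothFieldAt V q := by
  obtain ⟨R, hR, hg, hRg⟩ := h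
  filter_upwards [hR.eventually_nhds, hg.eventually_nhds, hRg.eventually_nhds,
    (chartAt F p).open_source.mem_nhds (mem_chart_source F p)] with q h1 h2 h3 h4 V hV
  rw [smoothFieldAt_iff h4]
  have h5 : ContDiffAt ℝ ∞ (fderiv ℝ R) (g q) := h1.self_of_nhds.fderiv_right (by simp)
  have h6 : ContMDiffAt 𝓘(ℝ, F) 𝓘(ℝ, E →L[ℝ] F) ∞ (fun q' => fderiv ℝ R (g q')) q :=
    ContDiffAt.comp_contMDiffAt (g := fderiv ℝ R) h5 h2.self_of_nhds
  refine (h6.clm_apply hV).congr_of_eventuallyEq ?_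
  filter_upwards [h1, h2, h3.eventually_nhds] with q' k1 k2 k3
  exact mdir_eq_of_leftInverse k1 k2 k3 _

/-- An ambient field tangent to r = 0 is lifted pointwise by choice; the left inverse makes the
resulting field smooth. -/
lemma LocalCR.exists_lift {T10 : (p : M) → Set (CTangent F p)} {r : E → ℝ}
    (h : LocalCR T10 g r p) (hg : HasLeftInverse F g p) {w : E → E}
    (hw : ∀ᶠ q in 𝓝 p, ContDiffAt ℝ ∞ w (g q))
    (hr : ∀ᶠ q in 𝓝 p, fderiv ℝ r (g q) (w (g q)) = 0) :
    ∃ V : (p : M) → TangentSpace 𝓘(ℝ, F) p,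
      ∀ᶠ q in 𝓝 p, SmoothFieldAt V q ∧ mdir F g q (V q) = w (g q) := by
  classical
  let V : (p : M) → TangentSpace 𝓘(ℝ, F) p := fun q =>
    if hq : ∃ v : F, mdir F g q v = w (g q) then hq.choose else (0 : F)
  have hV : ∀ᶠ q in 𝓝 p, mdir F g q (V q) = w (g q) := by
    filter_upwards [h.range_iff, hr] with q h1 h2
    have hq := (h1 _).1 h2
    have : (V q : F) = hq.choose := dif_pos hq
    exact (congrArg (mdir F g q) this).trans hq.choose_spec
  refine ⟨V, ?_⟩
  filter_upwards [hV.eventually_nhds, hg.smoothFieldAt, hw, h.smooth_g] with q h1 h2 h3 h4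
  exact ⟨h2 V ((ContDiffAt.comp_contMDiffAt (g := w) h3 h4).congr_of_eventuallyEq h1),
    h1.self_of_nhds⟩

lemma exists_delPart_eq_one {l : E →L[ℝ] ℝ} (hl : l ≠ 0) : ∃ m : E, delPart l m = 1 := by
  obtain ⟨a, ha⟩ : ∃ a, l a ≠ 0 := by
    by_contra! h
    exact hl (ContinuousLinearMap.ext h)
  have h0 : delPart l a ≠ 0 := fun h => ha ((delPart_eq_zero_iff _ _).1 h).1
  exact ⟨(delPart l a)⁻¹ • a, by rw [delPart_smul, inv_mul_cancel₀ h0]⟩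

lemma contDiffAt_delPart {r : E → ℝ} {x : E} (hr : ContDiffAt ℝ ∞ r x) (a : E) :
    ContDiffAt ℝ ∞ (fun y => delPart (fderiv ℝ r y) a) x := by
  have h1 : ContDiffAt ℝ ∞ (fderiv ℝ r) x := hr.fderiv_right (by simp)
  have h2 : ContDiffAt ℝ ∞ (fun y => (fderiv ℝ r y a / 2, -fderiv ℝ r y (I • a) / 2)) x :=
    ((h1.clm_apply contDiffAt_const).div_const 2).prodMk
      ((h1.clm_apply contDiffAt_const).neg.div_const 2)
  exact (Complex.equivRealProdCLM.symm : ℝ × ℝ →L[ℝ] ℂ).contDiff.contDiffAt.comp x h2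

/-- A smooth extension `w` of a given vector, with prescribed value of `∂r(w)`. -/
lemma exists_delPart_eq {r : E → ℝ} {x₀ : E} (hr : ContDiffAt ℝ ∞ r x₀)
    (hr0 : fderiv ℝ r x₀ ≠ 0) (a : E) :
    ∃ w : E → E, w x₀ = a ∧ ∀ᶠ x in 𝓝 x₀, (ContDiffAt ℝ ∞ r x → ContDiffAt ℝ ∞ w x) ∧
      delPart (fderiv ℝ r x) (w x) = delPart (fderiv ℝ r x₀) a := by
  obtain ⟨m, hm⟩ := exists_delPart_eq_one hr0
  set c := delPart (fderiv ℝ r x₀) a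
  refine ⟨fun x => a + ((c - delPart (fderiv ℝ r x) a) / delPart (fderiv ℝ r x) m) • m,
    by simp [c], ?_⟩
  have hne : ∀ᶠ x in 𝓝 x₀, delPart (fderiv ℝ r x) m ≠ 0 :=
    (contDiffAt_delPart hr m).continuousAt.eventually_ne (by rw [hm]; exact one_ne_zero)
  filter_upwards [hne] with x hx
  refine ⟨fun hrx => ?_, ?_⟩
  · have d : ContDiffAt ℝ ∞ (fun x => (c - delPart (fderiv ℝ r x) a)
        / delPart (fderiv ℝ r x) m) x := by
      have d1 := contDiffAt_delPart hrx m
      have d2 := (contDiffAt_const (c := c)).sub (contDiffAt_delPart hrx a)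
      simp only [div_eq_mul_inv]
      exact d2.mul (d1.inv hx)
    exact contDiffAt_const.add (d.smul contDiffAt_const)
  · rw [delPart_add, delPart_smul, div_mul_cancel₀ _ hx]
    ring

end LocalFrames

/-! ### The boundary as an embedded hypersurface in holomorphic charts. -/

section Hypersurface

open Filter Topology Complex

variable {E : Type*} [NormedAddCommGroup E] [NormedSpace ℂ E]
  {F : Type*} [NormedAddCommGroup F] [NormedSpace ℝ F]
  {X : Type*} [TopologicalSpace X] [ChartedSpace E X]
  {M : Type*} [TopologicalSpace M] [ChartedSpace F M]
  {Ω U : Set X} {ρ : X → ℝ} {ι : M → X} {p : M}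

lemma IsDefiningFunctionOn.contMDiffAt (h : IsDefiningFunctionOn E Ω U ρ) {x : X} (hx : x ∈ U) :
    ContMDiffAt 𝓘(ℝ, E) 𝓘(ℝ, ℝ) ∞ ρ x :=
  h.smooth.contMDiffAt (h.isOpen.mem_nhds hx)

lemma IsDefiningFunctionOn.eq_zero (h : IsDefiningFunctionOn E Ω U ρ) (hΩ : IsOpen Ω) {x : X}
    (hx : x ∈ frontier Ω) (hxU : x ∈ U) : ρ x = 0 := by
  refine le_antisymm ?_ ?_
  · have hc : Tendsto ρ (𝓝[Ω] x) (𝓝 (ρ x)) :=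
      (h.contMDiffAt hxU).continuousAt.tendsto.mono_left nhdsWithin_le_nhds
    have : (𝓝[Ω] x).NeBot := mem_closure_iff_nhdsWithin_neBot.1 hx.1
    refine le_of_tendsto hc ?_
    filter_upwards [self_mem_nhdsWithin, nhdsWithin_le_nhds (h.isOpen.mem_nhds hxU)] with y hy hyU
    exact ((h.mem_iff y hyU).1 hy).le
  · by_contra! hneg
    have := (h.mem_iff x hxU).2 hneg
    exact hx.2 (by rwa [hΩ.interior_eq])

/-- The map `ι` in the preferred chart at `ι p`. -/
def chartMap (E : Type*) [NormedAddCommGroup E] [NormedSpace ℂ E]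
    {X : Type*} [TopologicalSpace X] [ChartedSpace E X]
    {M : Type*} (ι : M → X) (p q : M) : E := extChartAt 𝓘(ℝ, E) (ι p) (ι q)

/-- The function `ρ` in the preferred chart at `x`. -/
def chartFun (E : Type*) [NormedAddCommGroup E] [NormedSpace ℂ E]
    {X : Type*} [TopologicalSpace X] [ChartedSpace E X] (ρ : X → ℝ) (x : X) : E → ℝ :=
  ρ ∘ (extChartAt 𝓘(ℝ, E) x).symm

omit [TopologicalSpace M] in
lemma chartFun_chartMap (ρ : X → ℝ) {q : M} (hq : ι q ∈ (chartAt E (ι p)).source) :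
    chartFun E ρ (ι p) (chartMap E ι p q) = ρ (ι q) := by
  simp only [chartFun, chartMap, Function.comp]
  rw [(extChartAt 𝓘(ℝ, E) (ι p)).left_inv (by simpa using hq)]

omit [NormedSpace ℂ E] in
lemma eventually_mem_chart_source (hι : ContinuousAt ι p) :
    ∀ᶠ q in 𝓝 p, ι q ∈ (chartAt E (ι p)).source :=
  hι.eventually ((chartAt E (ι p)).open_source.mem_nhds (mem_chart_source E (ι p)))

variable [IsManifold 𝓘(ℂ, E) ω X]

lemma contMDiffAt_chartMap {q : M} (hι : ContMDiffAt 𝓘(ℝ, F) 𝓘(ℝ, E) ∞ ι q)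
    (hq : ι q ∈ (chartAt E (ι p)).source) :
    ContMDiffAt 𝓘(ℝ, F) 𝓘(ℝ, E) ∞ (chartMap E ι p) q := by
  have : IsManifold 𝓘(ℝ, E) ∞ X := IsManifold.real_of_complex
  have h1 : ContMDiffAt 𝓘(ℝ, E) 𝓘(ℝ, E) ∞ (extChartAt 𝓘(ℝ, E) (ι p)) (ι q) :=
    contMDiffAt_extChartAt' hq
  exact h1.comp q hι

lemma mdir_chartMap {q : M} (hι : MDifferentiableAt 𝓘(ℝ, F) 𝓘(ℝ, E) ι q)
    (hq : ι q ∈ (chartAt E (ι p)).source) (v : F) :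
    mdir F (chartMap E ι p) q v =
      chartDeriv E (ι p) (ι q) ((mfderiv 𝓘(ℝ, F) 𝓘(ℝ, E) ι q : F →L[ℝ] E) v) := by
  have : IsManifold 𝓘(ℝ, E) ∞ X := IsManifold.real_of_complex
  have : IsManifold 𝓘(ℝ, E) 1 X := IsManifold.of_le (n := ∞) (by simp)
  have h1 := (mdifferentiableAt_extChartAt (I := 𝓘(ℝ, E)) hq).hasMFDerivAt
  have h2 := (h1.comp q hι.hasMFDerivAt).mfderiv
  exact DFunLike.congr_fun h2 v

lemma mem_inducedCR_iff {q : M} (hι : MDifferentiableAt 𝓘(ℝ, F) 𝓘(ℝ, E) ι q)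
    (hq : ι q ∈ (chartAt E (ι p)).source) (z : CTangent F q) :
    z ∈ inducedCR E ι q ↔
      mdir F (chartMap E ι p) q z.2 = -(I • mdir F (chartMap E ι p) q z.1) := by
  set d : F →L[ℝ] E := mfderiv 𝓘(ℝ, F) 𝓘(ℝ, E) ι q with hd
  have e1 := mdir_chartMap hι hq z.1
  have e2 := mdir_chartMap hι hq z.2
  rw [← hd] at e1 e2
  have e3 : -(I • chartDeriv E (ι p) (ι q) (d z.1)) = chartDeriv E (ι p) (ι q) (-(I • d z.1)) := by
    rw [map_neg, chartDeriv_I_smul hq]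
  have e4 : mdir F (chartMap E ι p) q z.2 = -(I • mdir F (chartMap E ι p) q z.1) ↔
      chartDeriv E (ι p) (ι q) (d z.2) = chartDeriv E (ι p) (ι q) (-(I • d z.1)) := by
    rw [← e3]
    exact (iff_of_eq (congrArg₂ (fun a b : E => a = -(I • b)) e2 e1))
  refine Iff.trans ?_ e4.symm
  exact (chartDeriv_bijective hq).1.eq_iff.symm

variable [IsManifold 𝓘(ℝ, F) ∞ M]

omit [IsManifold 𝓘(ℝ, F) ∞ M] in
-- In immersion charts ι is v ↦ A(v, 0); forgetting the second component gives a local retraction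
-- onto M.
lemma exists_retraction (hι : IsSmoothEmbedding 𝓘(ℝ, F) 𝓘(ℝ, E) ∞ ι) (p : M) :
    ∃ π : X → M, (∀ᶠ x in 𝓝 (ι p), ContMDiffAt 𝓘(ℝ, E) 𝓘(ℝ, F) ∞ π x) ∧
      ∀ᶠ q in 𝓝 p, π (ι q) = q := by
  have : IsManifold 𝓘(ℝ, E) ∞ X := IsManifold.real_of_complex
  have h := hι.isImmersion.isImmersionAt p
  set e := h.domChart
  set e' := h.codChart
  set A := h.equiv
  have hw := h.writtenInCharts
  have key : ∀ q ∈ e.source, A.symm (e' (ι q)) = (e q, 0) := by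
    intro q hq
    have h1 := hw (x := e q) (by simpa using e.map_source hq)
    simp only [OpenPartialHomeomorph.extend, Function.comp] at h1
    have h2 : e' (ι q) = A (e q, 0) := by
      have h0 : h.domChart.symm (e q) = q := e.left_inv hq
      simp only [modelWithCornersSelf_partialEquiv, PartialEquiv.trans_refl,
        OpenPartialHomeomorph.toFun_eq_coe, OpenPartialHomeomorph.coe_toPartialEquiv_symm, h0] at h1
      exact h1
    rw [h2, A.symm_apply_apply]
  refine ⟨fun x => e.symm (A.symm (e' x)).1, ?_, ?_⟩
  · have hc : ContinuousAt (fun x => (A.symm (e' x)).1) (ι p) :=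
      (A.symm.continuous.continuousAt.comp (e'.continuousAt h.mem_codChart_source)).fst
    have hp : (A.symm (e' (ι p))).1 ∈ e.target := by
      rw [key p h.mem_domChart_source]
      exact e.map_source h.mem_domChart_source
    filter_upwards [hc.eventually (e.open_target.mem_nhds hp),
      e'.open_source.mem_nhds h.mem_codChart_source] with x hx1 hx2
    have h1 : ContMDiffAt 𝓘(ℝ, E) 𝓘(ℝ, E) ∞ e' x :=
      contMDiffAt_of_mem_maximalAtlas h.codChart_mem_maximalAtlas hx2
    have h2 : ContMDiffAt 𝓘(ℝ, E) 𝓘(ℝ, F) ∞ (fun x => (A.symm (e' x)).1) x :=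
      ContDiffAt.comp_contMDiffAt (g := fun y => (A.symm y).1)
        (A.symm.contDiff.fst.contDiffAt) h1
    exact (contMDiffAt_symm_of_mem_maximalAtlas h.domChart_mem_maximalAtlas hx1).comp x h2
  · filter_upwards [e.open_source.mem_nhds h.mem_domChart_source] with q hq
    simp only [key q hq, e.left_inv hq]

lemma hasLeftInverse_chartMap (hι : IsSmoothEmbedding 𝓘(ℝ, F) 𝓘(ℝ, E) ∞ ι) (p : M) :
    HasLeftInverse F (chartMap E ι p) p := by
  have : IsManifold 𝓘(ℝ, E) ∞ X := IsManifold.real_of_complex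
  obtain ⟨π, hπ, hπι⟩ := exists_retraction hι p
  have hιs := hι.contMDiff
  have hsrc := eventually_mem_chart_source (E := E) (hιs p).continuousAt
  refine ⟨extChartAt 𝓘(ℝ, F) p ∘ π ∘ (extChartAt 𝓘(ℝ, E) (ι p)).symm, ?_, ?_, ?_⟩
  · filter_upwards [hsrc, (hιs p).continuousAt.eventually hπ, hπι,
      (chartAt F p).open_source.mem_nhds (mem_chart_source F p)] with q h1 h2 h3 h4
    have h1' : ι q ∈ (extChartAt 𝓘(ℝ, E) (ι p)).source := by simpa using h1
    have e1 : (extChartAt 𝓘(ℝ, E) (ι p)).symm (chartMap E ι p q) = ι q :=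
      (extChartAt 𝓘(ℝ, E) (ι p)).left_inv h1'
    rw [← contMDiffAt_iff_contDiffAt]
    have c1 : ContMDiffAt 𝓘(ℝ, E) 𝓘(ℝ, E) ∞ (extChartAt 𝓘(ℝ, E) (ι p)).symm (chartMap E ι p q) :=
      (contMDiffOn_extChartAt_symm (ι p)).contMDiffAt
        (extChartAt_target_mem_nhds' (PartialEquiv.map_source _ h1'))
    have c2 : ContMDiffAt 𝓘(ℝ, E) 𝓘(ℝ, F) ∞ (π ∘ (extChartAt 𝓘(ℝ, E) (ι p)).symm)
        (chartMap E ι p q) := ContMDiffAt.comp _ (by rwa [e1]) c1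
    refine ContMDiffAt.comp (I' := 𝓘(ℝ, F)) _ ?_ c2
    have e2 : (π ∘ (extChartAt 𝓘(ℝ, E) (ι p)).symm) (chartMap E ι p q) = q := by
      simp only [Function.comp, e1, h3]
    rw [e2]
    exact contMDiffAt_extChartAt' h4
  · exact hsrc.mono fun q hq => contMDiffAt_chartMap (hιs q) hq
  · filter_upwards [hsrc, hπι] with q h1 h2
    have e1 : (extChartAt 𝓘(ℝ, E) (ι p)).symm (chartMap E ι p q) = ι q :=
      (extChartAt 𝓘(ℝ, E) (ι p)).left_inv (by simpa using h1)
    simp only [Function.comp, e1, h2]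

lemma fderiv_chartFun_ne_zero (hρ : IsDefiningFunctionOn E Ω U ρ) {x₀ x : X}
    (hx : x ∈ (chartAt E x₀).source) (hxU : x ∈ U) (hxΩ : x ∈ frontier Ω) :
    fderiv ℝ (chartFun E ρ x₀) (extChartAt 𝓘(ℝ, E) x₀ x) ≠ 0 := by
  intro h0
  refine hρ.mfderiv_ne_zero x ⟨hxΩ, hxU⟩ ?_
  refine ContinuousLinearMap.ext fun v => ?_
  refine (mfderiv_eq_fderiv_chart hx ((hρ.contMDiffAt hxU).mdifferentiableAt (by simp)) v).trans ?_
  exact DFunLike.congr_fun h0 _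

/-- Since ρ vanishes on the boundary, the image of the differential lies in the kernel of dr. It is
all of it because the differential is injective, dr ≠ 0, and M has real codimension one. -/
lemma localCR_of_isDefiningFunctionOn [FiniteDimensional ℂ E] [FiniteDimensional ℝ F]
    (hF : Module.finrank ℝ F + 1 = Module.finrank ℝ E) (hΩ : IsOpen Ω)
    (hι : IsSmoothEmbedding 𝓘(ℝ, F) 𝓘(ℝ, E) ∞ ι) (hιΩ : range ι = frontier Ω)
    (hρ : IsDefiningFunctionOn E Ω U ρ) (hp : ι p ∈ U) :
    LocalCR (inducedCR E (F := F) ι) (chartMap E ι p) (chartFun E ρ (ι p)) p := by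
  have : IsManifold 𝓘(ℝ, E) ∞ X := IsManifold.real_of_complex
  have : FiniteDimensional ℝ E := FiniteDimensional.complexToReal E
  have hιs := hι.contMDiff
  have hsrc := eventually_mem_chart_source (E := E) (hιs p).continuousAt
  have hU : ∀ᶠ q in 𝓝 p, ι q ∈ U := (hιs p).continuousAt.eventually (hρ.isOpen.mem_nhds hp)
  have hfr : ∀ q, ι q ∈ frontier Ω := fun q => hιΩ ▸ mem_range_self q
  have hg := hsrc.mono fun q hq => contMDiffAt_chartMap (p := p) (hιs q) hq
  have hr : ∀ᶠ q in 𝓝 p, ContDiffAt ℝ ∞ (chartFun E ρ (ι p)) (chartMap E ι p q) := by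
    filter_upwards [hsrc, hU] with q h1 h2
    exact contDiffAt_comp_extChartAt_symm le_rfl h1 (hρ.contMDiffAt h2)
  refine ⟨hg, hr, ?_, ?_⟩
  · filter_upwards [hsrc.eventually_nhds, hU.eventually_nhds, hg, hr,
      (hasLeftInverse_chartMap hι p).injective] with q h1 h2 h3 h4 h5
    have hz : ∀ v, fderiv ℝ (chartFun E ρ (ι p)) (chartMap E ι p q)
        (mdir F (chartMap E ι p) q v) = 0 := by
      intro v
      have e := (h4.differentiableAt (by simp)).hasFDerivAt.comp_mdir
        (h3.mdifferentiableAt (by simp))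
      rw [mdir_eventually_const (c := (0 : ℝ)) (by
        filter_upwards [h1, h2] with q' k1 k2
        rw [chartFun_chartMap ρ k1, hρ.eq_zero hΩ (hfr q') k2])] at e
      exact (DFunLike.congr_fun e v).symm
    have hne := fderiv_chartFun_ne_zero hρ h1.self_of_nhds h2.self_of_nhds (hfr q)
    set l := fderiv ℝ (chartFun E ρ (ι p)) (chartMap E ι p q) with hl
    have hl0 : (l : E →ₗ[ℝ] ℝ) ≠ 0 := fun h => hne (ContinuousLinearMap.coe_inj.1 h)
    have hle : LinearMap.range (mdir F (chartMap E ι p) q : F →ₗ[ℝ] E) ≤ LinearMap.ker (l : E →ₗ[ℝ] ℝ) := by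
      rintro _ ⟨v, rfl⟩
      exact hz v
    have hk := Module.Dual.finrank_ker_add_one_of_ne_zero (f := (l : E →ₗ[ℝ] ℝ)) hl0
    have hrk := LinearMap.finrank_range_of_inj (f := (mdir F (chartMap E ι p) q : F →ₗ[ℝ] E)) h5
    have heq := Submodule.eq_of_le_of_finrank_eq hle (by omega)
    intro a
    have : a ∈ LinearMap.range (mdir F (chartMap E ι p) q : F →ₗ[ℝ] E) ↔ a ∈ LinearMap.ker (l : E →ₗ[ℝ] ℝ) := by rw [heq]
    exact this.symm
  · exact hsrc.mono fun q hq => mem_inducedCR_iff ((hιs q).mdifferentiableAt (by simp)) hq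

end Hypersurface

/-! ### Global sections and transversal fields by partitions of unity. -/

section GlobalFields

open Filter Topology Complex

variable {F : Type*} [NormedAddCommGroup F] [NormedSpace ℝ F]
  {M : Type*} [TopologicalSpace M] [ChartedSpace F M] [IsManifold 𝓘(ℝ, F) ∞ M]

/-- Convexity of the pointwise constraints allows local solutions to be averaged with a partition of
unity. -/
lemma exists_smooth_field [FiniteDimensional ℝ F] [T2Space M] [SigmaCompactSpace M]
    (t : ∀ q : M, Set (TangentSpace 𝓘(ℝ, F) q)) (ht : ∀ q, Convex ℝ (t q))
    (hloc : ∀ p : M, ∃ V : (q : M) → TangentSpace 𝓘(ℝ, F) q,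
      ∀ᶠ q in 𝓝 p, SmoothFieldAt V q ∧ V q ∈ t q) :
    ∃ V : (q : M) → TangentSpace 𝓘(ℝ, F) q, (∀ q, SmoothFieldAt V q) ∧ ∀ q, V q ∈ t q := by
  have : IsManifold 𝓘(ℝ, F) 1 M := IsManifold.one_of_infty ‹_›
  obtain ⟨s, hs⟩ := exists_contMDiffSection_forall_mem_convex_of_local (n := ⊤) 𝓘(ℝ, F)
    (fun q : M => TangentSpace 𝓘(ℝ, F) q) t ht (fun p => by
      obtain ⟨V, hV⟩ := hloc p
      refine ⟨_, hV, V, fun q hq => ?_, fun q hq => hq.2⟩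
      exact ContMDiffAt.contMDiffWithinAt hq.1)
  exact ⟨s, fun q => s.contMDiff q, hs⟩

variable {E : Type*} [NormedAddCommGroup E] [NormedSpace ℂ E]
  {X : Type*} [TopologicalSpace X] [ChartedSpace E X] [IsManifold 𝓘(ℂ, E) ω X]
  {Ω U : Set X} {ρ : X → ℝ} {ι : M → X} {p : M}

/-- The real 1-form `v ↦ dρ(J dι v)` on `M`. -/
def ambientContact (E : Type*) [NormedAddCommGroup E] [NormedSpace ℂ E]
    (F : Type*) [NormedAddCommGroup F] [NormedSpace ℝ F]
    {X : Type*} [TopologicalSpace X] [ChartedSpace E X]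
    {M : Type*} [TopologicalSpace M] [ChartedSpace F M] (ρ : X → ℝ) (ι : M → X) (q : M) :
    F →L[ℝ] ℝ :=
  (mfderiv 𝓘(ℝ, E) 𝓘(ℝ, ℝ) ρ (ι q) : E →L[ℝ] ℝ).comp
    (((I • ContinuousLinearMap.id ℂ E).restrictScalars ℝ).comp
      (mfderiv 𝓘(ℝ, F) 𝓘(ℝ, E) ι q : F →L[ℝ] E))

omit [IsManifold 𝓘(ℝ, F) ∞ M] in
lemma contact_eq_ambientContact {q : M} (hι : MDifferentiableAt 𝓘(ℝ, F) 𝓘(ℝ, E) ι q)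
    (hq : ι q ∈ (chartAt E (ι p)).source) (hρ : MDifferentiableAt 𝓘(ℝ, E) 𝓘(ℝ, ℝ) ρ (ι q)) (v : F) :
    contact F (chartFun E ρ (ι p)) (chartMap E ι p) q v = ambientContact E F ρ ι q v := by
  set d : F →L[ℝ] E := mfderiv 𝓘(ℝ, F) 𝓘(ℝ, E) ι q with hd
  have h1 := mfderiv_eq_fderiv_chart hq hρ (I • d v)
  have h2 := mdir_chartMap hι hq v
  rw [chartDeriv_I_smul hq] at h1
  exact (congrArg (fun a : E => fderiv ℝ (chartFun E ρ (ι p)) (chartMap E ι p q) (I • a)) h2).trans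
    h1.symm

variable [FiniteDimensional ℝ F] [FiniteDimensional ℂ E] [T2Space M] [SigmaCompactSpace M]

/-- Only the real part needs to be constructed: a (1,0)-field is determined by it through the
injective differential, and smoothness passes to the imaginary part. -/
lemma exists_isSection (hF : Module.finrank ℝ F + 1 = Module.finrank ℝ E) (hΩ : IsOpen Ω)
    (hι : IsSmoothEmbedding 𝓘(ℝ, F) 𝓘(ℝ, E) ∞ ι) (hιΩ : range ι = frontier Ω)
    (hΩs : HasSmoothBoundary E Ω) (p : M) (z : CTangent F p) (hz : z ∈ inducedCR E ι p) :
    ∃ L, IsSection (inducedCR E ι) L ∧ L p = z := by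
  have hloc : ∀ q : M, ∃ r : E → ℝ, LocalCR (inducedCR E (F := F) ι) (chartMap E ι q) r q ∧
      fderiv ℝ r (chartMap E ι q q) ≠ 0 := by
    intro q
    have hq : ι q ∈ frontier Ω := hιΩ ▸ mem_range_self q
    obtain ⟨U, ρ, hqU, hρ⟩ := hΩs (ι q) hq
    exact ⟨_, localCR_of_isDefiningFunctionOn hF hΩ hι hιΩ hρ hqU,
      fderiv_chartFun_ne_zero hρ (mem_chart_source E (ι q)) hqU hq⟩
  let d : ∀ q : M, F →L[ℝ] E := fun q => mfderiv 𝓘(ℝ, F) 𝓘(ℝ, E) ι q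
  -- Complex tangency is a linear condition and the value at p an affine one, so this set is convex;
  -- away from p the zero vector belongs to it.
  let t : ∀ q : M, Set F := fun q => {v : F | (∃ v' : F, d q v' = -(I • d q v)) ∧ (q = p → v = z.1)}
  have hconv : ∀ q, Convex ℝ (t q) := by
    rintro q v ⟨⟨v', hv'⟩, hvp⟩ w ⟨⟨w', hw'⟩, hwp⟩ a b ha hb hab
    refine ⟨⟨a • v' + b • w', ?_⟩, fun h => ?_⟩
    · rw [map_add, map_add, map_smul, map_smul, map_smul, map_smul, hv', hw', smul_add,
        smul_comm I a, smul_comm I b, smul_neg, smul_neg, neg_add]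
    · have e : ∀ c : F, v = c → w = c → a • v + b • w = c := by
        rintro c rfl rfl
        rw [← add_smul, hab, one_smul]
      exact e _ (hvp h) (hwp h)
  obtain ⟨V, hV, hVt⟩ := exists_smooth_field (M := M) t hconv (by
    intro q
    by_cases hqp : q = p
    · subst hqp
      obtain ⟨r, h, hr0⟩ := hloc q
      obtain ⟨w, hw0, hw⟩ := exists_delPart_eq h.smooth_r.self_of_nhds hr0
        (mdir F (chartMap E ι q) q z.1)
      have ha : delPart (fderiv ℝ r (chartMap E ι q q)) (mdir F (chartMap E ι q) q z.1) = 0 :=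
        (delPart_eq_zero_iff _ _).2 ⟨h.fderiv_mdir _, h.contact_fst hz⟩
      rw [ha] at hw
      have hw' := h.continuousAt.eventually hw
      have hw2 : ∀ᶠ q' in 𝓝 q, fderiv ℝ r (chartMap E ι q q') (w (chartMap E ι q q')) = 0 :=
        hw'.mono fun q' hq' => ((delPart_eq_zero_iff _ _).1 hq'.2).1
      obtain ⟨V, hV⟩ := h.exists_lift (hasLeftInverse_chartMap hι q) (w := w)
        ((hw'.and h.smooth_r).mono fun q' hq' => hq'.1.1 hq'.2) hw2
      refine ⟨V, ?_⟩
      filter_upwards [hV, hw', h.range_iff, h.mem_iff] with q' h1 h2 h3 h4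
      refine ⟨h1.1, ?_, ?_⟩
      · obtain ⟨v', hv'⟩ := (h3 (-(I • w (chartMap E ι q q')))).1
          (by rw [map_neg, ((delPart_eq_zero_iff _ _).1 h2.2).2, neg_zero])
        exact ⟨v', (h4 (V q', v')).2 (hv'.trans (by rw [← h1.2]))⟩
      · rintro rfl
        refine (hasLeftInverse_chartMap hι q').injective.self_of_nhds ?_
        rw [← hw0]
        exact h1.2
    · refine ⟨fun _ => (0 : F), ?_⟩
      filter_upwards [isOpen_ne.mem_nhds hqp] with q' hq'
      refine ⟨smoothFieldAt_zero, ⟨0, ?_⟩, fun h => (hq' h).elim⟩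
      have e : d q' 0 = -(I • d q' 0) := by simp
      exact e)
  choose hV1 hVp using hVt
  choose V' hV' using hV1
  have hL : ∀ q, ((V q, V' q) : CTangent F q) ∈ inducedCR E ι q := hV'
  refine ⟨fun q => (V q, V' q), ⟨⟨hV, fun q => ?_⟩, hL⟩, ?_⟩
  · obtain ⟨r, h, -⟩ := hloc q
    refine (hasLeftInverse_chartMap hι q).smoothFieldAt.self_of_nhds V' ?_
    have h1 := ((hV q).contMDiffAt_mdir h.smooth_g.self_of_nhds)
    have h2 : ContMDiffAt 𝓘(ℝ, F) 𝓘(ℝ, E) ∞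
        (fun q' => -(I • mdir F (chartMap E ι q) q' (V q'))) q :=
      ContDiffAt.comp_contMDiffAt (g := fun a : E => -(I • a))
        (((I • ContinuousLinearMap.id ℂ E).restrictScalars ℝ).contDiff.neg.contDiffAt) h1
    exact h2.congr_of_eventuallyEq (h.mem_iff.mono fun q' hq' => (hq' _).1 (hL q'))
  · have e1 : V p = z.1 := hVp p rfl
    refine Prod.ext e1 ?_
    obtain ⟨r, h, -⟩ := hloc p
    refine (hasLeftInverse_chartMap hι p).injective.self_of_nhds ?_
    have k1 := h.mdir_snd (hL p)
    have k2 := h.mdir_snd hz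
    exact k1.trans ((congrArg (fun v : F => -(I • mdir F (chartMap E ι p) p v)) e1).trans k2.symm)

/-- If ∂r(m) = 1, then w = -im satisfies dr(w) = 0 and dr(iw) = 2, so it lifts locally. The
requirement is affine, hence convex, and local solutions patch. -/
lemma exists_ambientContact_eq (hF : Module.finrank ℝ F + 1 = Module.finrank ℝ E) (hΩ : IsOpen Ω)
    (hι : IsSmoothEmbedding 𝓘(ℝ, F) 𝓘(ℝ, E) ∞ ι) (hιΩ : range ι = frontier Ω)
    (hρ : IsDefiningFunctionOn E Ω univ ρ) :
    ∃ τ : (q : M) → TangentSpace 𝓘(ℝ, F) q, (∀ q, SmoothFieldAt τ q) ∧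
      ∀ q, ambientContact E F ρ ι q (τ q) = 2 := by
  have hconv : ∀ q, Convex ℝ {v : F | ambientContact E F ρ ι q v = 2} := fun q =>
    convex_hyperplane (ambientContact E F ρ ι q).isLinear 2
  refine exists_smooth_field (M := M) (fun q => {v : F | ambientContact E F ρ ι q v = 2}) hconv ?_
  · intro p
    have hp : ι p ∈ frontier Ω := hιΩ ▸ mem_range_self p
    have h := localCR_of_isDefiningFunctionOn hF hΩ hι hιΩ hρ (mem_univ (ι p))
    have hr0 := fderiv_chartFun_ne_zero hρ (mem_chart_source E (ι p)) (mem_univ _) hp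
    obtain ⟨m, hm⟩ := exists_delPart_eq_one hr0
    obtain ⟨w, -, hw⟩ := exists_delPart_eq h.smooth_r.self_of_nhds hr0 (-I • m)
    rw [delPart_smul] at hw
    have hw' := h.continuousAt.eventually hw
    have hw2 : ∀ᶠ q in 𝓝 p, fderiv ℝ (chartFun E ρ (ι p)) (chartMap E ι p q)
        (w (chartMap E ι p q)) = 0 ∧ fderiv ℝ (chartFun E ρ (ι p)) (chartMap E ι p q)
        (I • w (chartMap E ι p q)) = 2 := by
      filter_upwards [hw'] with q hq
      have e := hq.2.trans (congrArg (-I * ·) hm)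
      have e1 := congrArg Complex.re e
      have e2 := congrArg Complex.im e
      simp [delPart] at e1 e2
      exact ⟨e1, by linarith⟩
    obtain ⟨V, hV⟩ := h.exists_lift (hasLeftInverse_chartMap hι p) (w := w)
      ((hw'.and h.smooth_r).mono fun q' hq' => hq'.1.1 hq'.2) (hw2.mono fun q hq => hq.1)
    refine ⟨V, ?_⟩
    have hιs := hι.contMDiff
    filter_upwards [hV, hw2, eventually_mem_chart_source (E := E) (hιs p).continuousAt]
      with q h1 h2 h3
    refine ⟨h1.1, ?_⟩
    refine (contact_eq_ambientContact ((hιs q).mdifferentiableAt (by simp)) h3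
      ((hρ.contMDiffAt (mem_univ _)).mdifferentiableAt (by simp)) _).symm.trans ?_
    exact (congrArg (fun a : E => fderiv ℝ (chartFun E ρ (ι p)) (chartMap E ι p q) (I • a))
      h1.2).trans h2.2

end GlobalFields

/-! ### Powers of a defining function and pseudoconvexity, in a fixed chart. -/

section PowerFunctions

open Filter Topology Complex

variable {E : Type*} [NormedAddCommGroup E] [NormedSpace ℂ E]
  {X : Type*} [TopologicalSpace X] [ChartedSpace E X]
  {Ω U : Set X} {ρ : X → ℝ}

lemma contMDiffAt_rpow_side {x : X} {s γ : ℝ} (hρ : ContMDiffAt 𝓘(ℝ, E) 𝓘(ℝ, ℝ) ∞ ρ x)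
    (hside : s * ρ x < 0) :
    ContMDiffAt 𝓘(ℝ, E) 𝓘(ℝ, ℝ) 2 (fun y => -s * (-(s * ρ y)) ^ γ) x := by
  have h : ContDiffAt ℝ 2 (fun y : ℝ => -s * (-(s * y)) ^ γ) (ρ x) := by
    have : ContDiffAt ℝ 2 (fun y : ℝ => (-(s * y)) ^ γ) (ρ x) :=
      ContDiffAt.rpow_const_of_ne (by fun_prop) (by linarith)
    exact contDiffAt_const.mul this
  exact ContDiffAt.comp_contMDiffAt (g := fun y : ℝ => -s * (-(s * y)) ^ γ) h
    (hρ.of_le two_le_infty)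

variable [IsManifold 𝓘(ℂ, E) ω X]

lemma complexHessian_rpow {x₀ x : X} (hx : x ∈ (chartAt E x₀).source) {s κ γ : ℝ}
    (hs : s ^ 2 = 1) (hγ : γ = 1 - s * κ) (hρ : ContMDiffAt 𝓘(ℝ, E) 𝓘(ℝ, ℝ) ∞ ρ x)
    (hside : s * ρ x < 0) (v : E) :
    complexHessian (fun y => -s * (-(s * ρ y)) ^ γ) x v = γ * (-(s * ρ x)) ^ (γ - 1) *
      powerHess s κ (chartFun E ρ x₀) (extChartAt 𝓘(ℝ, E) x₀ x) (chartDeriv E x₀ x v) / 4 := by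
  have hrx : chartFun E ρ x₀ (extChartAt 𝓘(ℝ, E) x₀ x) = ρ x := by
    simp only [chartFun, Function.comp]
    rw [(extChartAt 𝓘(ℝ, E) x₀).left_inv (by simpa using hx)]
  have hr : ContDiffAt ℝ 2 (chartFun E ρ x₀) (extChartAt 𝓘(ℝ, E) x₀ x) :=
    contDiffAt_comp_extChartAt_symm two_le_infty hx (hρ.of_le two_le_infty)
  have h := hermPart_rpow hr hs hγ (by rwa [hrx]) (chartDeriv E x₀ x v)
  rw [hrx] at h
  rw [complexHessian_eq_chart hx (contMDiffAt_rpow_side hρ hside), ← h]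
  rfl

/-- The chart derivative is bijective and commutes with i, so it carries complex tangent vectors
onto complex tangent vectors and transports the Levi condition. -/
lemma hermPart_nonneg_of_pseudoconvex (hpsc : HasPseudoconvexBoundary E Ω)
    (hρ : IsDefiningFunctionOn E Ω U ρ) {x₀ x : X} (hx : x ∈ (chartAt E x₀).source)
    (hxΩ : x ∈ frontier Ω) (hxU : x ∈ U) {v : E}
    (hv : delPart (fderiv ℝ (chartFun E ρ x₀) (extChartAt 𝓘(ℝ, E) x₀ x)) v = 0) :
    0 ≤ (hermPart (fderiv ℝ (fderiv ℝ (chartFun E ρ x₀)) (extChartAt 𝓘(ℝ, E) x₀ x)) v v).re := by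
  obtain ⟨w, rfl⟩ := (chartDeriv_bijective hx).2 v
  have hs := hρ.contMDiffAt hxU
  have hd := hs.mdifferentiableAt (by simp)
  obtain ⟨h1, h2⟩ := (delPart_eq_zero_iff _ _).1 hv
  rw [← chartDeriv_I_smul hx] at h2
  have h3 := hpsc U ρ hρ x ⟨hxΩ, hxU⟩ w ((mfderiv_eq_fderiv_chart hx hd w).trans h1)
    ((mfderiv_eq_fderiv_chart hx hd (I • w)).trans h2)
  rw [complexHessian_eq_chart hx (hs.of_le two_le_infty)] at h3
  have h4 : 0 ≤ (hermPart (fderiv ℝ (fderiv ℝ (chartFun E ρ x₀)) (extChartAt 𝓘(ℝ, E) x₀ x))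
    (chartDeriv E x₀ x w) (chartDeriv E x₀ x w)).re / 4 := h3
  linarith

end PowerFunctions

/-! ### Smoothness of forms induced by local maps. -/

section InducedForms

open Filter Topology Complex

variable {F : Type*} [NormedAddCommGroup F] [NormedSpace ℝ F]
  {M : Type*} [TopologicalSpace M] [ChartedSpace F M] [IsManifold 𝓘(ℝ, F) ∞ M]

/-- A 1-form is smooth if near every point it is `v ↦ A_q(g_* v)` for smooth `g` and `A`. -/
lemma smoothForm_of_local {V : Type*} [NormedAddCommGroup V] [NormedSpace ℝ V]
    {η : (p : M) → TangentSpace 𝓘(ℝ, F) p →L[ℝ] ℂ}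
    (h : ∀ p, ∃ (g : M → V) (A : M → V →L[ℝ] ℂ), (∀ᶠ q in 𝓝 p, ContMDiffAt 𝓘(ℝ, F) 𝓘(ℝ, V) ∞ g q) ∧
      ContMDiffAt 𝓘(ℝ, F) 𝓘(ℝ, V →L[ℝ] ℂ) ∞ A p ∧
      ∀ᶠ q in 𝓝 p, ∀ v : F, (η q : F →L[ℝ] ℂ) v = A q (mdir F g q v)) : SmoothForm η := by
  have : IsManifold 𝓘(ℝ, F) 1 M := IsManifold.one_of_infty ‹_›
  intro p
  obtain ⟨g, A, hg, hA, hη⟩ := h p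
  rw [contMDiffAt_hom_bundle]
  refine ⟨contMDiffAt_id, ?_⟩
  set φ := extChartAt 𝓘(ℝ, F) p with hφ
  have hp := mem_chart_source F p
  have h1 : ContDiffAt ℝ ∞ (fderiv ℝ (g ∘ φ.symm)) (φ p) :=
    (contDiffAt_written le_rfl hp hg.self_of_nhds).fderiv_right (by simp)
  have h2 : ContMDiffAt 𝓘(ℝ, F) 𝓘(ℝ, F →L[ℝ] V) ∞ (fun q => fderiv ℝ (g ∘ φ.symm) (φ q)) p :=
    ContDiffAt.comp_contMDiffAt (g := fderiv ℝ (g ∘ φ.symm)) h1 contMDiffAt_extChartAt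
  refine (hA.clm_comp h2).congr_of_eventuallyEq ?_
  filter_upwards [hg, hη, (chartAt F p).open_source.mem_nhds hp] with q k1 k2 k3
  set e := trivializationAt F (TangentSpace 𝓘(ℝ, F) : M → Type _) p
  have k4 : q ∈ e.baseSet := by simpa [e] using k3
  -- The inverse of the bundle trivialization is inverse to the chart derivative, so in coordinates
  -- the form is A composed with the derivative of g.
  have k5 : ∀ w : F, mdir F φ q (e.symmL ℝ q w) = w := fun w => by
    have a1 := TangentBundle.continuousLinearMapAt_trivializationAt (I := 𝓘(ℝ, F)) (x₀ := p) k3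
    exact (DFunLike.congr_fun a1 _).symm.trans (e.continuousLinearMapAt_symmL k4 w)
  refine ContinuousLinearMap.ext fun w => ?_
  have k6 : (η q : F →L[ℝ] ℂ) (e.symmL ℝ q w) = A q (fderiv ℝ (g ∘ φ.symm) (φ q) w) := by
    refine (k2 _).trans ?_
    rw [mdir_eq_fderiv_written k3 (k1.mdifferentiableAt (by simp))]
    exact congrArg (fun w => A q (fderiv ℝ (g ∘ φ.symm) (φ q) w)) (k5 w)
  refine Eq.trans ?_ k6
  have k7 := Bundle.Trivial.continuousLinearMapAt_trivialization ℝ M ℂ q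
  exact DFunLike.congr_fun k7 _

end InducedForms

/-! ### From plurisubharmonic powers to nonnegativity on the null space. -/

section FromDomain

open Filter Topology Complex ComplexConjugate

/-- The pointwise expression of the D'Angelo form, for a real linear map `A` into the ambient
space. -/
def dAngeloForm {E : Type*} [NormedAddCommGroup E] [NormedSpace ℂ E]
    {F : Type*} [NormedAddCommGroup F] [NormedSpace ℝ F] [FiniteDimensional ℝ F]
    (D : E →L[ℝ] E →L[ℝ] ℝ) (l : E →L[ℝ] ℝ) (A : F →L[ℝ] E) (m : E) : F →L[ℝ] ℂ :=
  LinearMap.toContinuousLinearMap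
    -- The subtracted term makes the complex extension vanish on T, whose image is m with ∂r(m) = 1,
    -- and it is zero on complex tangential vectors. A (1,0)-vector has image 2u, so the factor 1/4
    -- gives H(u, m)/2.
    { toFun := fun v => 1 / 4 * (hermPart D (A v) m - hermPart D m m * delPart l (A v))
      map_add' := fun v w => by
        rw [map_add, hermPart_add_left, delPart_add]; ring
      map_smul' := fun c v => by
        have h : A (c • v) = (c : ℂ) • A v := map_smul A c v
        rw [h, hermPart_smul_left, delPart_smul, RingHom.id_apply, Complex.real_smul]; ring }

variable {F : Type*} [NormedAddCommGroup F] [NormedSpace ℝ F]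
  {M : Type*} [TopologicalSpace M] [ChartedSpace F M]
  {E : Type*} [NormedAddCommGroup E] [NormedSpace ℂ E]
  {X : Type*} [TopologicalSpace X] [ChartedSpace E X]
  {Ω U : Set X} {ρ : X → ℝ} {ι : M → X} {p : M}

lemma dAngeloForm_apply [FiniteDimensional ℝ F] (D : E →L[ℝ] E →L[ℝ] ℝ) (l : E →L[ℝ] ℝ)
    (A : F →L[ℝ] E) (m : E) (v : F) : dAngeloForm D l A m v =
      1 / 4 * (hermPart D (A v) m - hermPart D m m * delPart l (A v)) := rfl

/-- The purely imaginary contact form `v ↦ -(i/2) dρ(J dι v)` on `M`. -/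
def contactForm (E : Type*) [NormedAddCommGroup E] [NormedSpace ℂ E]
    (F : Type*) [NormedAddCommGroup F] [NormedSpace ℝ F]
    {X : Type*} [TopologicalSpace X] [ChartedSpace E X]
    {M : Type*} [TopologicalSpace M] [ChartedSpace F M] (ρ : X → ℝ) (ι : M → X) (q : M) :
    F →L[ℝ] ℂ :=
  (ContinuousLinearMap.toSpanSingleton ℝ (-I / 2 : ℂ)).comp (ambientContact E F ρ ι q)

lemma contactForm_apply (q : M) (v : F) :
    contactForm E F ρ ι q v = (-I / 2) * ambientContact E F ρ ι q v := by
  simp [contactForm, mul_comm]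

lemma isTransversal_contactForm [IsManifold 𝓘(ℝ, F) ∞ M]
    {τ : (q : M) → TangentSpace 𝓘(ℝ, F) q} (hτs : ∀ q, SmoothFieldAt τ q)
    (hτ : ∀ q, ambientContact E F ρ ι q (τ q) = 2) :
    IsTransversal (contactForm E F ρ ι) (fun q => ((0 : F), τ q)) := by
  refine ⟨⟨fun q => smoothFieldAt_zero, hτs⟩, fun _ => rfl, fun p => ?_⟩
  have h1 := contactForm_apply (F := F) (E := E) (ρ := ρ) (ι := ι) p (τ p)
  have h0 : contactForm E F ρ ι p 0 = 0 := map_zero _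
  refine (congrArg₂ (fun x y => x + I * y) h0 h1).trans ?_
  rw [hτ]
  push_cast
  linear_combination -I_mul_I

variable [IsManifold 𝓘(ℂ, E) ω X]

lemma isContactAt_contactForm (hι : ContMDiff 𝓘(ℝ, F) 𝓘(ℝ, E) ∞ ι)
    (hρ : IsDefiningFunctionOn E Ω univ ρ) (p : M) :
    IsContactAt (contactForm E F ρ ι) (chartMap E ι p) (chartFun E ρ (ι p)) 1 p := by
  filter_upwards [eventually_mem_chart_source (E := E) (hι p).continuousAt] with q hq v
  rw [contact_eq_ambientContact ((hι q).mdifferentiableAt (by simp)) hq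
    ((hρ.contMDiffAt (mem_univ _)).mdifferentiableAt (by simp))]
  refine (contactForm_apply q v).trans ?_
  push_cast
  ring

variable [IsManifold 𝓘(ℝ, F) ∞ M] [FiniteDimensional ℝ F] [FiniteDimensional ℂ E]

lemma isTrivialization_contactForm
    (hF : Module.finrank ℝ F + 1 = Module.finrank ℝ E) (hΩ : IsOpen Ω)
    (hι : IsSmoothEmbedding 𝓘(ℝ, F) 𝓘(ℝ, E) ∞ ι) (hιΩ : range ι = frontier Ω)
    (hρ : IsDefiningFunctionOn E Ω univ ρ)
    {τ : (q : M) → TangentSpace 𝓘(ℝ, F) q} (hτ : ∀ q, ambientContact E F ρ ι q (τ q) = 2) :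
    IsTrivialization (inducedCR E ι) (contactForm E F ρ ι) := by
  have hcr := fun p => localCR_of_isDefiningFunctionOn hF hΩ hι hιΩ hρ (mem_univ (ι p))
  have hct := isContactAt_contactForm hι.contMDiff hρ
  refine ⟨smoothForm_of_local (V := E) fun p => ?_, fun p v => ?_, fun p h0 => ?_,
    fun p z hz => ?_, fun p z hz => ?_⟩
  · have h := hcr p
    refine ⟨chartMap E ι p, fun q => (ContinuousLinearMap.toSpanSingleton ℝ (-I / 2 : ℂ)).comp
      ((fderiv ℝ (chartFun E ρ (ι p)) (chartMap E ι p q)).comp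
        ((I • ContinuousLinearMap.id ℂ E).restrictScalars ℝ)), h.smooth_g, ?_, ?_⟩
    · have h1 : ContDiffAt ℝ ∞ (fderiv ℝ (chartFun E ρ (ι p))) (chartMap E ι p p) :=
        h.smooth_r.self_of_nhds.fderiv_right (by simp)
      have h2 : ContMDiffAt 𝓘(ℝ, F) 𝓘(ℝ, E →L[ℝ] ℝ) ∞
          (fun q => fderiv ℝ (chartFun E ρ (ι p)) (chartMap E ι p q)) p :=
        ContDiffAt.comp_contMDiffAt (g := fderiv ℝ (chartFun E ρ (ι p))) h1
          h.smooth_g.self_of_nhds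
      exact contMDiffAt_const.clm_comp (h2.clm_comp contMDiffAt_const)
    · filter_upwards [hct p] with q hq v
      refine (hq v).trans ?_
      simp [contact, mul_comm]
  · refine (congrArg Complex.re (contactForm_apply (F := F) p v)).trans ?_
    simp
  · have h1 := (contactForm_apply (F := F) (E := E) (ρ := ρ) (ι := ι) p (τ p)).symm.trans
      (DFunLike.congr_fun h0 (τ p))
    rw [hτ] at h1
    simp at h1
  · refine (cext_contact (hct p).self_of_nhds z).trans ?_
    rw [(hcr p).contact_fst hz, (hcr p).contact_snd hz]
    simp
  · refine (cext_contact (hct p).self_of_nhds (cconj z)).trans ?_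
    have h2 : contact F (chartFun E ρ (ι p)) (chartMap E ι p) p (cconj z).2 = 0 :=
      (contact_neg (F := F) p z.2).trans (by rw [(hcr p).contact_snd hz, neg_zero])
    have h0 := (hcr p).contact_fst hz
    have h1 : contact F (chartFun E ρ (ι p)) (chartMap E ι p) p (cconj z).1 = 0 := h0
    rw [h1, h2]
    simp

/-- If a power of a defining function is plurisubharmonic on one side of the boundary, the index
form is nonnegative on the Levi null space. -/
theorem nonnegOnNull_of_psh [T2Space M] [SigmaCompactSpace M]
    (hF : Module.finrank ℝ F + 1 = Module.finrank ℝ E) (hΩ : IsOpen Ω)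
    (hι : IsSmoothEmbedding 𝓘(ℝ, F) 𝓘(ℝ, E) ∞ ι) (hιΩ : range ι = frontier Ω)
    (hΩs : HasSmoothBoundary E Ω) (hpsc : HasPseudoconvexBoundary E Ω)
    (hρ : IsDefiningFunctionOn E Ω univ ρ) {s κ γ c : ℝ} (hs : s ^ 2 = 1) (hκ : 0 < κ)
    (hγ : γ = 1 - s * κ) (hγ0 : 0 < γ) (hc : c = 1 / κ - s) {S : Set X}
    (hS : PshOn (E := E) (fun y => -s * (-(s * ρ y)) ^ γ) S)
    (hside : ∀ x ∈ frontier Ω, ∀ᶠ y in 𝓝 x, s * ρ y < 0 → y ∈ S) :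
    NonnegOnNull (inducedCR E (F := F) ι) s c := by
  have hfr : ∀ q, ι q ∈ frontier Ω := fun q => hιΩ ▸ mem_range_self q
  have hcr := fun p => localCR_of_isDefiningFunctionOn hF hΩ hι hιΩ hρ (mem_univ (ι p))
  have hct := isContactAt_contactForm hι.contMDiff hρ
  have hsec := exists_isSection hF hΩ hι hιΩ hΩs
  obtain ⟨τ, hτs, hτ⟩ := exists_ambientContact_eq hF hΩ hι hιΩ hρ
  set T : (q : M) → CTangent F q := fun q => ((0 : F), τ q) with hTdef
  have hT := isTransversal_contactForm hτs hτ
  set σ : (q : M) → TangentSpace 𝓘(ℝ, F) q →L[ℝ] ℂ := fun q =>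
    dAngeloForm (F := F) (fderiv ℝ (fderiv ℝ (chartFun E ρ (ι q))) (chartMap E ι q q))
      (fderiv ℝ (chartFun E ρ (ι q)) (chartMap E ι q q)) (mdir F (chartMap E ι q) q)
      (transv F (chartMap E ι q) 1 T q) with hσdef
  have hone : (1 : ℝ) ^ 2 = 1 := one_pow 2
  have hσ : IsDAngeloForm (inducedCR E ι) (contactForm E F ρ ι) T σ := by
    -- Both ingredients are complex linear in the argument, so extending to a + ib amounts to
    -- inserting g_*a + i g_*b: this is m for T, 0 for (0,1)-vectors and 2u for (1,0)-vectors.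
    have hcext : ∀ (q : M) (z : CTangent F q), cext (σ q) z =
        1 / 4 * (hermPart (fderiv ℝ (fderiv ℝ (chartFun E ρ (ι q))) (chartMap E ι q q))
          (mdir F (chartMap E ι q) q z.1 + I • mdir F (chartMap E ι q) q z.2)
          (transv F (chartMap E ι q) 1 T q)
        - hermPart (fderiv ℝ (fderiv ℝ (chartFun E ρ (ι q))) (chartMap E ι q q))
          (transv F (chartMap E ι q) 1 T q) (transv F (chartMap E ι q) 1 T q) *
          delPart (fderiv ℝ (chartFun E ρ (ι q)) (chartMap E ι q q))
          (mdir F (chartMap E ι q) q z.1 + I • mdir F (chartMap E ι q) q z.2)) := by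
      intro q z
      rw [hermPart_add_left, hermPart_smul_left, delPart_add, delPart_smul]
      have hval : ∀ v : F, (σ q : F →L[ℝ] ℂ) v =
          1 / 4 * (hermPart (fderiv ℝ (fderiv ℝ (chartFun E ρ (ι q))) (chartMap E ι q q))
            (mdir F (chartMap E ι q) q v) (transv F (chartMap E ι q) 1 T q)
          - hermPart (fderiv ℝ (fderiv ℝ (chartFun E ρ (ι q))) (chartMap E ι q q))
            (transv F (chartMap E ι q) 1 T q) (transv F (chartMap E ι q) 1 T q) *
            delPart (fderiv ℝ (chartFun E ρ (ι q)) (chartMap E ι q q))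
            (mdir F (chartMap E ι q) q v)) := fun v => dAngeloForm_apply _ _ _ _ v
      refine (congrArg₂ (fun x y : ℂ => x + I * y) (hval z.1) (hval z.2)).trans ?_
      ring
    refine ⟨fun q => ?_, fun q z hz => ?_, fun L hL q => ?_⟩
    · obtain ⟨h1, h2⟩ := (hcr q).fderiv_transv (hct q) hone hT
      have h3 := delPart_of_normalized h1 h2
      have h4 : mdir F (chartMap E ι q) q (T q).1 + I • mdir F (chartMap E ι q) q (T q).2
          = transv F (chartMap E ι q) 1 T q := by
        have e : mdir F (chartMap E ι q) q (0 : F) = 0 := map_zero _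
        have e' : mdir F (chartMap E ι q) q (T q).1 = 0 := e
        rw [e', zero_add, transv, ofReal_one, one_smul]
      rw [hcext, h4, h3]
      ring
    · have h1 := (hcr q).mdir_snd hz
      have h2 : mdir F (chartMap E ι q) q (cconj z).2 = I • mdir F (chartMap E ι q) q z.1 :=
        (map_neg (mdir F (chartMap E ι q) q) z.2).trans ((congrArg Neg.neg h1).trans (neg_neg _))
      have h3 : mdir F (chartMap E ι q) q (cconj z).1 + I • mdir F (chartMap E ι q) q (cconj z).2
          = (0 : ℂ) • mdir F (chartMap E ι q) q z.1 := by
        rw [h2, I_smul_I_smul, zero_smul]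
        exact add_neg_cancel _
      rw [hcext, h3, hermPart_smul_left, delPart_smul]
      ring
    · rw [(hcr q).dAngelo_eq (hct q) hone hT hL, hcext]
      have h1 := (hcr q).mdir_snd (hL.2 q)
      have h4 := (hcr q).contact_fst (hL.2 q)
      have h5 := (hcr q).fderiv_mdir (L q).1
      have h3 : mdir F (chartMap E ι q) q (L q).1 + I • mdir F (chartMap E ι q) q (L q).2
          = (2 : ℂ) • mdir F (chartMap E ι q) q (L q).1 := by
        rw [h1, smul_neg, I_smul_I_smul, neg_neg, two_smul]
      rw [h3, hermPart_smul_left, delPart_smul, (delPart_eq_zero_iff _ _).2 ⟨h5, h4⟩]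
      ring
  refine ⟨contactForm E F ρ ι, T, σ,
    ⟨isTrivialization_contactForm hF hΩ hι hιΩ hρ hτ, fun L hL q => ?_⟩, hT, hσ,
    fun L hL q hnull => ?_⟩
  · rw [(hcr q).leviForm_eq (hct q) hL hL, ofReal_one, one_mul]
    exact hermPart_nonneg_of_pseudoconvex hpsc hρ (mem_chart_source E (ι q)) (hfr q) (mem_univ _)
      ((delPart_eq_zero_iff _ _).2 ⟨(hcr q).fderiv_mdir (L q).1, (hcr q).contact_fst (hL.2 q)⟩)
  · rw [(hcr q).indexForm_eq (hct q) hone hT hσ (hsec q) hL hnull hc]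
    obtain ⟨h1, h2⟩ := (hcr q).fderiv_transv (hct q) hone hT
    have h3 := (hcr q).contact_fst (hL.2 q)
    have h4 := (hcr q).fderiv_mdir (L q).1
    have h5 := ((hcr q).leviNull_iff (hct q) hone (hsec q) (hL.2 q)).1 hnull _ h4 h3
    have hr4 : ContDiffAt ℝ 4 (chartFun E ρ (ι q)) (chartMap E ι q q) :=
      (hcr q).smooth_r.self_of_nhds.of_le (by
        have : ((4 : ℕ∞) : WithTop ℕ∞) ≤ ((⊤ : ℕ∞) : WithTop ℕ∞) := WithTop.coe_le_coe.2 le_top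
        exact this)
    refine leviIndex_nonneg hr4 ?_ h1 h2 hs hκ h4 h3 (by rw [h5]; rfl) ?_
    · rw [chartFun_chartMap ρ (mem_chart_source E (ι q)), hρ.eq_zero hΩ (hfr q) (mem_univ _)]
    -- The chart image of the neighborhood filter turns the local condition in E into one on X,
    -- where the positive factor γ t^(γ-1)/4 is divided out.
    · rw [chartMap, ← map_extChartAt_nhds_of_boundaryless (I := 𝓘(ℝ, E)) (ι q), eventually_map]
      filter_upwards [hside (ι q) (hfr q),
        (chartAt E (ι q)).open_source.mem_nhds (mem_chart_source E (ι q))] with x hx1 hx2 hx3 v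
      have hrx : chartFun E ρ (ι q) (extChartAt 𝓘(ℝ, E) (ι q) x) = ρ x := by
        simp only [chartFun, Function.comp]
        rw [(extChartAt 𝓘(ℝ, E) (ι q)).left_inv (by simpa using hx2)]
      rw [hrx] at hx3
      obtain ⟨w, rfl⟩ := (chartDeriv_bijective hx2).2 v
      have h6 := hS.2 x (hx1 hx3) w
      rw [complexHessian_rpow hx2 hs hγ (hρ.contMDiffAt (mem_univ _)) hx3] at h6
      have h7 : 0 < γ * (-(s * ρ x)) ^ (γ - 1) :=
        mul_pos hγ0 (Real.rpow_pos_of_pos (by linarith) _)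
      refine (mul_nonneg_iff_of_pos_left h7).1 ?_
      linarith

end FromDomain

/-! ### Normalizing and gluing defining functions. -/

section Gluing

open Filter Topology Complex

section

variable {F : Type*} [NormedAddCommGroup F] [NormedSpace ℝ F]
  {M : Type*} [TopologicalSpace M] [ChartedSpace F M]

/-- Where g vanishes, only its own differential survives in the product rule. Rescaling or averaging
defining functions therefore acts pointwise on their boundary differentials. -/
lemma mdir_mul_of_eq_zero {f g : M → ℝ} {p : M} (hf : MDifferentiableAt 𝓘(ℝ, F) 𝓘(ℝ, ℝ) f p)
    (hg : MDifferentiableAt 𝓘(ℝ, F) 𝓘(ℝ, ℝ) g p) (h0 : g p = 0) (v : F) :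
    mdir F (fun q => f q * g q) p v = f p * mdir F g p v := by
  have h := (hasFDerivAt_written_self hf).mul (hasFDerivAt_written_self hg)
  have e : mdir F (fun q => f q * g q) p = _ := mdir_eq_of_hasFDerivAt (hf.mul hg) h
  rw [e]
  simp [h0]

lemma mdir_finsetSum {α : Type*} (t : Finset α) {f : α → M → ℝ} {p : M}
    (hf : ∀ i ∈ t, MDifferentiableAt 𝓘(ℝ, F) 𝓘(ℝ, ℝ) (f i) p) (v : F) :
    mdir F (fun q => ∑ i ∈ t, f i q) p v = ∑ i ∈ t, mdir F (f i) p v := by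
  have h := HasFDerivAt.fun_sum fun i hi => hasFDerivAt_written_self (hf i hi)
  have h1 : MDifferentiableAt 𝓘(ℝ, F) 𝓘(ℝ, ℝ) (fun q => ∑ i ∈ t, f i q) p := by
    clear h
    classical
    induction t using Finset.induction_on with
    | empty => simpa using mdifferentiableAt_const
    | insert i t hi ih =>
      simp only [Finset.sum_insert hi]
      exact (hf i (by simp)).add (ih fun j hj => hf j (by simp [hj]))
  rw [mdir_eq_of_hasFDerivAt h1 h]
  simp

end

variable {E : Type*} [NormedAddCommGroup E] [NormedSpace ℂ E]
  {X : Type*} [TopologicalSpace X] [ChartedSpace E X]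
  {Ω U V : Set X} {ρ ρ' μ : X → ℝ} {x : X}

lemma IsDefiningFunctionOn.mdir_ne_zero (h : IsDefiningFunctionOn E Ω U ρ) (hx : x ∈ frontier Ω)
    (hxU : x ∈ U) : mdir E ρ x ≠ 0 := h.mfderiv_ne_zero x ⟨hx, hxU⟩

lemma IsDefiningFunctionOn.mono (h : IsDefiningFunctionOn E Ω U ρ) (hV : IsOpen V) (hVU : V ⊆ U) :
    IsDefiningFunctionOn E Ω V ρ :=
  ⟨hV, h.smooth.mono hVU, fun x hx => h.mem_iff x (hVU hx),
    fun x hx => h.mfderiv_ne_zero x ⟨hx.1, hVU hx.2⟩⟩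

lemma IsDefiningFunctionOn.pos_mul (h : IsDefiningFunctionOn E Ω U ρ) (hΩ : IsOpen Ω)
    (hμ : ContMDiffOn 𝓘(ℝ, E) 𝓘(ℝ, ℝ) ∞ μ U) (hpos : ∀ x ∈ U, 0 < μ x) :
    IsDefiningFunctionOn E Ω U (fun x => μ x * ρ x) := by
  refine ⟨h.isOpen, hμ.mul h.smooth, fun x hx => ?_, fun x hx h0 => ?_⟩
  · rw [h.mem_iff x hx]
    constructor
    · intro h1; exact mul_neg_of_pos_of_neg (hpos x hx) h1
    · intro h1; exact neg_of_mul_neg_right h1 (hpos x hx).le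
  · refine h.mdir_ne_zero hx.1 hx.2 (ContinuousLinearMap.ext fun v => ?_)
    have h1 := mdir_mul_of_eq_zero ((hμ.contMDiffAt (h.isOpen.mem_nhds hx.2)).mdifferentiableAt
      (by simp)) ((h.contMDiffAt hx.2).mdifferentiableAt (by simp)) (h.eq_zero hΩ hx.1 hx.2) v
    have h2 := h1.symm.trans (DFunLike.congr_fun h0 v)
    exact (mul_eq_zero.1 h2).resolve_left (hpos x hx.2).ne'

variable [IsManifold 𝓘(ℂ, E) ω X]

omit [IsManifold 𝓘(ℂ, E) ω X] in
/-- Differentials of two defining functions at a boundary point have the same sign. -/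
lemma IsDefiningFunctionOn.mdir_nonneg_of_pos (h : IsDefiningFunctionOn E Ω U ρ)
    (h' : IsDefiningFunctionOn E Ω V ρ') (hΩ : IsOpen Ω) (hx : x ∈ frontier Ω) (hxU : x ∈ U)
    (hxV : x ∈ V) {w : E} (hw : 0 < mdir E ρ x w) : 0 ≤ mdir E ρ' x w := by
  have hm := (h.contMDiffAt hxU).mdifferentiableAt (by simp : (∞ : WithTop ℕ∞) ≠ 0)
  have hm' := (h'.contMDiffAt hxV).mdifferentiableAt (by simp : (∞ : WithTop ℕ∞) ≠ 0)
  have key : ∀ {r : X → ℝ}, MDifferentiableAt 𝓘(ℝ, E) 𝓘(ℝ, ℝ) r x → r x = 0 →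
      HasDerivAt (fun t : ℝ => chartFun E r x (extChartAt 𝓘(ℝ, E) x x + t • w)) (mdir E r x w) 0 := by
    intro r hr _
    have h1 := hasFDerivAt_written_self hr
    have h2 : HasDerivAt (fun t : ℝ => extChartAt 𝓘(ℝ, E) x x + t • w) w 0 := by
      simpa using ((hasDerivAt_id (0 : ℝ)).smul_const w).const_add (extChartAt 𝓘(ℝ, E) x x)
    exact HasFDerivAt.comp_hasDerivAt_of_eq (0 : ℝ) h1 h2 (by simp)
  have h0 := h.eq_zero hΩ hx hxU
  have h0' := h'.eq_zero hΩ hx hxV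
  have k := key hm h0
  have k' := key hm' h0'
  have e0 : ∀ r : X → ℝ, chartFun E r x (extChartAt 𝓘(ℝ, E) x x + (0 : ℝ) • w) = r x := by
    intro r
    simp [chartFun]
  have hc : ContinuousAt (fun t : ℝ => (extChartAt 𝓘(ℝ, E) x).symm
      (extChartAt 𝓘(ℝ, E) x x + t • w)) 0 := by
    refine ContinuousAt.comp_of_eq (continuousAt_extChartAt_symm (I := 𝓘(ℝ, E)) x) (by fun_prop)
      (by simp)
  have hUV : ∀ᶠ t in 𝓝 (0 : ℝ), (extChartAt 𝓘(ℝ, E) x).symm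
      (extChartAt 𝓘(ℝ, E) x x + t • w) ∈ U ∩ V := by
    refine hc.eventually ((h.isOpen.inter h'.isOpen).mem_nhds ?_)
    simpa using ⟨hxU, hxV⟩
  by_contra! hneg
  have s1 := (hasDerivAt_iff_tendsto_slope.1 k).eventually (lt_mem_nhds hw)
  have s2 := (hasDerivAt_iff_tendsto_slope.1 k').eventually (gt_mem_nhds hneg)
  -- If the signs differed, at small negative times along w the first function would be negative and
  -- the second positive, and the point would be both in Ω and outside it.
  have hle : 𝓝[<] (0 : ℝ) ≤ 𝓝[≠] 0 := nhdsWithin_mono _ fun y (hy : y < 0) => hy.ne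
  have hneg' : ∀ᶠ t in 𝓝[<] (0 : ℝ), t < 0 := self_mem_nhdsWithin
  have hall := ((s1.filter_mono hle).and (s2.filter_mono hle)).and
    ((hUV.filter_mono nhdsWithin_le_nhds).and hneg')
  obtain ⟨t, ⟨t1, t2⟩, t3, t4⟩ := hall.exists
  simp only [slope_def_field, e0, h0, h0', sub_zero] at t1 t2
  have a1 : chartFun E ρ x (extChartAt 𝓘(ℝ, E) x x + t • w) < 0 := by
    rcases div_pos_iff.1 t1 with k | k
    · linarith [k.2]
    · exact k.1
  have a2 : 0 < chartFun E ρ' x (extChartAt 𝓘(ℝ, E) x x + t • w) := by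
    rcases div_neg_iff.1 t2 with k | k
    · exact k.1
    · linarith [k.2]
  exact a2.not_gt ((h'.mem_iff _ t3.2).1 ((h.mem_iff _ t3.1).2 a1))

variable {F : Type*} [NormedAddCommGroup F] [NormedSpace ℝ F] [FiniteDimensional ℝ F]
  [FiniteDimensional ℂ E] {M : Type*} [TopologicalSpace M] [ChartedSpace F M]
  [IsManifold 𝓘(ℝ, F) ∞ M] {ι : M → X} {τ : (q : M) → TangentSpace 𝓘(ℝ, F) q}

lemma contMDiffAt_ambientContact (hF : Module.finrank ℝ F + 1 = Module.finrank ℝ E)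
    (hΩ : IsOpen Ω) (hι : IsSmoothEmbedding 𝓘(ℝ, F) 𝓘(ℝ, E) ∞ ι) (hιΩ : range ι = frontier Ω)
    (hτ : ∀ q, SmoothFieldAt τ q) (hρ : IsDefiningFunctionOn E Ω U ρ) {q : M} (hq : ι q ∈ U) :
    ContMDiffAt 𝓘(ℝ, F) 𝓘(ℝ, ℝ) ∞ (fun q => ambientContact E F ρ ι q (τ q)) q := by
  have h := localCR_of_isDefiningFunctionOn hF hΩ hι hιΩ hρ hq
  have h1 : ContDiffAt ℝ ∞ (fderiv ℝ (chartFun E ρ (ι q))) (chartMap E ι q q) :=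
    h.smooth_r.self_of_nhds.fderiv_right (by simp)
  have h2 : ContMDiffAt 𝓘(ℝ, F) 𝓘(ℝ, E →L[ℝ] ℝ) ∞
      (fun q' => fderiv ℝ (chartFun E ρ (ι q)) (chartMap E ι q q')) q :=
    ContDiffAt.comp_contMDiffAt (g := fderiv ℝ (chartFun E ρ (ι q))) h1 h.smooth_g.self_of_nhds
  have h3 := (hτ q).contMDiffAt_mdir h.smooth_g.self_of_nhds
  have h4 : ContMDiffAt 𝓘(ℝ, F) 𝓘(ℝ, E) ∞ (fun q' => I • mdir F (chartMap E ι q) q' (τ q')) q :=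
    ContDiffAt.comp_contMDiffAt (g := fun a : E => I • a)
      ((I • ContinuousLinearMap.id ℂ E).restrictScalars ℝ).contDiff.contDiffAt h3
  have hιs := hι.contMDiff
  refine (h2.clm_apply h4).congr_of_eventuallyEq ?_
  filter_upwards [eventually_mem_chart_source (E := E) (hιs q).continuousAt,
    (hιs q).continuousAt.eventually (hρ.isOpen.mem_nhds hq)] with q' k1 k2
  exact (contact_eq_ambientContact ((hιs q').mdifferentiableAt (by simp)) k1
    ((hρ.contMDiffAt k2).mdifferentiableAt (by simp)) (τ q')).symm

/-- The factor 2/|h ∘ π|, with h the contact value on τ and π a local retraction onto M, rescales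
the boundary differential to absolute value 2. The absolute value keeps the factor positive whatever
the sign of h. -/
lemma exists_normalized_local (hF : Module.finrank ℝ F + 1 = Module.finrank ℝ E)
    (hΩ : IsOpen Ω) (hι : IsSmoothEmbedding 𝓘(ℝ, F) 𝓘(ℝ, E) ∞ ι) (hιΩ : range ι = frontier Ω)
    (hΩs : HasSmoothBoundary E Ω) (hτ : ∀ q, SmoothFieldAt τ q)
    (hne : ∀ U ρ, IsDefiningFunctionOn E Ω U ρ → ∀ q, ι q ∈ U →
      ambientContact E F ρ ι q (τ q) ≠ 0) (p : M) :
    ∃ U ρ, ι p ∈ U ∧ IsDefiningFunctionOn E Ω U ρ ∧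
      ∀ q, ι q ∈ U → |ambientContact E F ρ ι q (τ q)| = 2 := by
  have hfr : ∀ q, ι q ∈ frontier Ω := fun q => hιΩ ▸ mem_range_self q
  have hιs := hι.contMDiff
  obtain ⟨U, ρ, hpU, hρ⟩ := hΩs (ι p) (hfr p)
  obtain ⟨π, hπ, hπι⟩ := exists_retraction hι p
  set h : M → ℝ := fun q => ambientContact E F ρ ι q (τ q) with hh
  have hπp : π (ι p) = p := hπι.self_of_nhds
  have hπU : ∀ᶠ x in 𝓝 (ι p), ι (π x) ∈ U := by
    have c : ContinuousAt (fun x => ι (π x)) (ι p) :=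
      ContinuousAt.comp (by rw [hπp]; exact (hιs p).continuousAt) hπ.self_of_nhds.continuousAt
    exact c.eventually (hρ.isOpen.mem_nhds (by simpa only [hπp] using hpU))
  have hπι' : ∀ᶠ x in 𝓝 (ι p), ∀ q, ι q = x → π (ι q) = q := by
    rw [hι.isEmbedding.isInducing.nhds_eq_comap, eventually_comap] at hπι
    exact hπι
  obtain ⟨V, hV, hVo, hpV⟩ := eventually_nhds_iff.1
    ((hπ.and hπU).and (hπι'.and (hρ.isOpen.mem_nhds hpU)))
  have hVU : V ⊆ U := fun x hx => (hV x hx).2.2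
  have hμ : ContMDiffOn 𝓘(ℝ, E) 𝓘(ℝ, ℝ) ∞ (fun x => 2 * |h (π x)|⁻¹) V := by
    intro x hx
    have h0 : h (π x) ≠ 0 := hne U ρ hρ _ (hV x hx).1.2
    have h1 : ContMDiffAt 𝓘(ℝ, E) 𝓘(ℝ, ℝ) ∞ (h ∘ π) x :=
      ContMDiffAt.comp (I' := 𝓘(ℝ, F)) x
        (contMDiffAt_ambientContact hF hΩ hι hιΩ hτ hρ (hV x hx).1.2) (hV x hx).1.1
    have h2 : ContDiffAt ℝ ∞ (fun y : ℝ => 2 * |y|⁻¹) (h (π x)) :=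
      contDiffAt_const.mul ((contDiffAt_abs h0).inv (abs_ne_zero.2 h0))
    exact (ContDiffAt.comp_contMDiffAt (g := fun y : ℝ => 2 * |y|⁻¹) (f := h ∘ π) h2
      h1).contMDiffWithinAt
  have hpos : ∀ x ∈ V, 0 < 2 * |h (π x)|⁻¹ := fun x hx => by
    have : 0 < |h (π x)| := abs_pos.2 (hne U ρ hρ _ (hV x hx).1.2)
    positivity
  have hρV := hρ.mono hVo hVU
  refine ⟨V, _, hpV, hρV.pos_mul hΩ hμ hpos, fun q hq => ?_⟩
  have e1 : ambientContact E F (fun x => 2 * |h (π x)|⁻¹ * ρ x) ι q (τ q) =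
      2 * |h (π (ι q))|⁻¹ * h q :=
    mdir_mul_of_eq_zero ((hμ.contMDiffAt (hVo.mem_nhds hq)).mdifferentiableAt (by simp))
      ((hρ.contMDiffAt (hVU hq)).mdifferentiableAt (by simp)) (hρ.eq_zero hΩ (hfr q) (hVU hq)) _
  have h0 : |h q| ≠ 0 := abs_ne_zero.2 (hne U ρ hρ _ (hVU hq))
  rw [e1, (hV _ hq).2.1 q rfl, abs_mul, abs_mul, abs_inv, abs_abs, abs_two, mul_assoc,
    inv_mul_cancel₀ h0, mul_one]


/-- The family of defining functions whose differential is normalized on a transversal field is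
closed under gluing. -/
lemma exists_normalized_global [T2Space X] [SigmaCompactSpace X]
    (hF : Module.finrank ℝ F + 1 = Module.finrank ℝ E)
    (hΩ : IsOpen Ω) (hι : IsSmoothEmbedding 𝓘(ℝ, F) 𝓘(ℝ, E) ∞ ι) (hιΩ : range ι = frontier Ω)
    (hΩs : HasSmoothBoundary E Ω) (hτ : ∀ q, SmoothFieldAt τ q)
    (hne : ∀ U ρ, IsDefiningFunctionOn E Ω U ρ → ∀ q, ι q ∈ U →
      ambientContact E F ρ ι q (τ q) ≠ 0) :
    ∃ ρ, IsDefiningFunctionOn E Ω univ ρ ∧ ∀ q, |ambientContact E F ρ ι q (τ q)| = 2 := by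
  have : IsManifold 𝓘(ℝ, E) ∞ X := IsManifold.real_of_complex
  have : FiniteDimensional ℝ E := FiniteDimensional.complexToReal E
  have hfr : ∀ q, ι q ∈ frontier Ω := fun q => hιΩ ▸ mem_range_self q
  have hdisj : Disjoint Ω (frontier Ω) := disjoint_frontier_iff_isOpen.2 hΩ |>.symm
  -- Away from the boundary the constants -1 and 1 are local defining functions, and the
  -- normalization is vacuous.
  have hloc : ∀ x : X, ∃ U ρ, x ∈ U ∧ IsDefiningFunctionOn E Ω U ρ ∧
      ∀ q, ι q ∈ U → |ambientContact E F ρ ι q (τ q)| = 2 := by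
    intro x
    by_cases hx : x ∈ frontier Ω
    · obtain ⟨p, rfl⟩ := hιΩ.symm ▸ hx
      exact exists_normalized_local hF hΩ hι hιΩ hΩs hτ hne p
    by_cases hxΩ : x ∈ Ω
    · refine ⟨Ω, fun _ => -1, hxΩ, ⟨hΩ, contMDiffOn_const, fun y hy => by simp [hy],
        fun y hy => (hdisj.le_bot ⟨hy.2, hy.1⟩).elim⟩,
        fun q hq => (hdisj.le_bot ⟨hq, hfr q⟩).elim⟩
    · have hxc : x ∈ (closure Ω)ᶜ := fun h => hx ⟨h, by rwa [hΩ.interior_eq]⟩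
      refine ⟨(closure Ω)ᶜ, fun _ => 1, hxc, ⟨isClosed_closure.isOpen_compl, contMDiffOn_const,
        fun y hy => ⟨fun h => (hy (subset_closure h)).elim, fun h => by linarith⟩,
        fun y hy => (hy.2 hy.1.1).elim⟩, fun q hq => (hq (hfr q).1).elim⟩
  choose U r hxU hr hrτ using hloc
  obtain ⟨f, hf⟩ := SmoothPartitionOfUnity.exists_isSubordinate 𝓘(ℝ, E) isClosed_univ U
    (fun x => (hr x).isOpen) fun x _ => mem_iUnion.2 ⟨x, hxU x⟩
  set ρ : X → ℝ := fun x => ∑ᶠ i, f i x • r i x with hρdef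
  have hρs : ContMDiff 𝓘(ℝ, E) 𝓘(ℝ, ℝ) ∞ ρ :=
    hf.contMDiff_finsum_smul (fun i => (hr i).isOpen) fun i => (hr i).smooth
  have hsupp : ∀ {i x}, x ∈ tsupport (f i) → x ∈ U i := fun {i x} h => hf i h
  have hmem : ∀ {i x}, f i x ≠ 0 → x ∈ U i := fun h => hsupp (subset_tsupport _ h)
  have hdef : ∀ x, x ∈ Ω ↔ ρ x < 0 := by
    intro x
    have hfin : (Function.support fun i => f i x • r i x).Finite :=
      (f.locallyFinite.point_finite x).subset fun i hi h0 => hi (by simp [h0])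
    constructor
    · intro hx
      obtain ⟨i, hi⟩ := f.exists_pos_of_mem (mem_univ x)
      have h1 : ∑ᶠ i, -(f i x • r i x) > 0 := by
        refine finsum_pos (fun j => ?_) ⟨i, ?_⟩ (hfin.subset fun j hj h0 => hj (neg_eq_zero.2 h0))
        · by_cases h0 : f j x = 0
          · simp [h0]
          · have := ((hr j).mem_iff x (hmem h0)).1 hx
            have := f.nonneg j x
            rw [smul_eq_mul]; nlinarith
        · have := ((hr i).mem_iff x (hmem hi.ne')).1 hx
          rw [smul_eq_mul]; nlinarith
      rw [finsum_neg_distrib] at h1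
      exact neg_pos.1 h1
    · intro hx
      by_contra hxΩ
      refine hx.not_ge (finsum_nonneg fun j => ?_)
      by_cases h0 : f j x = 0
      · simp [h0]
      · exact mul_nonneg (f.nonneg j x) (not_lt.1 fun h => hxΩ (((hr j).mem_iff x (hmem h0)).2 h))
  have hval : ∀ q, |ambientContact E F ρ ι q (τ q)| = 2 := by
    intro q
    set d : F →L[ℝ] E := mfderiv 𝓘(ℝ, F) 𝓘(ℝ, E) ι q with hd
    set w : E := I • d (τ q) with hw
    set t := f.fintsupport (ι q) with ht
    have hin : ∀ {i}, i ∈ t → ι q ∈ U i := fun {i} hi =>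
      hsupp ((f.mem_fintsupport_iff (ι q) i).1 hi)
    have heq : ρ =ᶠ[𝓝 (ι q)] fun x => ∑ i ∈ t, f i x * r i x := by
      filter_upwards [f.eventually_finsupport_subset (ι q)] with x hx
      refine finsum_eq_sum_of_support_subset _ fun i hi => hx ?_
      rw [f.mem_finsupport]
      exact fun h0 => hi (by simp [h0])
    have hfm : ∀ i, MDifferentiableAt 𝓘(ℝ, E) 𝓘(ℝ, ℝ) (f i) (ι q) := fun i =>
      (f i).contMDiff.mdifferentiableAt (by simp)
    have hrm : ∀ i ∈ t, MDifferentiableAt 𝓘(ℝ, E) 𝓘(ℝ, ℝ) (r i) (ι q) := fun i hi =>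
      ((hr i).contMDiffAt (hin hi)).mdifferentiableAt (by simp)
    -- All summands vanish on the boundary, so the derivatives of the partition functions drop out.
    have hsum : mdir E ρ (ι q) w = ∑ i ∈ t, f i (ι q) * mdir E (r i) (ι q) w := by
      rw [mdir_congr heq, mdir_finsetSum t (f := fun i x => f i x * r i x)
        (fun i hi => (hfm i).mul (hrm i hi))]
      exact Finset.sum_congr rfl fun i hi =>
        mdir_mul_of_eq_zero (hfm i) (hrm i hi) ((hr i).eq_zero hΩ (hfr q) (hin hi)) w
    have hone : ∑ i ∈ t, f i (ι q) = 1 :=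
      f.sum_finsupport' (ι q) (mem_univ _) (f.finsupport_subset_fintsupport (ι q))
    have hj := hxU (ι q)
    have hvj : |mdir E (r (ι q)) (ι q) w| = 2 := hrτ _ q hj
    -- The values are ±2, and differentials of defining functions at a boundary point have
    -- compatible signs, so all values agree and their average has absolute value 2.
    have hsame : ∀ i ∈ t, mdir E (r i) (ι q) w = mdir E (r (ι q)) (ι q) w := by
      intro i hi
      have hvi : |mdir E (r i) (ι q) w| = 2 := hrτ _ q (hin hi)
      rcases (abs_eq zero_le_two).1 hvj with k | k <;> rcases (abs_eq zero_le_two).1 hvi with k' | k'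
      · rw [k, k']
      · have := (hr (ι q)).mdir_nonneg_of_pos (hr i) hΩ (hfr q) hj (hin hi) (w := w)
          (by rw [k]; norm_num)
        rw [k'] at this; norm_num at this
      · have := (hr i).mdir_nonneg_of_pos (hr (ι q)) hΩ (hfr q) (hin hi) hj (w := w)
          (by rw [k']; norm_num)
        rw [k] at this; norm_num at this
      · rw [k, k']
    have hfinal : mdir E ρ (ι q) w = mdir E (r (ι q)) (ι q) w := by
      rw [hsum, Finset.sum_congr rfl fun i hi => by rw [hsame i hi], ← Finset.sum_mul, hone, one_mul]
    exact (congrArg abs hfinal).trans hvj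
  refine ⟨ρ, ⟨isOpen_univ, hρs.contMDiffOn, fun x _ => hdef x, fun x hx h0 => ?_⟩, hval⟩
  obtain ⟨q, rfl⟩ := hιΩ.symm ▸ hx.1
  have h1 := hval q
  have h2 : ambientContact E F ρ ι q (τ q) = 0 := DFunLike.congr_fun h0 _
  rw [h2, abs_zero] at h1
  norm_num at h1

end Gluing

/-! ### From positivity on the null space to strictly plurisubharmonic powers. -/

section FromBoundary

open Filter Topology Complex

section

variable {E : Type*} [NormedAddCommGroup E] [NormedSpace ℂ E]
  {F : Type*} [NormedAddCommGroup F] [NormedSpace ℝ F]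
  {M : Type*} [TopologicalSpace M] [ChartedSpace F M]
  {T10 : (p : M) → Set (CTangent F p)} {g : M → E} {r : E → ℝ} {p : M}
  [IsManifold 𝓘(ℝ, F) ∞ M] {η : (p : M) → TangentSpace 𝓘(ℝ, F) p →L[ℝ] ℂ}
  {T : (p : M) → CTangent F p}

/-- A complex tangential real vector is the mean of a (1,0)-vector and its conjugate, and η
annihilates both. -/
lemma LocalCR.apply_eq_zero_of_contact (h : LocalCR T10 g r p) (hη : IsTrivialization T10 η)
    {v : F} (hv : contact F r g p v = 0) : (η p : F →L[ℝ] ℂ) v = 0 := by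
  obtain ⟨v', hv'⟩ := (h.range_iff.self_of_nhds (-(I • mdir F g p v))).1 (by
    rw [map_neg, neg_eq_zero]; exact hv)
  have hz : ((v, v') : CTangent F p) ∈ T10 p := (h.mem_iff.self_of_nhds _).2 hv'
  have h1 : (η p : F →L[ℝ] ℂ) v + I * (η p : F →L[ℝ] ℂ) v' = 0 := hη.annihilates p _ hz
  have h2 : (η p : F →L[ℝ] ℂ) v + I * (η p : F →L[ℝ] ℂ) (-v') = 0 := hη.annihilates_conj p _ hz
  have h3 : (η p : F →L[ℝ] ℂ) (-v') = -(η p : F →L[ℝ] ℂ) v' := map_neg (η p : F →L[ℝ] ℂ) v'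
  rw [h3] at h2
  linear_combination (h1 + h2) / 2

lemma IsTransversal.apply_snd (hT : IsTransversal η T) (p : M) :
    (η p : F →L[ℝ] ℂ) (T p).2 = -I := by
  have h1 : (η p : F →L[ℝ] ℂ) (T p).1 + I * (η p : F →L[ℝ] ℂ) (T p).2 = 1 := hT.normalized p
  have h2 : (η p : F →L[ℝ] ℂ) (T p).1 = 0 :=
    (congrArg (η p : F →L[ℝ] ℂ) (hT.imaginary p)).trans (map_zero (η p : F →L[ℝ] ℂ))
  rw [h2, zero_add] at h1
  linear_combination (-I) * h1 + (η p : F →L[ℝ] ℂ) (T p).2 * I_mul_I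

lemma LocalCR.contact_transversal_ne_zero (h : LocalCR T10 g r p) (hη : IsTrivialization T10 η)
    (hT : IsTransversal η T) : contact F r g p (T p).2 ≠ 0 := fun h0 => by
  have h1 := (hT.apply_snd p).symm.trans (h.apply_eq_zero_of_contact hη h0)
  simp at h1

/-- Every v differs from a multiple of τ by a vector in the kernel of the contact form, where η
vanishes too. Hence η is fixed by its value -i on τ. -/
lemma LocalCR.isContactAt (h : LocalCR T10 g r p) (hη : IsTrivialization T10 η)
    (hT : IsTransversal η T) {s : ℝ} (hs : s ^ 2 = 1)
    (hc : ∀ᶠ q in 𝓝 p, contact F r g q (T q).2 = 2 * s) : IsContactAt η g r s p := by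
  filter_upwards [h.eventually, hc] with q hq hcq v
  set τ : F := (T q).2 with hτ
  have hsmul : ∀ c : ℝ, contact F r g q (c • τ) = c * contact F r g q τ := fun c => by
    simp only [contact, map_smul, smul_comm I c, smul_eq_mul]
  have h1 := hq.apply_eq_zero_of_contact hη (v := v - (s / 2 * contact F r g q v) • τ) (by
    rw [contact_sub, hsmul, hcq]
    linear_combination (-contact F r g q v) * hs)
  have h2 : (η q : F →L[ℝ] ℂ) τ = -I := hT.apply_snd q
  have h3 : (η q : F →L[ℝ] ℂ) (v - (s / 2 * contact F r g q v) • τ) = (η q : F →L[ℝ] ℂ) v -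
      (s / 2 * contact F r g q v) • (η q : F →L[ℝ] ℂ) τ :=
    (map_sub (η q : F →L[ℝ] ℂ) _ _).trans
      (congrArg _ (map_smul (η q : F →L[ℝ] ℂ) (s / 2 * contact F r g q v) τ))
  rw [h3, h2, sub_eq_zero] at h1
  rw [h1, Complex.real_smul]
  push_cast
  ring

end

variable {E : Type*} [NormedAddCommGroup E] [NormedSpace ℂ E]
  {X : Type*} [TopologicalSpace X] [ChartedSpace E X] [IsManifold 𝓘(ℂ, E) ω X]
  {Ω U : Set X} {ρ : X → ℝ}

/-- Near the boundary, a defining function vanishes only on the boundary. -/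
lemma IsDefiningFunctionOn.eventually_mem_frontier (hρ : IsDefiningFunctionOn E Ω U ρ)
    {x : X} (hx : x ∈ frontier Ω) (hxU : x ∈ U) : ∀ᶠ y in 𝓝 x, ρ y = 0 → y ∈ frontier Ω := by
  set φ := extChartAt 𝓘(ℝ, E) x with hφ
  have hr : ContDiffAt ℝ ∞ (chartFun E ρ x) (φ x) :=
    contDiffAt_comp_extChartAt_symm le_rfl (mem_chart_source E x) (hρ.contMDiffAt hxU)
  have hc : ContinuousAt (fun y => fderiv ℝ (chartFun E ρ x) (φ y)) x :=
    ContinuousAt.comp (hr.fderiv_right (m := 0) (by simp)).continuousAt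
      (continuousAt_extChartAt x)
  filter_upwards [hc.eventually (isOpen_ne.mem_nhds
      (fderiv_chartFun_ne_zero hρ (mem_chart_source E x) hxU hx)), hρ.isOpen.mem_nhds hxU,
    (chartAt E x).open_source.mem_nhds (mem_chart_source E x)] with y h1 h2 h3 h4
  have hyΩ : y ∉ Ω := fun h => by
    have := (hρ.mem_iff y h2).1 h
    linarith
  -- A zero of ρ outside the closure of Ω would be a local minimum, since ρ ≥ 0 around it; near the
  -- boundary this contradicts dρ ≠ 0.
  refine ⟨?_, fun h => hyΩ (interior_subset h)⟩
  by_contra hcl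
  refine h1 (IsLocalMin.fderiv_eq_zero ?_)
  have h3' : y ∈ φ.source := by simpa [φ] using h3
  have hev : ∀ᶠ y' in 𝓝 y, 0 ≤ ρ y' := by
    filter_upwards [isClosed_closure.isOpen_compl.mem_nhds hcl, hρ.isOpen.mem_nhds h2] with y' k1 k2
    exact not_lt.1 fun k => k1 (subset_closure ((hρ.mem_iff y' k2).2 k))
  have hcs : ContinuousAt φ.symm (φ y) := continuousAt_extChartAt_symm' h3'
  have e : φ.symm (φ y) = y := φ.left_inv h3'
  refine (hcs.eventually (by rw [e]; exact hev)).mono fun z hz => ?_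
  have : chartFun E ρ x (φ y) = 0 := (congrArg ρ e).trans h4
  rw [this]
  exact hz

variable {F : Type*} [NormedAddCommGroup F] [NormedSpace ℝ F] [FiniteDimensional ℝ F]
  [FiniteDimensional ℂ E] {M : Type*} [TopologicalSpace M] [ChartedSpace F M]
  [IsManifold 𝓘(ℝ, F) ∞ M] {ι : M → X}

/-- If the index form is positive on the Levi null space, a power of a suitable defining function
is strictly plurisubharmonic on one side of the boundary. -/
theorem strictPsh_of_positiveOnNull [T2Space X] [SigmaCompactSpace X] [T2Space M]
    [SigmaCompactSpace M]
    (hF : Module.finrank ℝ F + 1 = Module.finrank ℝ E) (hΩ : IsOpen Ω)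
    (hι : IsSmoothEmbedding 𝓘(ℝ, F) 𝓘(ℝ, E) ∞ ι) (hιΩ : range ι = frontier Ω)
    (hΩs : HasSmoothBoundary E Ω) (hpsc : HasPseudoconvexBoundary E Ω)
    {s κ γ c : ℝ} (hs : s ^ 2 = 1) (hκ : 0 < κ) (hγ : γ = 1 - s * κ) (hγ0 : 0 < γ)
    (hc : c = 1 / κ - s) (hP : PositiveOnNull (inducedCR E (F := F) ι) s c) :
    ∃ ρ, IsDefiningFunctionOn E Ω univ ρ ∧ ∃ W, IsOpen W ∧ frontier Ω ⊆ W ∧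
      (∀ y ∈ W, ρ y = 0 → y ∈ frontier Ω) ∧
      StrictPshOn (E := E) (fun y => -s * (-(s * ρ y)) ^ γ) ({y | s * ρ y < 0} ∩ W) := by
  obtain ⟨η, T, σ, ⟨hη, -⟩, hT, hσ, hpos⟩ := hP
  have hιs := hι.contMDiff
  have hfr : ∀ q, ι q ∈ frontier Ω := fun q => hιΩ ▸ mem_range_self q
  have hsec := exists_isSection hF hΩ hι hιΩ hΩs
  -- The field τ is the imaginary part of T. Its contact value is nonzero for every local defining
  -- function, because η(τ) = -i.
  obtain ⟨ρ, hρ, hρ2⟩ := exists_normalized_global (τ := fun q => (T q).2) hF hΩ hι hιΩ hΩs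
    (fun q => hT.smooth.snd q) (fun U ρ hρ q hq => by
      have e := contact_eq_ambientContact (p := q) ((hιs q).mdifferentiableAt (by simp))
        (mem_chart_source E (ι q)) ((hρ.contMDiffAt hq).mdifferentiableAt (by simp)) (T q).2
      exact fun h0 => (localCR_of_isDefiningFunctionOn hF hΩ hι hιΩ hρ
        hq).contact_transversal_ne_zero hη hT (e.trans h0))
  have hcr := fun p => localCR_of_isDefiningFunctionOn hF hΩ hι hιΩ hρ (mem_univ (ι p))
  have hct : ∀ p, ∃ t : ℝ, t ^ 2 = 1 ∧
      IsContactAt η (chartMap E ι p) (chartFun E ρ (ι p)) t p := by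
    intro p
    have hcont := (contMDiffAt_ambientContact (τ := fun q => (T q).2) hF hΩ hι hιΩ
      (fun q => hT.smooth.snd q) hρ (mem_univ (ι p))).continuousAt
    -- The contact value is continuous and takes only the values ±2, so its sign is locally
    -- constant.
    have hev : ∀ t : ℝ, t ^ 2 = 1 → ambientContact E F ρ ι p (T p).2 = 2 * t →
        ∀ᶠ q in 𝓝 p, ambientContact E F ρ ι q (T q).2 = 2 * t := by
      intro t ht h0
      have h1 : 0 < t * ambientContact E F ρ ι p (T p).2 := by rw [h0]; nlinarith
      filter_upwards [(hcont.const_mul t).eventually (lt_mem_nhds h1)] with q hq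
      rcases (abs_eq zero_le_two).1 (hρ2 q) with k | k <;> rw [k] at hq ⊢ <;>
        rcases sq_eq_one_iff.1 ht with rfl | rfl <;> linarith
    obtain ⟨t, ht, h0⟩ : ∃ t : ℝ, t ^ 2 = 1 ∧ ambientContact E F ρ ι p (T p).2 = 2 * t := by
      rcases (abs_eq zero_le_two).1 (hρ2 p) with k | k
      · exact ⟨1, by norm_num, k.trans (by norm_num)⟩
      · exact ⟨-1, by norm_num, k.trans (by norm_num)⟩
    refine ⟨t, ht, (hcr p).isContactAt hη hT ht ?_⟩
    filter_upwards [hev t ht h0, eventually_mem_chart_source (E := E) (hιs p).continuousAt]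
      with q h1 h2
    exact (contact_eq_ambientContact ((hιs q).mdifferentiableAt (by simp)) h2
      ((hρ.contMDiffAt (mem_univ _)).mdifferentiableAt (by simp)) _).trans h1
  have hnear : ∀ x ∈ frontier Ω, ∀ᶠ y in 𝓝 x, s * ρ y < 0 → ∀ v : E, v ≠ 0 →
      0 < complexHessian (fun y => -s * (-(s * ρ y)) ^ γ) y v := by
    intro x hx
    obtain ⟨p, rfl⟩ := hιΩ.symm ▸ hx
    obtain ⟨t, ht, hcp⟩ := hct p
    obtain ⟨h1, h2⟩ := (hcr p).fderiv_transv hcp ht hT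
    have hr4 : ContDiffAt ℝ 4 (chartFun E ρ (ι p)) (chartMap E ι p p) :=
      (hcr p).smooth_r.self_of_nhds.of_le (by
        have : ((4 : ℕ∞) : WithTop ℕ∞) ≤ ((⊤ : ℕ∞) : WithTop ℕ∞) := WithTop.coe_le_coe.2 le_top
        exact this)
    have hval : ∀ {y}, y ∈ (chartAt E (ι p)).source →
        chartFun E ρ (ι p) (extChartAt 𝓘(ℝ, E) (ι p) y) = ρ y := fun {y} hy => by
      simp only [chartFun, Function.comp]
      rw [(extChartAt 𝓘(ℝ, E) (ι p)).left_inv (by simpa using hy)]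
    have hsrc := (chartAt E (ι p)).open_source.mem_nhds (mem_chart_source E (ι p))
    have main := eventually_powerHess_pos (s := s) (κ := κ) hr4 (by
        rw [chartFun_chartMap ρ (mem_chart_source E (ι p)), hρ.eq_zero hΩ (hfr p) (mem_univ _)])
      h1 h2 hs hκ (by
        rw [chartMap, ← map_extChartAt_nhds_of_boundaryless (I := 𝓘(ℝ, E)) (ι p), eventually_map]
        filter_upwards [hsrc, hρ.eventually_mem_frontier (hfr p) (mem_univ _)] with y k1 k2 k3 v hv
        rw [hval k1] at k3
        exact hermPart_nonneg_of_pseudoconvex hpsc hρ k1 (k2 k3) (mem_univ _) hv)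
      (by
        -- A null vector in the chart is the image of the real part of a section that is Levi null
        -- and nonzero at p, so the hypothesis on M applies.
        intro u hu hu0 hnull
        obtain ⟨a1, a2⟩ := (delPart_eq_zero_iff _ _).1 hu0
        obtain ⟨z, hz, rfl⟩ := (hcr p).exists_mem a1 a2
        obtain ⟨L, hL, rfl⟩ := hsec p z hz
        have hLnull := ((hcr p).leviNull_iff hcp ht (hsec p) hz).2 fun w w1 w2 =>
          hnull w ((delPart_eq_zero_iff _ _).2 ⟨w1, w2⟩)
        have hi := hpos L hL p hLnull fun h0 => hu (by
          have e : (L p).1 = (0 : F) := congrArg Prod.fst h0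
          exact (congrArg (mdir F (chartMap E ι p) p) e).trans (map_zero _))
        rwa [(hcr p).indexForm_eq hcp ht hT hσ (hsec p) hL hLnull hc] at hi)
    rw [chartMap, ← map_extChartAt_nhds_of_boundaryless (I := 𝓘(ℝ, E)) (ι p), eventually_map] at main
    filter_upwards [main, hsrc] with y k1 k2 k3 v hv
    rw [complexHessian_rpow k2 hs hγ (hρ.contMDiffAt (mem_univ _)) k3]
    have h7 : 0 < γ * (-(s * ρ y)) ^ (γ - 1) :=
      mul_pos hγ0 (Real.rpow_pos_of_pos (by linarith) _)
    have hv' : chartDeriv E (ι p) y v ≠ 0 := fun h0 =>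
      hv ((chartDeriv_bijective k2).1 (h0.trans (map_zero _).symm))
    have := mul_pos h7 (k1 (by rwa [hval k2]) _ hv')
    linarith
  -- The interior of the set where both local conclusions hold contains the boundary, as each
  -- conclusion holds in a neighborhood of every boundary point.
  refine ⟨ρ, hρ, interior {y | (s * ρ y < 0 → ∀ v : E, v ≠ 0 →
      0 < complexHessian (fun y => -s * (-(s * ρ y)) ^ γ) y v) ∧ (ρ y = 0 → y ∈ frontier Ω)},
    isOpen_interior, fun x hx => mem_interior_iff_mem_nhds.2
      ((hnear x hx).and (hρ.eventually_mem_frontier hx (mem_univ x))),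
    fun y hy => (interior_subset hy).2, fun y hy => ?_, fun y hy => (interior_subset hy.2).1 hy.1⟩
  exact (contMDiffAt_rpow_side (hρ.contMDiffAt (mem_univ _)) hy.1).contMDiffWithinAt

end FromBoundary

/-! ### The two implications on each side of the boundary. -/

section Comparison

open Filter Topology Complex

section

variable {E : Type*} [NormedAddCommGroup E] [NormedSpace ℂ E]
  {X : Type*} [TopologicalSpace X] [ChartedSpace E X]
  {F : Type*} [NormedAddCommGroup F] [NormedSpace ℝ F]
  {M : Type*} [TopologicalSpace M] [ChartedSpace F M] {ι : M → X} {Ω : Set X}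

lemma StrictPshOn.pshOn {u : X → ℝ} {S : Set X} (h : StrictPshOn (E := E) u S) :
    PshOn (E := E) u S := by
  refine ⟨h.1, fun x hx v => ?_⟩
  by_cases hv : v = 0
  · subst hv
    simp [complexHessian]
  · exact (h.2 x hx v hv).le

lemma StrictPshOn.mono {u : X → ℝ} {S S' : Set X} (h : StrictPshOn (E := E) u S) (hS : S' ⊆ S) :
    StrictPshOn (E := E) u S' :=
  ⟨h.1.mono hS, fun x hx => h.2 x (hS hx)⟩

lemma compactSpace_of_isEmbedding [T2Space X] (hι : IsEmbedding ι) (hιΩ : range ι = frontier Ω)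
    (hc : IsCompact (closure Ω)) : CompactSpace M := by
  have h : IsCompact (range ι) := hιΩ ▸ hc.of_isClosed_subset isClosed_frontier frontier_subset_closure
  rw [← image_univ] at h
  exact isCompact_univ_iff.1 (hι.isCompact_iff.2 h)

end

variable {E : Type*} [NormedAddCommGroup E] [NormedSpace ℂ E] [FiniteDimensional ℂ E]
  {X : Type*} [TopologicalSpace X] [ChartedSpace E X] [IsManifold 𝓘(ℂ, E) ω X]
  {F : Type*} [NormedAddCommGroup F] [NormedSpace ℝ F] [FiniteDimensional ℝ F]
  {M : Type*} [TopologicalSpace M] [ChartedSpace F M] [IsManifold 𝓘(ℝ, F) ∞ M]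
  [T2Space M] [SigmaCompactSpace M] {ι : M → X} {Ω : Set X} {γ : ℝ}

lemma nonnegOnNull_of_psh_inside (hF : Module.finrank ℝ F + 1 = Module.finrank ℝ E)
    (hΩ : IsOpen Ω) (hι : IsSmoothEmbedding 𝓘(ℝ, F) 𝓘(ℝ, E) ∞ ι) (hιΩ : range ι = frontier Ω)
    (hΩs : HasSmoothBoundary E Ω) (hpsc : HasPseudoconvexBoundary E Ω) (h0 : 0 < γ) (h1 : γ < 1)
    {ρ : X → ℝ} (hρ : IsDefiningFunctionOn E Ω univ ρ) {W : Set X} (hW : IsOpen W)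
    (hΩW : frontier Ω ⊆ W) (h : PshOn (E := E) (fun x => -(-ρ x) ^ γ) (Ω ∩ W)) :
    NonnegOnNull (inducedCR E (F := F) ι) 1 (γ / (1 - γ)) := by
  have h2 : 1 - γ ≠ 0 := by linarith
  -- Here 1/κ - s = 1/(1-γ) - 1 = γ/(1-γ).
  refine nonnegOnNull_of_psh (s := 1) (κ := 1 - γ) (γ := γ) (S := Ω ∩ W) hF hΩ hι hιΩ hΩs hpsc hρ
    (by norm_num) (by linarith) (by ring) h0 (by field_simp; ring) (by simpa using h) fun x hx => ?_
  filter_upwards [hW.mem_nhds (hΩW hx)] with y hy hlt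
  exact ⟨(hρ.mem_iff y (mem_univ y)).2 (by linarith), hy⟩

lemma nonnegOnNull_of_psh_outside (hF : Module.finrank ℝ F + 1 = Module.finrank ℝ E)
    (hΩ : IsOpen Ω) (hι : IsSmoothEmbedding 𝓘(ℝ, F) 𝓘(ℝ, E) ∞ ι) (hιΩ : range ι = frontier Ω)
    (hΩs : HasSmoothBoundary E Ω) (hpsc : HasPseudoconvexBoundary E Ω) (h1 : 1 < γ)
    {ρ : X → ℝ} (hρ : IsDefiningFunctionOn E Ω univ ρ) {W : Set X} (hW : IsOpen W)
    (hΩW : frontier Ω ⊆ W) (h : PshOn (E := E) (fun x => ρ x ^ γ) ((closure Ω)ᶜ ∩ W)) :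
    NonnegOnNull (inducedCR E (F := F) ι) (-1) (γ / (γ - 1)) := by
  have h2 : γ - 1 ≠ 0 := by linarith
  -- Here 1/κ - s = 1/(γ-1) + 1 = γ/(γ-1).
  refine nonnegOnNull_of_psh (s := -1) (κ := γ - 1) (γ := γ) (S := (closure Ω)ᶜ ∩ W) hF hΩ hι hιΩ
    hΩs hpsc hρ (by norm_num) (by linarith) (by ring) (by linarith) (by field_simp; ring)
    (by simpa using h) fun x hx => ?_
  filter_upwards [hW.mem_nhds (hΩW hx)] with y hy hlt
  refine ⟨fun hcl => ?_, hy⟩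
  by_cases hyΩ : y ∈ Ω
  · have := (hρ.mem_iff y (mem_univ y)).1 hyΩ
    linarith
  · have := hρ.eq_zero hΩ (x := y) ⟨hcl, by rwa [hΩ.interior_eq]⟩ (mem_univ y)
    linarith

variable [T2Space X] [SigmaCompactSpace X]

lemma strictPsh_inside_of_positiveOnNull (hF : Module.finrank ℝ F + 1 = Module.finrank ℝ E)
    (hΩ : IsOpen Ω) (hι : IsSmoothEmbedding 𝓘(ℝ, F) 𝓘(ℝ, E) ∞ ι) (hιΩ : range ι = frontier Ω)
    (hΩs : HasSmoothBoundary E Ω) (hpsc : HasPseudoconvexBoundary E Ω) (h0 : 0 < γ) (h1 : γ < 1)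
    (h : PositiveOnNull (inducedCR E (F := F) ι) 1 (γ / (1 - γ))) :
    ∃ ρ, IsDefiningFunctionOn E Ω univ ρ ∧ ∃ W, IsOpen W ∧ frontier Ω ⊆ W ∧
      StrictPshOn (E := E) (fun x => -(-ρ x) ^ γ) (Ω ∩ W) := by
  have h2 : 1 - γ ≠ 0 := by linarith
  obtain ⟨ρ, hρ, W, hW, hΩW, -, hpsh⟩ := strictPsh_of_positiveOnNull (s := 1) (κ := 1 - γ) (γ := γ)
    hF hΩ hι hιΩ hΩs hpsc (by norm_num) (by linarith) (by ring) h0 (by field_simp; ring) h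
  simp only [one_mul, neg_mul] at hpsh
  exact ⟨ρ, hρ, W, hW, hΩW,
    hpsh.mono fun x hx => ⟨(hρ.mem_iff x (mem_univ x)).1 hx.1, hx.2⟩⟩

lemma strictPsh_outside_of_positiveOnNull (hF : Module.finrank ℝ F + 1 = Module.finrank ℝ E)
    (hΩ : IsOpen Ω) (hι : IsSmoothEmbedding 𝓘(ℝ, F) 𝓘(ℝ, E) ∞ ι) (hιΩ : range ι = frontier Ω)
    (hΩs : HasSmoothBoundary E Ω) (hpsc : HasPseudoconvexBoundary E Ω) (h1 : 1 < γ)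
    (h : PositiveOnNull (inducedCR E (F := F) ι) (-1) (γ / (γ - 1))) :
    ∃ ρ, IsDefiningFunctionOn E Ω univ ρ ∧ ∃ W, IsOpen W ∧ frontier Ω ⊆ W ∧
      StrictPshOn (E := E) (fun x => ρ x ^ γ) ((closure Ω)ᶜ ∩ W) := by
  have h2 : γ - 1 ≠ 0 := by linarith
  obtain ⟨ρ, hρ, W, hW, hΩW, hzero, hpsh⟩ := strictPsh_of_positiveOnNull (s := -1) (κ := γ - 1)
    (γ := γ) hF hΩ hι hιΩ hΩs hpsc (by norm_num) (by linarith) (by ring) (by linarith)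
    (by field_simp; ring) h
  simp only [one_mul, neg_mul, neg_neg] at hpsh
  refine ⟨ρ, hρ, W, hW, hΩW, hpsh.mono fun x hx => ⟨?_, hx.2⟩⟩
  have hx1 : 0 ≤ ρ x := not_lt.1 fun k =>
    hx.1 (subset_closure ((hρ.mem_iff x (mem_univ x)).2 k))
  rcases hx1.lt_or_eq with k | k
  -- Outside the closure ρ ≥ 0, and in W its zeros lie on the boundary; so ρ > 0 at the points
  -- considered.
  · exact neg_neg_of_pos k
  · exact (hx.1 (hzero x hx.2 k.symm).1).elim

end Comparison

/-- In ℝ the supremum is monotone here because exponents are bounded by 1 and positive: if the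
smaller set is empty, its supremum 0 is still a lower bound. -/
lemma sSup_mono_of_lt_one {P Q : ℝ → Prop} (h : ∀ γ, 0 < γ → γ < 1 → P γ → Q γ) :
    sSup {γ : ℝ | 0 < γ ∧ γ < 1 ∧ P γ} ≤ sSup {γ : ℝ | 0 < γ ∧ γ < 1 ∧ Q γ} :=
  Real.sSup_le (fun γ hγ => le_csSup ⟨1, fun _ h' => h'.2.1.le⟩ ⟨hγ.1, hγ.2.1, h γ hγ.1 hγ.2.1 hγ.2.2⟩)
    (Real.sSup_nonneg fun _ h' => h'.1.le)

lemma sInf_anti_of_one_lt {P Q : ℝ → Prop} (h : ∀ γ, 1 < γ → P γ → Q γ) :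
    sInf {x : EReal | ∃ γ : ℝ, x = γ ∧ 1 < γ ∧ Q γ} ≤
      sInf {x : EReal | ∃ γ : ℝ, x = γ ∧ 1 < γ ∧ P γ} :=
  sInf_le_sInf fun _ ⟨γ, hx, h1, h2⟩ => ⟨γ, hx, h1, h γ h1 h2⟩

end

theorem mainTheorem1
    {E : Type*} [NormedAddCommGroup E] [NormedSpace ℂ E] [FiniteDimensional ℂ E]
    {X : Type*} [TopologicalSpace X] [T2Space X] [SecondCountableTopology X]
    [ChartedSpace E X] [IsManifold 𝓘(ℂ, E) ω X]
    (Ω : Set X) (hΩ_open : IsOpen Ω) (hΩ_conn : IsConnected Ω) (hΩ_cpt : IsCompact (closure Ω))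
    (hΩ_smooth : HasSmoothBoundary E Ω) (hΩ_psc : HasPseudoconvexBoundary E Ω)
    {F : Type*} [NormedAddCommGroup F] [NormedSpace ℝ F] [FiniteDimensional ℝ F]
    (hF : Module.finrank ℝ F + 1 = Module.finrank ℝ E)
    {M : Type*} [TopologicalSpace M] [ChartedSpace F M] [IsManifold 𝓘(ℝ, F) ∞ M]
    (ι : M → X) (hι : IsSmoothEmbedding 𝓘(ℝ, F) 𝓘(ℝ, E) ∞ ι) (hιΩ : range ι = frontier Ω) :
    (0 ≤ crDFStrong (inducedCR E (F := F) ι) ∧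
      crDFStrong (inducedCR E (F := F) ι) ≤ domainDFStrong E Ω ∧
      domainDFStrong E Ω ≤ domainDFWeak E Ω ∧
      domainDFWeak E Ω ≤ crDFWeak (inducedCR E (F := F) ι) ∧
      crDFWeak (inducedCR E (F := F) ι) ≤ 1) ∧
    (1 ≤ crSteinWeak (inducedCR E (F := F) ι) ∧
      crSteinWeak (inducedCR E (F := F) ι) ≤ domainSteinWeak E Ω ∧
      domainSteinWeak E Ω ≤ domainSteinStrong E Ω ∧
      domainSteinStrong E Ω ≤ crSteinStrong (inducedCR E (F := F) ι) ∧
      crSteinStrong (inducedCR E (F := F) ι) ≤ ⊤) := by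
  have : FiniteDimensional ℝ E := FiniteDimensional.complexToReal E
  have : LocallyCompactSpace X := ChartedSpace.locallyCompactSpace E X
  -- Relative compactness of Ω makes the boundary compact, hence σ-compact, as the partitions of
  -- unity on M require.
  have : CompactSpace M := compactSpace_of_isEmbedding hι.isEmbedding hιΩ hΩ_cpt
  have : T2Space M := hι.isEmbedding.t2Space
  refine ⟨⟨Real.sSup_nonneg fun _ h => h.1.le, sSup_mono_of_lt_one fun γ h0 h1 h => ?_,
    sSup_mono_of_lt_one ?_, sSup_mono_of_lt_one ?_,
    Real.sSup_le (fun _ h => h.2.1.le) zero_le_one⟩,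
    le_sInf ?_, sInf_anti_of_one_lt ?_, sInf_anti_of_one_lt ?_,
    sInf_anti_of_one_lt fun γ h1 h => ?_, le_top⟩
  · exact strictPsh_inside_of_positiveOnNull hF hΩ_open hι hιΩ hΩ_smooth hΩ_psc h0 h1 h
  · rintro γ - - ⟨ρ, hρ, W, hW, hΩW, h⟩
    exact ⟨ρ, hρ, W, hW, hΩW, h.pshOn⟩
  · rintro γ h0 h1 ⟨ρ, hρ, W, hW, hΩW, h⟩
    exact nonnegOnNull_of_psh_inside hF hΩ_open hι hιΩ hΩ_smooth hΩ_psc h0 h1 hρ hW hΩW h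
  · rintro _ ⟨γ, rfl, h1, -⟩
    exact_mod_cast h1.le
  · rintro γ h1 ⟨ρ, hρ, W, hW, hΩW, h⟩
    exact nonnegOnNull_of_psh_outside hF hΩ_open hι hιΩ hΩ_smooth hΩ_psc h1 hρ hW hΩW h
  · rintro γ - ⟨ρ, hρ, W, hW, hΩW, h⟩
    exact ⟨ρ, hρ, W, hW, hΩW, h.pshOn⟩
  · exact strictPsh_outside_of_positiveOnNull hF hΩ_open hι hιΩ hΩ_smooth hΩ_psc h1 h
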